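/- Let $n\ge 2$, let $\mathbb B^n\subset\mathbb C^n$ be the open unit ball with coordinates $z_j=x_j+iy_j$, and let $\alpha\in(0,1)$. Put $$X=\{z\in\mathbb B^n : x_1^2+y_1^2+x_2^2<\alpha^2,\ x_2>0,\ y_2=0,\ x_j=y_j=0 \text{ for } j>2\},\qquad \nu_X=dx_1\wedge dy_1\wedge dx_2 .$$ Notation. Let $\langle z,w\rangle=\sum_j z_j\bar w_j-1$; let $\mathcal K(z,w)=\frac{n!}{\pi^n}(-\langle z,w\rangle)^{-(n+1)}$ be the Bergman kernel of $\mathbb B^n$, $dV=\mathcal K(z,z)\,dV_e$ the invariant volume ($dV_e$ is the Euclidean volume), and $c(\mathbb B^n,k)$ the constant with $c(\mathbb B^n,k)\int_{\mathbb B^n}\mathcal K(z,w)^k\mathcal K(w,z)^k\mathcal K(w,w)^{-k}\,dV(w)=\mathcal K(z,z)^k$. Let $\tau$ be the complex hyperbolic distance, $\cosh^2\frac{\tau(z,w)}2=\frac{\langle z,w\rangle\langle w,z\rangle}{\langle z,z\rangle\langle w,w\rangle}$, and $\mathrm{dist}(A,B)=\inf\{\tau(z,w): z\in A, w\in B\}$.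 The group $SU(n,1)$ acts on $\mathbb B^n$ by fractional-linear transformations; $J(\gamma,z)$ denotes the complex Jacobian of $\gamma$ at $z$. For a discrete subgroup $\Gamma\subset SU(n,1)$ acting freely on $\mathbb B^n$ with $\Gamma\backslash\mathbb B^n$ compact, a unitary representation $\rho:\Gamma\to U(m)$, $j\in\{1,\dots,m\}$ and a positive integer $k$, let $$\Theta_p^{(j;k)}(z)=c(\mathbb B^n,k)\sum_{\gamma\in\Gamma}\rho(\gamma^{-1})\,\mathcal K(\gamma z,p)^k e_j\,J(\gamma,z)^k,\qquad \Theta_X^{(j;k)}(z)=\int_X\Theta_p^{(j;k)}(z)\,\mathcal K(p,p)^{-k/2}\,\nu_X(p),$$ where $e_j$ is the $j$-th standard basis vector of $\mathbb C^m$, and let $(F,G)=\int_{\Gamma\backslash\mathbb B^n}F(z)^T\overline{G(z)}\,\mathcal K(z,z)^{-k}\,dV(z)$. Then: (a) $X$ is a $3$-dimensional CR submanifold of $\mathbb B^n$ (with the complex hyperbolic metric), i.e. $TX$ contains a smooth distribution invariant under the complex structure whose orthogonal complement in $TX$ is mapped by the complex structure into the normal bundle; $X$ is neither totally real nor complex.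 (b) There is a constant $C>0$, depending only on $n$ and $\alpha$, such that for all $\Gamma$, $m$, $\rho$, $j$ as above for which $X$ is contained in a Dirichlet fundamental domain $\mathcal F$ of $\Gamma$ with $\mathrm{dist}(X,\partial\mathcal F)>0$, the following holds for all sufficiently large $k$: the series and the integrals above converge absolutely; $\Theta_X^{(j;k)}$ is holomorphic on $\mathbb B^n$ and satisfies $J(\gamma,z)^k\,\Theta_X^{(j;k)}(\gamma z)=\rho(\gamma)\,\Theta_X^{(j;k)}(z)$ for $\gamma\in\Gamma$, $z\in\mathbb B^n$; and $$(\Theta_X^{(j;k)},\Theta_X^{(j;k)})\le C\,k^{n-2}.$$ In particular $(\Theta_X^{(j;k)},\Theta_X^{(j;k)})$ is not asymptotic, as $k\to\infty$, to $c\,k^{n-\frac32}$ for any constant $c\ne0$. -/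

import Mathlib

noncomputable section

namespace BallForms

open Matrix
open scoped ContDiff ComplexConjugate

/-- The space `ℂⁿ`; its `volume` is the Euclidean (Lebesgue) measure `dx₁ dy₁ ⋯ dxₙ dyₙ`. -/
abbrev Cn (n : ℕ) : Type := Fin n → ℂ

/-- The open unit ball `𝔹ⁿ` of `ℂⁿ` for the Euclidean norm. -/
def ball (n : ℕ) : Set (Cn n) := {z | ∑ i, ‖z i‖ ^ 2 < 1}

/-- `⟨z, w⟩ = z₁ w̄₁ + ⋯ + zₙ w̄ₙ - 1`. -/
def herm {n : ℕ} (z w : Cn n) : ℂ := ∑ i, z i * conj (w i) - 1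

/-- The Bergman kernel of `𝔹ⁿ`: `(n! / πⁿ) (-⟨z, w⟩)^{-(n+1)}`. -/
def kernel {n : ℕ} (z w : Cn n) : ℂ :=
  ((n.factorial : ℂ) / (Real.pi : ℂ) ^ n) * ((-herm z w) ^ (n + 1))⁻¹

/-- The constant `c(𝔹ⁿ, k)`, determined by
`c ∫_𝔹 K(z,w)ᵏ K(w,z)ᵏ K(w,w)⁻ᵏ dV(w) = K(z,z)ᵏ` at `z = 0`, where `dV(w) = K(w,w) dV_e(w)`. -/
def kernelConst (n k : ℕ) : ℂ :=
  kernel (0 : Cn n) 0 ^ k /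
    ∫ w in ball n, kernel 0 w ^ k * kernel w 0 ^ k * (kernel w w ^ k)⁻¹ * kernel w w

/-- The diagonal matrix `σ = diag(1, …, 1, -1)` of size `n + 1`. -/
def sigma (n : ℕ) : Matrix (Fin (n + 1)) (Fin (n + 1)) ℂ :=
  Matrix.diagonal fun i => if i = Fin.last n then -1 else 1

/-- `SU(n,1) = {A ∈ SL(n+1, ℂ) | Aᵀ σ Ā = σ}`. -/
def SU (n : ℕ) : Subgroup (SpecialLinearGroup (Fin (n + 1)) ℂ) where
  carrier := {A | (A : Matrix (Fin (n + 1)) (Fin (n + 1)) ℂ)ᵀ * sigma n *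
    (A : Matrix (Fin (n + 1)) (Fin (n + 1)) ℂ).map (starRingEnd ℂ) = sigma n}
  one_mem' := by simp
  mul_mem' := by
    intro A B hA hB
    obtain ⟨M, hM⟩ := A
    obtain ⟨N, hN⟩ := B
    change Mᵀ * sigma n * M.map (starRingEnd ℂ) = sigma n at hA
    change Nᵀ * sigma n * N.map (starRingEnd ℂ) = sigma n at hB
    change (M * N)ᵀ * sigma n * (M * N).map (starRingEnd ℂ) = sigma n
    rw [Matrix.transpose_mul, Matrix.map_mul]
    calc Nᵀ * Mᵀ * sigma n * (M.map (starRingEnd ℂ) * N.map (starRingEnd ℂ))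
        = Nᵀ * (Mᵀ * sigma n * M.map (starRingEnd ℂ)) * N.map (starRingEnd ℂ) := by
          simp only [Matrix.mul_assoc]
      _ = sigma n := by rw [hA, hB]
  inv_mem' := by
    intro A hA
    obtain ⟨M, hM⟩ := A
    change Mᵀ * sigma n * M.map (starRingEnd ℂ) = sigma n at hA
    change M.adjugateᵀ * sigma n * M.adjugate.map (starRingEnd ℂ) = sigma n
    have h : M * M.adjugate = 1 := by rw [Matrix.mul_adjugate, hM, one_smul]
    generalize M.adjugate = N at *
    have h1 : Nᵀ * Mᵀ = 1 := by rw [← Matrix.transpose_mul, h, Matrix.transpose_one]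
    have h2 : M.map (starRingEnd ℂ) * N.map (starRingEnd ℂ) = 1 := by
      rw [← Matrix.map_mul, h]; simp
    calc Nᵀ * sigma n * N.map (starRingEnd ℂ)
        = Nᵀ * (Mᵀ * sigma n * M.map (starRingEnd ℂ)) * N.map (starRingEnd ℂ) := by rw [hA]
      _ = (Nᵀ * Mᵀ) * sigma n * (M.map (starRingEnd ℂ) * N.map (starRingEnd ℂ)) := by
          simp only [Matrix.mul_assoc]
      _ = sigma n := by rw [h1, h2]; simp

/-- The underlying matrix of an element of `SU(n,1)`. -/
def mat {n : ℕ} (g : SU n) : Matrix (Fin (n + 1)) (Fin (n + 1)) ℂ :=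
  (g : SpecialLinearGroup (Fin (n + 1)) ℂ)

/-- The fractional-linear action of `SU(n,1)` on the ball. -/
def act {n : ℕ} (g : SU n) (z : Cn n) : Cn n := fun i =>
  (∑ j, mat g i.castSucc (Fin.castSucc j) * z j + mat g i.castSucc (Fin.last n)) /
    (∑ j, mat g (Fin.last n) (Fin.castSucc j) * z j + mat g (Fin.last n) (Fin.last n))

/-- The complex Jacobian `J(γ, z)`: the determinant of the complex derivative of `γ` at `z`. -/
def jac {n : ℕ} (g : SU n) (z : Cn n) : ℂ := (fderiv ℂ (act g) z).det

/-- The quotient `Γ \ 𝔹ⁿ` with the quotient topology. -/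
abbrev BallQuotient {n : ℕ} (Γ : Subgroup (SU n)) : Type :=
  Quot fun z w : ball n => ∃ g ∈ Γ, act g z.1 = w.1

/-- `Γ` acts freely on the ball (with `Γ` discrete: the quotient is smooth and the projection
is a covering map). -/
def ActsFreely {n : ℕ} (Γ : Subgroup (SU n)) : Prop :=
  ∀ g ∈ Γ, g ≠ 1 → ∀ z ∈ ball n, act g z ≠ z

/-- The complex hyperbolic distance on the ball:
`cosh² (τ(z,w)/2) = ⟨z,w⟩⟨w,z⟩ / (⟨z,z⟩⟨w,w⟩)`. -/
def hypDist {n : ℕ} (z w : Cn n) : ℝ :=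
  2 * Real.arcosh (Real.sqrt (‖herm z w‖ ^ 2 / (‖herm z z‖ * ‖herm w w‖)))

/-- `dist(A, B) = inf {τ(z,w) | z ∈ A, w ∈ B}` (`∞` if one of the sets is empty). -/
def setDist {n : ℕ} (A B : Set (Cn n)) : ENNReal :=
  ⨅ z ∈ A, ⨅ w ∈ B, ENNReal.ofReal (hypDist z w)

/-- The Dirichlet fundamental domain of `Γ` centred at `p₀`. -/
def dirichlet {n : ℕ} (Γ : Subgroup (SU n)) (p₀ : Cn n) : Set (Cn n) :=
  {z | z ∈ ball n ∧ ∀ g ∈ Γ, g ≠ 1 → hypDist z p₀ < hypDist z (act g p₀)}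

/-- Vector-valued holomorphic automorphic forms of weight `k` for `(ρ, Γ)`:
`J(γ,z)ᵏ F(γ z) = ρ(γ) F(z)`. -/
def IsAutomorphicForm {n m : ℕ} (Γ : Subgroup (SU n)) (ρ : Γ →* unitaryGroup (Fin m) ℂ)
    (k : ℕ) (F : Cn n → Fin m → ℂ) : Prop :=
  DifferentiableOn ℂ F (ball n) ∧
    ∀ g : Γ, ∀ z ∈ ball n, jac g.1 z ^ k • F (act g.1 z) = (ρ g).1 *ᵥ F z

/-- The function `F(z)ᵀ conj(G(z)) K(z,z)⁻ᵏ` times the density `K(z,z)` of the invariant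
volume `dV` with respect to the Euclidean volume. -/
def innerDensity {n m : ℕ} (k : ℕ) (F G : Cn n → Fin m → ℂ) (z : Cn n) : ℂ :=
  (∑ i, F z i * conj (G z i)) * (kernel z z ^ k)⁻¹ * kernel z z

/-- The inner product `(F, G) = ∫_{Γ\𝔹} F(z)ᵀ conj(G(z)) K(z,z)⁻ᵏ dV(z)`, the integral over the
quotient being taken over the Dirichlet fundamental domain centred at `p₀`. -/
def innerProd {n m : ℕ} (Γ : Subgroup (SU n)) (p₀ : Cn n) (k : ℕ)
    (F G : Cn n → Fin m → ℂ) : ℂ :=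
  ∫ z in dirichlet Γ p₀, innerDensity k F G z

/-- The term `ρ(γ⁻¹) T_p(γ z) J(γ,z)ᵏ` of the Poincaré series, where `T_p` has `j`-th component
`K(·,p)ᵏ` and all other components zero. -/
def thetaTerm {n m : ℕ} (Γ : Subgroup (SU n)) (ρ : Γ →* unitaryGroup (Fin m) ℂ)
    (j : Fin m) (k : ℕ) (z p : Cn n) (g : Γ) : Fin m → ℂ :=
  jac g.1 z ^ k • ((ρ g⁻¹).1 *ᵥ Pi.single j (kernel (act g.1 z) p ^ k))

/-- The Poincaré series `Θ_p^{(j;k)}(z) = c(𝔹ⁿ,k) ∑_γ ρ(γ⁻¹) T_p(γ z) J(γ,z)ᵏ`. -/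
def thetaPoint {n m : ℕ} (Γ : Subgroup (SU n)) (ρ : Γ →* unitaryGroup (Fin m) ℂ)
    (j : Fin m) (k : ℕ) (z p : Cn n) : Fin m → ℂ :=
  kernelConst n k • ∑' g : Γ, thetaTerm Γ ρ j k z p g

/-- The integrand `Θ_p^{(j;k)}(z) K(p,p)^{-k/2}`, as a function of `p`. -/
def thetaIntegrand {n m : ℕ} (Γ : Subgroup (SU n)) (ρ : Γ →* unitaryGroup (Fin m) ℂ)
    (j : Fin m) (k : ℕ) (z p : Cn n) : Fin m → ℂ :=
  ((kernel p p).re ^ (-(k : ℝ) / 2)) • thetaPoint Γ ρ j k z p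

/-- `Θ_Λ^{(j;k)}(z) = ∫_Λ Θ_p^{(j;k)}(z) K(p,p)^{-k/2} ν(p)`; the positive volume form `ν` on
the submanifold `Λ` enters as the measure on `ℂⁿ`, concentrated on `Λ`, that it defines. -/
def thetaSub {n m : ℕ} (Γ : Subgroup (SU n)) (ρ : Γ →* unitaryGroup (Fin m) ℂ)
    (j : Fin m) (k : ℕ) (ν : MeasureTheory.Measure (Cn n)) (z : Cn n) : Fin m → ℂ :=
  ∫ p, thetaIntegrand Γ ρ j k z p ∂ν

/-- `X = {x₁² + y₁² + x₂² < α², x₂ > 0, y₂ = 0, x_j = y_j = 0 for j > 2}` in `𝔹ⁿ`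
(the coordinates `z₁, z₂` of the text are those with index `0, 1` in `Fin n`). -/
def halfBall (n : ℕ) (hn : 2 ≤ n) (α : ℝ) : Set (Cn n) :=
  {z | z ∈ ball n ∧
    (z ⟨0, by omega⟩).re ^ 2 + (z ⟨0, by omega⟩).im ^ 2 + (z ⟨1, by omega⟩).re ^ 2 < α ^ 2 ∧
    0 < (z ⟨1, by omega⟩).re ∧ (z ⟨1, by omega⟩).im = 0 ∧ ∀ i : Fin n, 2 ≤ i.1 → z i = 0}

/-- The linear map `(z₁, x₂) ↦ (z₁, x₂, 0, …, 0)`, whose restriction is a global chart of `X`. -/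
def embed (n : ℕ) (w : ℂ × ℝ) : Cn n := fun i =>
  if i.1 = 0 then w.1 else if i.1 = 1 then (w.2 : ℂ) else 0

/-- The measure on `X` defined by `ν_X = dx₁ ∧ dy₁ ∧ dx₂`. -/
def halfBallMeasure (n : ℕ) (α : ℝ) : MeasureTheory.Measure (Cn n) :=
  (MeasureTheory.volume.restrict
    {w : ℂ × ℝ | w.1.re ^ 2 + w.1.im ^ 2 + w.2 ^ 2 < α ^ 2 ∧ 0 < w.2}).map (embed n)

/-- `X` is a smooth embedded submanifold of real dimension `q`. -/
def IsSubmanifold {n : ℕ} (q : ℕ) (X : Set (Cn n)) : Prop :=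
  ∀ p ∈ X, ∃ Φ : OpenPartialHomeomorph (Cn n) (Cn n), p ∈ Φ.source ∧
    ContDiffOn ℝ ∞ Φ Φ.source ∧ ContDiffOn ℝ ∞ Φ.symm Φ.target ∧
    ∃ W : Submodule ℝ (Cn n), Module.finrank ℝ W = q ∧
      Φ '' (Φ.source ∩ X) = Φ.target ∩ (W : Set (Cn n))

/-- The tangent space of a submanifold `X` at `p`, as a real subspace of `ℂⁿ`. -/
def tangentSp {n : ℕ} (X : Set (Cn n)) (p : Cn n) : Submodule ℝ (Cn n) :=
  Submodule.span ℝ (tangentConeAt ℝ X p)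

/-- The complex hyperbolic Riemannian metric on `𝔹ⁿ`, up to a positive constant factor. -/
def hypMetric {n : ℕ} (p v w : Cn n) : ℝ :=
  (((1 - ∑ i, p i * conj (p i)) * (∑ i, v i * conj (w i)) +
    (∑ i, v i * conj (p i)) * (∑ i, p i * conj (w i))) /
      (1 - ∑ i, p i * conj (p i)) ^ 2).re

/-- `D` is a smooth distribution on `X`: a subspace of the tangent space at every point, locally
spanned by a smooth frame. -/
def IsSmoothDistribution {n : ℕ} (X : Set (Cn n)) (D : Cn n → Submodule ℝ (Cn n)) : Prop :=
  (∀ p ∈ X, D p ≤ tangentSp X p) ∧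
    ∃ r : ℕ, ∀ p ∈ X, ∃ U : Set (Cn n), IsOpen U ∧ p ∈ U ∧ ∃ ξ : Fin r → Cn n → Cn n,
      (∀ i, ContDiffOn ℝ ∞ (ξ i) U) ∧ ∀ x ∈ U ∩ X,
        LinearIndependent ℝ (fun i => ξ i x) ∧ D x = Submodule.span ℝ (Set.range fun i => ξ i x)

/-- `X ⊆ 𝔹ⁿ` is a CR submanifold of real dimension `q`: there is a smooth distribution `D` on `X`
that is holomorphic (invariant under the complex structure) and whose orthogonal complement in
`TX` is totally real (mapped by the complex structure into the normal bundle of `X`). -/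
def IsCRSubmanifold {n : ℕ} (q : ℕ) (X : Set (Cn n)) : Prop :=
  X ⊆ ball n ∧ IsSubmanifold q X ∧ ∃ D : Cn n → Submodule ℝ (Cn n), IsSmoothDistribution X D ∧
    ∀ p ∈ X, (∀ v ∈ D p, Complex.I • v ∈ D p) ∧
      ∀ v ∈ tangentSp X p, (∀ u ∈ D p, hypMetric p v u = 0) →
        ∀ u ∈ tangentSp X p, hypMetric p (Complex.I • v) u = 0

/-- `X` is totally real: no tangent space contains a complex line. -/
def IsTotallyReal {n : ℕ} (X : Set (Cn n)) : Prop :=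
  ∀ p ∈ X, ∀ v ∈ tangentSp X p, Complex.I • v ∈ tangentSp X p → v = 0

/-- All tangent spaces of `X` are complex subspaces. -/
def IsComplexSub {n : ℕ} (X : Set (Cn n)) : Prop :=
  ∀ p ∈ X, ∀ v ∈ tangentSp X p, Complex.I • v ∈ tangentSp X p

end BallForms

end

noncomputable section

namespace BallForms

open Matrix MeasureTheory Filter
open scoped ContDiff ComplexConjugate Topology ENNReal

/-! Write `k = l + 1` and `N = (n + 1) k`. Up to an explicit scalar, `Θ_X` is a sum over `γ` of
translates of one function, `waveT`, the integral over `X` of `(-⟨z,p⟩)^{-N} (1 - |p|²)^{N/2}`. On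
the Dirichlet domain the term `γ = 1` dominates, and everything rests on its norm and on the decay
of the other terms.

Term `γ = 1`. The half ball and its density are invariant under rotation of `p₁`, while the kernel
is holomorphic in `p̄₁`. The mean value property therefore replaces `p₁` by `0` in the kernel but
not in the weight (`waveT_eq`). The weight is at most `(1 - t²)^{N/2} exp(-N|p₁|²/2)` with `t = p₂`,
so the complex direction contributes a full Gaussian factor `2π/N` (`enorm_waveT_le`). What is left
is an integral over `t ∈ (0, α)` of `|(1 - t z₂)/√(1 - t²)|^{-N}`, and this base is the denominator
of a hyperbolic translation. After Cauchy–Schwarz in `t`, the invariance of the weighted volume `W =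
∫ (1 - |z|²)^{(n+1)l}` evaluates the square norm for each `t` exactly (`lintegral_waveT_sq_le`). The
result is at most `(2π/N)² α² W`. The normalization multiplies by `1/(κ W²)`
(`innerDensity_thetaSub`), and `W ≥ c k^{-n}` (`weightedVol_ge`), which together give `O(k^{n-2})`
with a constant independent of `Γ`, `ρ` and `j`. Cauchy–Schwarz in `t` need not be sharp: the
exponent is already below `n - 3/2`.

Terms `γ ≠ 1`. If `z` lies in the Dirichlet domain then `γz` does not, so it stays at positive
distance from `X`; there the normalized kernel is bounded by some `θ < 1`
(`exists_kernel_ratio_le`). Two of the `k` powers secure convergence of the series by comparing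
volumes of disjoint translates (`summable_inv_norm_den`), and the rest produce exponential decay
(`exists_norm_tsum_phi_le`). The number of components `m` and the group affect only how large `k`
must be.

For the geometric part, `X` is open in a real linear space `ℂ ⊕ ℝ`. Its complex line is the
holomorphic distribution, and the orthogonal complement is a real line, which is automatically
totally real. -/

/-- The squared Euclidean norm on `ℂⁿ`. -/
def nsq {n : ℕ} (z : Cn n) : ℝ := ∑ i, ‖z i‖ ^ 2

/-- The Euclidean norm on `ℂⁿ`. -/
def nrm {n : ℕ} (z : Cn n) : ℝ := Real.sqrt (nsq z)

/-! ### Euclidean norm and lower bounds for the Hermitian form. -/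

theorem nsq_nonneg {n : ℕ} (z : Cn n) : 0 ≤ nsq z := Finset.sum_nonneg fun _ _ => by positivity

theorem nrm_nonneg {n : ℕ} (z : Cn n) : 0 ≤ nrm z := Real.sqrt_nonneg _

theorem nrm_sq {n : ℕ} (z : Cn n) : nrm z ^ 2 = nsq z := Real.sq_sqrt (nsq_nonneg z)

theorem mem_ball_iff {n : ℕ} {z : Cn n} : z ∈ ball n ↔ nsq z < 1 := Iff.rfl

theorem mem_ball_iff_nrm {n : ℕ} {z : Cn n} : z ∈ ball n ↔ nrm z < 1 := by
  rw [mem_ball_iff, ← nrm_sq, sq_lt_one_iff₀ (nrm_nonneg z)]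

theorem continuous_nsq {n : ℕ} : Continuous (nsq : Cn n → ℝ) := by unfold nsq; fun_prop

theorem continuous_nrm {n : ℕ} : Continuous (nrm : Cn n → ℝ) := continuous_nsq.sqrt

theorem isOpen_ball (n : ℕ) : IsOpen (ball n) :=
  isOpen_lt continuous_nsq continuous_const

theorem norm_le_nrm {n : ℕ} (z : Cn n) : ‖z‖ ≤ nrm z := by
  refine (pi_norm_le_iff_of_nonneg (nrm_nonneg z)).2 fun i => ?_
  refine Real.le_sqrt_of_sq_le ?_
  exact Finset.single_le_sum (f := fun i => ‖z i‖ ^ 2) (fun _ _ => by positivity)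
    (Finset.mem_univ i)

theorem norm_sum_mul_le {n : ℕ} (z w : Cn n) : ‖∑ i, z i * w i‖ ≤ nrm z * nrm w := by
  refine (norm_sum_le _ _).trans ?_
  simp only [norm_mul]
  exact Real.sum_mul_le_sqrt_mul_sqrt Finset.univ (fun i => ‖z i‖) fun i => ‖w i‖

theorem nrm_conj {n : ℕ} (z : Cn n) : nrm (fun i => conj (z i)) = nrm z := by
  simp [nrm, nsq]

theorem norm_sum_mul_conj_le {n : ℕ} (z w : Cn n) :
    ‖∑ i, z i * conj (w i)‖ ≤ nrm z * nrm w := by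
  simpa [nrm_conj] using norm_sum_mul_le z fun i => conj (w i)

theorem sum_mul_conj_self {n : ℕ} (z : Cn n) : ∑ i, z i * conj (z i) = (nsq z : ℂ) := by
  simp [nsq, Complex.mul_conj, Complex.normSq_eq_norm_sq]

theorem herm_self {n : ℕ} (z : Cn n) : herm z z = ((nsq z - 1 : ℝ) : ℂ) := by
  simp [herm, sum_mul_conj_self]

theorem neg_herm_self {n : ℕ} (z : Cn n) : -herm z z = ((1 - nsq z : ℝ) : ℂ) := by
  rw [herm_self]; push_cast; ring

theorem norm_herm_self {n : ℕ} {z : Cn n} (hz : z ∈ ball n) : ‖herm z z‖ = 1 - nsq z := by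
  rw [← norm_neg, neg_herm_self, Complex.norm_real, Real.norm_of_nonneg]
  linarith [mem_ball_iff.1 hz]

theorem one_sub_le_norm_herm {n : ℕ} (z w : Cn n) : 1 - nrm z * nrm w ≤ ‖herm z w‖ := by
  have h := norm_sum_mul_conj_le z w
  have h1 := norm_sub_norm_le (1 : ℂ) (∑ i, z i * conj (w i))
  rw [norm_one] at h1
  rw [herm, norm_sub_rev]
  linarith

theorem norm_herm_le {n : ℕ} (z w : Cn n) : ‖herm z w‖ ≤ 1 + nrm z * nrm w := by
  have h := norm_sum_mul_conj_le z w
  have h1 := norm_sub_le (∑ i, z i * conj (w i)) (1 : ℂ)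
  rw [norm_one] at h1
  rw [herm]
  linarith

theorem nsq_sub {n : ℕ} (z w : Cn n) :
    nsq (z - w) = nsq z + nsq w - 2 * (∑ i, z i * conj (w i)).re := by
  simp only [nsq, Complex.re_sum, Finset.mul_sum, ← Finset.sum_add_distrib,
    ← Finset.sum_sub_distrib, Pi.sub_apply]
  refine Finset.sum_congr rfl fun i _ => ?_
  simp only [← Complex.normSq_eq_norm_sq, Complex.normSq_apply, Complex.sub_re, Complex.sub_im,
    Complex.mul_re, Complex.conj_re, Complex.conj_im]
  ring

/-- The left side is exactly the real part of `-⟨z,w⟩`, by polarization. -/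
theorem half_sum_add_le_norm_herm {n : ℕ} (z w : Cn n) :
    ((1 - nsq z) + (1 - nsq w)) / 2 + nsq (z - w) / 2 ≤ ‖herm z w‖ := by
  have h : (-herm z w).re ≤ ‖-herm z w‖ := Complex.re_le_norm _
  rw [norm_neg] at h
  refine le_trans (le_of_eq ?_) h
  rw [nsq_sub]
  simp [herm]
  ring

/-- `√(1 - |z|²)`. -/
def defect {n : ℕ} (z : Cn n) : ℝ := Real.sqrt (1 - nsq z)

theorem defect_nonneg {n : ℕ} (z : Cn n) : 0 ≤ defect z := Real.sqrt_nonneg _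

theorem defect_sq {n : ℕ} {z : Cn n} (hz : z ∈ ball n) : defect z ^ 2 = 1 - nsq z :=
  Real.sq_sqrt (by linarith [mem_ball_iff.1 hz])

theorem defect_pos {n : ℕ} {z : Cn n} (hz : z ∈ ball n) : 0 < defect z :=
  Real.sqrt_pos.2 (by linarith [mem_ball_iff.1 hz])

theorem defect_le_one {n : ℕ} (z : Cn n) : defect z ≤ 1 :=
  Real.sqrt_le_one.2 (by linarith [nsq_nonneg z])

theorem continuous_defect {n : ℕ} : Continuous (defect : Cn n → ℝ) :=
  (continuous_const.sub continuous_nsq).sqrt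

/-- The inequality between arithmetic and geometric means turns the previous bound into a reverse
Cauchy–Schwarz inequality with a remainder. The remainder `|z-w|²/2` is what later makes the kernel
ratio strictly less than one away from `X`. -/
theorem defect_mul_add_le_norm_herm {n : ℕ} {z w : Cn n} (hz : z ∈ ball n) (hw : w ∈ ball n) :
    defect z * defect w + nsq (z - w) / 2 ≤ ‖herm z w‖ := by
  have h := half_sum_add_le_norm_herm z w
  rw [← defect_sq hz, ← defect_sq hw] at h
  nlinarith [sq_nonneg (defect z - defect w)]

theorem norm_herm_pos {n : ℕ} {z w : Cn n} (hz : z ∈ ball n) (hw : w ∈ ball n) :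
    0 < ‖herm z w‖ := by
  have h := defect_mul_add_le_norm_herm hz hw
  have h1 := mul_pos (defect_pos hz) (defect_pos hw)
  linarith [nsq_nonneg (z - w)]

theorem herm_ne_zero {n : ℕ} {z w : Cn n} (hz : z ∈ ball n) (hw : w ∈ ball n) :
    herm z w ≠ 0 := norm_pos_iff.1 (norm_herm_pos hz hw)

/-! ### The fractional-linear action -/

/-- The denominator of the fractional-linear action. -/
def den {n : ℕ} (g : SU n) (z : Cn n) : ℂ :=
  ∑ j, mat g (Fin.last n) (Fin.castSucc j) * z j + mat g (Fin.last n) (Fin.last n)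

/-- The numerator of the fractional-linear action. -/
def num {n : ℕ} (g : SU n) (z : Cn n) : Cn n := fun i =>
  ∑ j, mat g i.castSucc (Fin.castSucc j) * z j + mat g i.castSucc (Fin.last n)

theorem act_apply {n : ℕ} (g : SU n) (z : Cn n) (i : Fin n) :
    act g z i = num g z i / den g z := rfl

theorem mat_mulVec_snoc {n : ℕ} (g : SU n) (z : Cn n) :
    mat g *ᵥ (Fin.snoc z 1 : Fin (n + 1) → ℂ) = Fin.snoc (num g z) (den g z) := by
  ext i
  refine Fin.lastCases ?_ (fun i => ?_) i
  · simp [Matrix.mulVec, dotProduct, Fin.sum_univ_castSucc, den]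
  · simp [Matrix.mulVec, dotProduct, Fin.sum_univ_castSucc, num]

theorem mat_mul {n : ℕ} (g h : SU n) : mat (g * h) = mat g * mat h := rfl

theorem mat_one {n : ℕ} : mat (1 : SU n) = 1 := rfl

theorem det_mat {n : ℕ} (g : SU n) : (mat g).det = 1 := g.1.2

theorem mat_isometry {n : ℕ} (g : SU n) :
    (mat g)ᵀ * sigma n * (mat g).map (starRingEnd ℂ) = sigma n := g.2

theorem sigma_mul_sigma (n : ℕ) : sigma n * sigma n = 1 := by
  rw [sigma, Matrix.diagonal_mul_diagonal, ← Matrix.diagonal_one]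
  congr 1
  ext i
  split_ifs <;> simp

theorem dotProduct_sigma_mulVec {n : ℕ} (z w : Cn n) (a b : ℂ) :
    (Fin.snoc z a : Fin (n + 1) → ℂ) ⬝ᵥ (sigma n *ᵥ (fun i => conj ((Fin.snoc w b : Fin (n + 1) → ℂ) i)))
      = ∑ i, z i * conj (w i) - a * conj b := by
  simp [sigma, Matrix.mulVec_diagonal, dotProduct, Fin.sum_univ_castSucc,
    Fin.castSucc_ne_last, sub_eq_add_neg]

/-- The matrix preserves the form `σ`, and `(z, 1)` is sent to `(num, den)`. All transformation
rules for `⟨·,·⟩`, for `1 - |z|²` and for the distance come from this identity. -/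
theorem num_den_isometry {n : ℕ} (g : SU n) (z w : Cn n) :
    ∑ i, num g z i * conj (num g w i) - den g z * conj (den g w) = herm z w := by
  have hconj : (fun i => conj ((Fin.snoc (num g w) (den g w) : Fin (n + 1) → ℂ) i)) =
      (mat g).map (starRingEnd ℂ) *ᵥ fun i => conj ((Fin.snoc w 1 : Fin (n + 1) → ℂ) i) := by
    rw [← mat_mulVec_snoc]
    ext i
    simp [Matrix.mulVec, dotProduct]
  rw [← dotProduct_sigma_mulVec, hconj, ← mat_mulVec_snoc, Matrix.mulVec_mulVec,
    Matrix.dotProduct_mulVec, ← Matrix.vecMul_transpose, Matrix.vecMul_vecMul,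
    ← Matrix.dotProduct_mulVec, ← Matrix.mul_assoc, mat_isometry, dotProduct_sigma_mulVec, herm]
  simp

theorem nrm_last_row {n : ℕ} (g : SU n) :
    nsq (fun j => mat g (Fin.last n) (Fin.castSucc j)) = ‖den g 0‖ ^ 2 - 1 := by
  have h := mat_isometry g
  have h1 : ((mat g)ᵀ * sigma n) * ((mat g).map (starRingEnd ℂ) * sigma n) = 1 := by
    rw [← Matrix.mul_assoc, h, sigma_mul_sigma]
  -- A left inverse of a square matrix is a right inverse, which converts the relation between
  -- columns into one between rows; its last diagonal entry is the claim.
  have h2 := mul_eq_one_comm.1 h1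
  have h3 : (mat g).map (starRingEnd ℂ) * sigma n * (mat g)ᵀ = sigma n := by
    have := congrArg (· * sigma n) h2
    simpa [Matrix.mul_assoc, sigma_mul_sigma] using this
  have h4 := congrFun (congrFun h3 (Fin.last n)) (Fin.last n)
  rw [Matrix.mul_apply] at h4
  simp only [sigma, Matrix.mul_diagonal, Matrix.transpose_apply,
    Matrix.map_apply, Fin.sum_univ_castSucc, Fin.castSucc_ne_last, if_false, if_true,
    Matrix.diagonal_apply_eq, mul_one, mul_neg, neg_mul] at h4
  have h5 : ∀ x : ℂ, conj x * x = ((‖x‖ ^ 2 : ℝ) : ℂ) := fun x => by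
    rw [mul_comm, Complex.mul_conj, Complex.normSq_eq_norm_sq]
  simp only [h5] at h4
  have h6 : nsq (fun j => mat g (Fin.last n) (Fin.castSucc j))
      + -‖mat g (Fin.last n) (Fin.last n)‖ ^ 2 = -1 := by
    unfold nsq; exact_mod_cast h4
  have h7 : den g 0 = mat g (Fin.last n) (Fin.last n) := by simp [den]
  rw [h7]; linarith

theorem one_le_norm_den_zero {n : ℕ} (g : SU n) : 1 ≤ ‖den g 0‖ := by
  have h := nrm_last_row g
  have h1 := nsq_nonneg (fun j => mat g (Fin.last n) (Fin.castSucc j))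
  nlinarith [norm_nonneg (den g 0)]

/-- Unitarity makes the last row, without its final entry, shorter than `|den g 0|`, so
Cauchy–Schwarz controls how much the denominator varies. Hence `den g z` is nonzero and comparable
to `den g 0`, with constants that do not depend on `g`. -/
theorem norm_den_sub_le {n : ℕ} (g : SU n) (z : Cn n) :
    ‖den g z - den g 0‖ ≤ ‖den g 0‖ * nrm z := by
  have h : den g z - den g 0 = ∑ j, mat g (Fin.last n) (Fin.castSucc j) * z j := by simp [den]
  rw [h]
  refine (norm_sum_mul_le _ z).trans ?_
  gcongr
  · exact nrm_nonneg z
  · rw [nrm, nrm_last_row]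
    exact Real.sqrt_le_iff.2 ⟨norm_nonneg _, by linarith⟩

theorem le_norm_den {n : ℕ} (g : SU n) (z : Cn n) :
    ‖den g 0‖ * (1 - nrm z) ≤ ‖den g z‖ := by
  have h := norm_den_sub_le g z
  have h1 := norm_sub_norm_le (den g 0) (den g z)
  rw [norm_sub_rev] at h1
  linarith

theorem norm_den_le {n : ℕ} (g : SU n) {z : Cn n} (hz : z ∈ ball n) :
    ‖den g z‖ ≤ 2 * ‖den g 0‖ := by
  have h := norm_den_sub_le g z
  have h1 := norm_sub_norm_le (den g z) (den g 0)
  have h2 := mem_ball_iff_nrm.1 hz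
  have h3 := norm_nonneg (den g 0)
  nlinarith

theorem den_ne_zero {n : ℕ} (g : SU n) {z : Cn n} (hz : z ∈ ball n) : den g z ≠ 0 := by
  have h := le_norm_den g z
  have h1 := one_le_norm_den_zero g
  have h2 := mem_ball_iff_nrm.1 hz
  refine norm_pos_iff.1 (lt_of_lt_of_le ?_ h)
  exact mul_pos (by linarith) (by linarith)

theorem herm_act {n : ℕ} (g : SU n) {z w : Cn n} (hz : z ∈ ball n) (hw : w ∈ ball n) :
    herm (act g z) (act g w) = herm z w / (den g z * conj (den g w)) := by
  have h1 := den_ne_zero g hz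
  have h2 : conj (den g w) ≠ 0 := (map_ne_zero _).2 (den_ne_zero g hw)
  rw [← num_den_isometry g z w, herm, sub_div, div_self (mul_ne_zero h1 h2), Finset.sum_div]
  simp only [act_apply, map_div₀, div_mul_div_comm]

theorem one_sub_nsq_act {n : ℕ} (g : SU n) {z : Cn n} (hz : z ∈ ball n) :
    1 - nsq (act g z) = (1 - nsq z) / ‖den g z‖ ^ 2 := by
  have h := herm_act g hz hz
  rw [Complex.mul_conj, Complex.normSq_eq_norm_sq, herm_self, herm_self,
    ← Complex.ofReal_div] at h
  have h' := Complex.ofReal_injective h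
  rw [← neg_sub, h', ← neg_div, neg_sub]

theorem act_mem_ball {n : ℕ} (g : SU n) {z : Cn n} (hz : z ∈ ball n) : act g z ∈ ball n := by
  rw [mem_ball_iff, ← sub_pos, one_sub_nsq_act g hz]
  exact div_pos (sub_pos.2 hz) (by have := norm_pos_iff.2 (den_ne_zero g hz); positivity)

theorem defect_act {n : ℕ} (g : SU n) {z : Cn n} (hz : z ∈ ball n) :
    defect (act g z) = defect z / ‖den g z‖ := by
  rw [defect, one_sub_nsq_act g hz, Real.sqrt_div' _ (by positivity),
    Real.sqrt_sq (norm_nonneg _), defect]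

theorem snoc_act {n : ℕ} (g : SU n) {z : Cn n} (hz : z ∈ ball n) :
    (Fin.snoc (num g z) (den g z) : Fin (n + 1) → ℂ) =
      den g z • (Fin.snoc (act g z) 1 : Fin (n + 1) → ℂ) := by
  ext i
  refine Fin.lastCases ?_ (fun i => ?_) i
  · simp
  · simp [act_apply, mul_div_cancel₀ _ (den_ne_zero g hz)]

theorem snoc_num_den_mul {n : ℕ} (g h : SU n) {z : Cn n} (hz : z ∈ ball n) :
    (Fin.snoc (num (g * h) z) (den (g * h) z) : Fin (n + 1) → ℂ) =
      den h z • (Fin.snoc (num g (act h z)) (den g (act h z)) : Fin (n + 1) → ℂ) := by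
  rw [← mat_mulVec_snoc, mat_mul, ← Matrix.mulVec_mulVec, mat_mulVec_snoc, snoc_act h hz,
    Matrix.mulVec_smul, mat_mulVec_snoc]

theorem den_mul {n : ℕ} (g h : SU n) {z : Cn n} (hz : z ∈ ball n) :
    den (g * h) z = den h z * den g (act h z) := by
  simpa using congrFun (snoc_num_den_mul g h hz) (Fin.last n)

theorem act_mul {n : ℕ} (g h : SU n) {z : Cn n} (hz : z ∈ ball n) :
    act (g * h) z = act g (act h z) := by
  ext i
  have h1 : num (g * h) z i = den h z * num g (act h z) i := by
    simpa using congrFun (snoc_num_den_mul g h hz) i.castSucc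
  rw [act_apply, act_apply, h1, den_mul g h hz, mul_div_mul_left _ _ (den_ne_zero h hz)]

theorem snoc_one {n : ℕ} (z : Cn n) :
    (Fin.snoc (num 1 z) (den 1 z) : Fin (n + 1) → ℂ) = Fin.snoc z 1 := by
  rw [← mat_mulVec_snoc, mat_one, Matrix.one_mulVec]

theorem den_one {n : ℕ} (z : Cn n) : den 1 z = 1 := by
  simpa using congrFun (snoc_one z) (Fin.last n)

theorem act_one {n : ℕ} (z : Cn n) : act 1 z = z := by
  ext i
  have h : num 1 z i = z i := by simpa using congrFun (snoc_one z) i.castSucc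
  rw [act_apply, h, den_one, div_one]

theorem act_inv_act {n : ℕ} (g : SU n) {z : Cn n} (hz : z ∈ ball n) :
    act g⁻¹ (act g z) = z := by
  rw [← act_mul _ _ hz, inv_mul_cancel, act_one]

theorem act_act_inv {n : ℕ} (g : SU n) {z : Cn n} (hz : z ∈ ball n) :
    act g (act g⁻¹ z) = z := by
  rw [← act_mul _ _ hz, mul_inv_cancel, act_one]

theorem injOn_act {n : ℕ} (g : SU n) : Set.InjOn (act g) (ball n) := fun z hz w hw h => by
  rw [← act_inv_act g hz, h, act_inv_act g hw]

theorem image_act_ball {n : ℕ} (g : SU n) : act g '' ball n = ball n := by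
  refine Set.Subset.antisymm (Set.image_subset_iff.2 fun z hz => act_mem_ball g hz) fun z hz => ?_
  exact ⟨act g⁻¹ z, act_mem_ball _ hz, act_act_inv g hz⟩

/-! ### The Jacobian -/

/-- The derivative of `act g` at `z` as a matrix. -/
def actDeriv {n : ℕ} (g : SU n) (z : Cn n) : Matrix (Fin n) (Fin n) ℂ := fun i j =>
  (mat g i.castSucc j.castSucc - num g z i * (den g z)⁻¹ * mat g (Fin.last n) j.castSucc) *
    (den g z)⁻¹

theorem hasFDerivAt_act {n : ℕ} (g : SU n) {z : Cn n} (hz : z ∈ ball n) :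
    HasFDerivAt (act g) (Matrix.mulVecLin (actDeriv g z)).toContinuousLinearMap z := by
  rw [hasFDerivAt_pi']
  intro i
  have hp : ∀ j : Fin n, HasFDerivAt (fun y : Cn n => y j)
      (ContinuousLinearMap.proj (R := ℂ) (φ := fun _ : Fin n => ℂ) j) z := fun j =>
    hasFDerivAt_apply j z
  have hnum : HasFDerivAt (fun y : Cn n => num g y i) _ z :=
    (HasFDerivAt.fun_sum (u := Finset.univ) fun j _ =>
      (hp j).const_mul (mat g i.castSucc j.castSucc)).add_const (mat g i.castSucc (Fin.last n))
  have hden : HasFDerivAt (fun y : Cn n => den g y) _ z :=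
    (HasFDerivAt.fun_sum (u := Finset.univ) fun j _ =>
      (hp j).const_mul (mat g (Fin.last n) j.castSucc)).add_const (mat g (Fin.last n) (Fin.last n))
  have hd := den_ne_zero g hz
  have hi : HasFDerivAt (fun y : Cn n => (den g y)⁻¹) _ z :=
    (hasDerivAt_inv hd).comp_hasFDerivAt z hden
  have he : (fun y : Cn n => act g y i) = fun y => num g y i * (den g y)⁻¹ := by
    ext y; rw [act_apply, div_eq_mul_inv]
  rw [he]
  refine (hnum.mul hi).congr_fderiv ?_
  ext v
  simp [Matrix.mulVec, dotProduct, actDeriv, sub_mul, Finset.sum_sub_distrib, Finset.mul_sum]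
  rw [neg_add_eq_sub]
  congr 1 <;> exact Finset.sum_congr rfl fun _ _ => by ring

/-- The derivative is `den⁻¹` times the Schur complement of the lower right entry in a matrix
obtained from `mat g` by replacing its last column with `mat g (z, 1)`. That is a unipotent column
operation, so the determinant is still `1`. -/
theorem det_actDeriv {n : ℕ} (g : SU n) {z : Cn n} (hz : z ∈ ball n) :
    (actDeriv g z).det = ((den g z) ^ (n + 1))⁻¹ := by
  have hd := den_ne_zero g hz
  let A : Matrix (Fin n) (Fin n) ℂ := Matrix.of fun i j => mat g i.castSucc j.castSucc
  let B : Matrix (Fin n) (Fin 1) ℂ := Matrix.of fun i _ => num g z i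
  let C : Matrix (Fin 1) (Fin n) ℂ := Matrix.of fun _ j => mat g (Fin.last n) j.castSucc
  let D : Matrix (Fin 1) (Fin 1) ℂ := Matrix.of fun _ _ => den g z
  let B' : Matrix (Fin n) (Fin 1) ℂ := Matrix.of fun i _ => mat g i.castSucc (Fin.last n)
  let D' : Matrix (Fin 1) (Fin 1) ℂ := Matrix.of fun _ _ => mat g (Fin.last n) (Fin.last n)
  let Z : Matrix (Fin n) (Fin 1) ℂ := Matrix.of fun i _ => z i
  have hM : (Matrix.fromBlocks A B' C D').det = 1 := by
    rw [← det_mat g, ← Matrix.det_submatrix_equiv_self finSumFinEquiv (mat g)]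
    congr 1
    ext i j
    rcases i with i | i <;> rcases j with j | j <;>
      simp [A, B', C, D', Fin.castSucc, Subsingleton.elim _ (0 : Fin 1), Fin.last, Fin.natAdd]
  have hmul : Matrix.fromBlocks A B' C D' * Matrix.fromBlocks 1 Z 0 1 =
      Matrix.fromBlocks A B C D := by
    rw [Matrix.fromBlocks_multiply]
    congr 1
    · simp
    · ext i j; simp [Matrix.mul_apply, A, B, B', Z, num]
    · simp
    · ext i j; simp [Matrix.mul_apply, C, D, D', Z, den]
  have hdet : (Matrix.fromBlocks A B C D).det = 1 := by
    rw [← hmul, Matrix.det_mul, hM, Matrix.det_fromBlocks_zero₂₁]; simp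
  have hDdet : D.det = den g z := by simp [D]
  let : Invertible D := Matrix.invertibleOfIsUnitDet _ (by rw [hDdet]; exact hd.isUnit)
  have hinv : ⅟D = Matrix.of fun _ _ => (den g z)⁻¹ := by
    rw [Matrix.invOf_eq_nonsing_inv]
    refine Matrix.inv_eq_right_inv ?_
    ext i j
    obtain rfl := Subsingleton.elim i j
    simp [D, Matrix.mul_apply, hd]
  rw [Matrix.det_fromBlocks₂₂, hDdet] at hdet
  have hS : actDeriv g z = (den g z)⁻¹ • (A - B * ⅟D * C) := by
    ext i j
    rw [hinv]
    simp [actDeriv, A, B, C, Matrix.mul_apply, mul_comm]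
  rw [hS, Matrix.det_smul, Fintype.card_fin, eq_inv_of_mul_eq_one_right hdet, ← inv_pow]
  ring

theorem jac_eq {n : ℕ} (g : SU n) {z : Cn n} (hz : z ∈ ball n) :
    jac g z = ((den g z) ^ (n + 1))⁻¹ := by
  rw [jac, (hasFDerivAt_act g hz).fderiv, ← det_actDeriv g hz, ContinuousLinearMap.det,
    LinearMap.coe_toContinuousLinearMap, ← Matrix.toLin'_apply', LinearMap.det_toLin']

theorem continuousOn_act {n : ℕ} (g : SU n) : ContinuousOn (act g) (ball n) := fun _ hz =>
  (hasFDerivAt_act g hz).continuousAt.continuousWithinAt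

theorem differentiableOn_act {n : ℕ} (g : SU n) : DifferentiableOn ℂ (act g) (ball n) :=
  fun _ hz => (hasFDerivAt_act g hz).differentiableAt.differentiableWithinAt

theorem differentiable_den {n : ℕ} (g : SU n) : Differentiable ℂ (den g) := by
  unfold den; fun_prop

/-- Change of variables for the action of `SU(n,1)` on the ball. -/
theorem lintegral_image_act {n : ℕ} (g : SU n) {A : Set (Cn n)} (hA : MeasurableSet A)
    (hAB : A ⊆ ball n) (f : Cn n → ℝ≥0∞) :
    ∫⁻ x in act g '' A, f x =
      ∫⁻ x in A, ENNReal.ofReal ((‖den g x‖ ^ (2 * (n + 1)))⁻¹) * f (act g x) := by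
  rw [lintegral_image_eq_lintegral_abs_det_fderiv_mul volume hA
    (fun x hx => ((hasFDerivAt_act g (hAB hx)).restrictScalars ℝ).hasFDerivWithinAt)
    ((injOn_act g).mono hAB)]
  refine setLIntegral_congr_fun hA fun x hx => ?_
  have hdet : (((Matrix.mulVecLin (actDeriv g x)).toContinuousLinearMap).restrictScalars ℝ).det =
      (‖den g x‖ ^ (2 * (n + 1)))⁻¹ := by
    have h := LinearMap.det_restrictScalars (R := ℝ) (S := ℂ) (f := (actDeriv g x).mulVecLin)
    rw [← Matrix.toLin'_apply', LinearMap.det_toLin', det_actDeriv g (hAB hx),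
      Algebra.norm_complex_apply, Complex.normSq_eq_norm_sq, norm_inv, norm_pow, inv_pow,
      ← pow_mul, mul_comm] at h
    exact h
  simp only [hdet]
  rw [abs_of_nonneg (by positivity)]

theorem volume_ball_lt_top (n : ℕ) : volume (ball n) < ⊤ := by
  refine (measure_mono (fun z hz => ?_)).trans_lt (measure_ball_lt_top (x := (0 : Cn n)) (r := 1))
  rw [mem_ball_zero_iff]
  exact (norm_le_nrm z).trans_lt (mem_ball_iff_nrm.1 hz)

/-! ### The hyperbolic distance -/

/-- `cosh (τ(z,w)/2)`. -/
def coshHalf {n : ℕ} (z w : Cn n) : ℝ := ‖herm z w‖ / (defect z * defect w)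

theorem one_le_coshHalf {n : ℕ} {z w : Cn n} (hz : z ∈ ball n) (hw : w ∈ ball n) :
    1 ≤ coshHalf z w := by
  rw [coshHalf, one_le_div (mul_pos (defect_pos hz) (defect_pos hw))]
  linarith [defect_mul_add_le_norm_herm hz hw, nsq_nonneg (z - w)]

theorem hypDist_eq {n : ℕ} {z w : Cn n} (hz : z ∈ ball n) (hw : w ∈ ball n) :
    hypDist z w = 2 * Real.arcosh (coshHalf z w) := by
  rw [hypDist, norm_herm_self hz, norm_herm_self hw, ← defect_sq hz, ← defect_sq hw, ← mul_pow,
    ← div_pow, Real.sqrt_sq, coshHalf]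
  exact zero_le_one.trans (one_le_coshHalf hz hw)

theorem hypDist_lt_iff {n : ℕ} {z w z' w' : Cn n} (hz : z ∈ ball n) (hw : w ∈ ball n)
    (hz' : z' ∈ ball n) (hw' : w' ∈ ball n) :
    hypDist z w < hypDist z' w' ↔ coshHalf z w < coshHalf z' w' := by
  rw [hypDist_eq hz hw, hypDist_eq hz' hw', mul_lt_mul_iff_right₀ two_pos,
    Real.arcosh_lt_arcosh (by linarith [one_le_coshHalf hz hw])
      (by linarith [one_le_coshHalf hz' hw'])]

theorem coshHalf_act {n : ℕ} (g : SU n) {z w : Cn n} (hz : z ∈ ball n) (hw : w ∈ ball n) :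
    coshHalf (act g z) (act g w) = coshHalf z w := by
  have h1 := norm_ne_zero_iff.2 (den_ne_zero g hz)
  have h2 := norm_ne_zero_iff.2 (den_ne_zero g hw)
  have h3 := (defect_pos hz).ne'
  have h4 := (defect_pos hw).ne'
  rw [coshHalf, coshHalf, herm_act g hz hw, defect_act g hz, defect_act g hw, norm_div, norm_mul,
    RCLike.norm_conj]
  field_simp

theorem continuousOn_coshHalf_left {n : ℕ} {w : Cn n} (hw : w ∈ ball n) :
    ContinuousOn (fun z => coshHalf z w) (ball n) := by
  refine ContinuousOn.div (Continuous.continuousOn ?_) (Continuous.continuousOn ?_) fun z hz => ?_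
  · unfold herm; fun_prop
  · exact continuous_defect.mul continuous_const
  · exact (mul_pos (defect_pos hz) (defect_pos hw)).ne'

/-! ### Dirichlet domains: disjoint translates, relative compactness, position of `X`. -/

theorem mem_dirichlet_iff {n : ℕ} {Γ : Subgroup (SU n)} {p₀ : Cn n} (hp₀ : p₀ ∈ ball n)
    {z : Cn n} : z ∈ dirichlet Γ p₀ ↔
      z ∈ ball n ∧ ∀ g ∈ Γ, g ≠ 1 → coshHalf z p₀ < coshHalf z (act g p₀) := by
  refine and_congr_right fun hz => forall_congr' fun g => forall_congr' fun _ =>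
    forall_congr' fun _ => hypDist_lt_iff hz hp₀ hz (act_mem_ball g hp₀)

theorem dirichlet_subset_ball {n : ℕ} {Γ : Subgroup (SU n)} {p₀ : Cn n} :
    dirichlet Γ p₀ ⊆ ball n := fun _ h => h.1

/-- If both points were in the domain, invariance of the distance would give `τ(z,p₀) < τ(gz,p₀)`
from `g⁻¹` and the reverse inequality from `g`. -/
theorem act_notMem_dirichlet {n : ℕ} {Γ : Subgroup (SU n)} {p₀ : Cn n} (hp₀ : p₀ ∈ ball n)
    {z : Cn n} (hz : z ∈ dirichlet Γ p₀) {g : SU n} (hg : g ∈ Γ) (h1 : g ≠ 1) :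
    act g z ∉ dirichlet Γ p₀ := by
  intro hgz
  rw [mem_dirichlet_iff hp₀] at hz hgz
  have h2 := hgz.2 g hg h1
  have h3 := hz.2 g⁻¹ (Γ.inv_mem hg) (inv_ne_one.2 h1)
  rw [coshHalf_act g hz.1 hp₀] at h2
  rw [← coshHalf_act g hz.1 (act_mem_ball _ hp₀), act_act_inv g hp₀] at h3
  exact lt_asymm h2 h3

theorem measurableSet_dirichlet {n : ℕ} {Γ : Subgroup (SU n)} [Countable Γ] {p₀ : Cn n}
    (hp₀ : p₀ ∈ ball n) : MeasurableSet (dirichlet Γ p₀) := by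
  have h : dirichlet Γ p₀ = ball n ∩ ⋂ g : Γ, {z | (g : SU n) ≠ 1 →
      coshHalf z p₀ < coshHalf z (act g.1 p₀)} := by
    ext z
    simp only [mem_dirichlet_iff hp₀, Set.mem_inter_iff, Set.mem_iInter, Set.mem_ofPred_eq,
      Subtype.forall]
  have hm : ∀ w : Cn n, Measurable fun z => coshHalf z w := fun w => by
    refine Measurable.div (Continuous.measurable ?_) (Continuous.measurable ?_)
    · unfold herm; fun_prop
    · exact continuous_defect.mul continuous_const
  rw [h]
  refine (isOpen_ball n).measurableSet.inter (MeasurableSet.iInter fun g => ?_)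
  by_cases hg : (g : SU n) = 1
  · simp [hg]
  · simpa [hg] using measurableSet_lt (hm p₀) (hm _)

/-- A cocompact group moves every point of the ball into a fixed smaller ball. -/
theorem exists_nrm_act_lt {n : ℕ} (Γ : Subgroup (SU n)) [CompactSpace (BallQuotient Γ)] :
    ∃ r : ℝ, r < 1 ∧ ∀ z ∈ ball n, ∃ g ∈ Γ, nrm (act g z) < r := by
  have hwd : ∀ r : ℝ, ∀ z w : ball n, (∃ g ∈ Γ, act g z.1 = w.1) →
      (∃ g ∈ Γ, nrm (act g z.1) < r) = ∃ g ∈ Γ, nrm (act g w.1) < r := by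
    rintro r z w ⟨h, hh, hzw⟩
    refine propext ⟨?_, ?_⟩
    · rintro ⟨g, hg, hr⟩
      refine ⟨g * h⁻¹, Γ.mul_mem hg (Γ.inv_mem hh), ?_⟩
      rwa [act_mul _ _ w.2, ← hzw, act_inv_act h z.2]
    · rintro ⟨g, hg, hr⟩
      refine ⟨g * h, Γ.mul_mem hg hh, ?_⟩
      rwa [act_mul _ _ z.2, hzw]
  -- Having some translate of norm less than `r` is a `Γ`-invariant condition, so it defines open
  -- sets of the quotient. They increase with `r < 1` and exhaust it, and compactness picks a single
  -- `r`.
  let P : ℝ → BallQuotient Γ → Prop := fun r =>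
    Quot.lift (fun z : ball n => ∃ g ∈ Γ, nrm (act g z.1) < r) (hwd r)
  have hopen : ∀ r, IsOpen {x | P r x} := by
    intro r
    rw [← isQuotientMap_quot_mk.isOpen_preimage]
    have : Quot.mk _ ⁻¹' {x | P r x} =
        ⋃ g ∈ Γ, {z : ball n | nrm (act g z.1) < r} := by
      ext z
      simp [P]
    rw [this]
    refine isOpen_biUnion fun g _ => ?_
    refine isOpen_lt (continuous_nrm.comp ?_) continuous_const
    exact (continuousOn_act g).domRestrict
  have hcover : (Set.univ : Set (BallQuotient Γ)) ⊆ ⋃ r : Set.Iio (1 : ℝ), {x | P r x} := by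
    rintro ⟨z⟩ -
    obtain ⟨r, hr, hr1⟩ := exists_between (mem_ball_iff_nrm.1 z.2)
    exact Set.mem_iUnion.2 ⟨⟨r, hr1⟩, 1, Γ.one_mem, by rwa [act_one]⟩
  have hdir : Directed (· ⊆ ·) fun r : Set.Iio (1 : ℝ) => {x | P r x} := by
    refine Monotone.directed_le fun r s hrs => ?_
    rintro ⟨z⟩ ⟨g, hg, h⟩
    exact ⟨g, hg, h.trans_le hrs⟩
  have : Nonempty (Set.Iio (1 : ℝ)) := ⟨⟨0, Set.mem_Iio.2 one_pos⟩⟩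
  obtain ⟨r, hr⟩ := isCompact_univ.elim_directed_cover _ (fun r : Set.Iio (1 : ℝ) => hopen r) hcover hdir
  refine ⟨r, r.2, fun z hz => ?_⟩
  exact hr (Set.mem_univ (Quot.mk _ (⟨z, hz⟩ : ball n)))

/-- A Dirichlet domain of a cocompact group is relatively compact in the ball. -/
theorem exists_nrm_le_of_mem_dirichlet {n : ℕ} (Γ : Subgroup (SU n))
    [CompactSpace (BallQuotient Γ)] {p₀ : Cn n} (hp₀ : p₀ ∈ ball n) :
    ∃ r : ℝ, 0 ≤ r ∧ r < 1 ∧ ∀ z ∈ dirichlet Γ p₀, nrm z ≤ r := by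
  obtain ⟨r, hr1, hr⟩ := exists_nrm_act_lt Γ
  have hp := mem_ball_iff_nrm.1 hp₀
  have hr0 : 0 ≤ r := by
    obtain ⟨g, -, hg⟩ := hr p₀ hp₀
    exact (nrm_nonneg _).trans hg.le
  set δ : ℝ := (1 - nrm p₀) * Real.sqrt (1 - r ^ 2) / 2 with hδ
  have hs : 0 < Real.sqrt (1 - r ^ 2) := Real.sqrt_pos.2 (by nlinarith)
  have hδ0 : 0 < δ := by have := sub_pos.2 hp; positivity
  refine ⟨Real.sqrt (1 - δ ^ 2), Real.sqrt_nonneg _, ?_, fun z hz => ?_⟩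
  · rw [Real.sqrt_lt' one_pos]; nlinarith
  have hzb := hz.1
  obtain ⟨g, hg, hgz⟩ := hr z hzb
  have hgb := act_mem_ball g hzb
  -- Among the points of its orbit, `z` is nearest to `p₀`. Comparing it with a translate `gz` in
  -- the fixed smaller ball bounds `1 - |z|²` from below.
  have h1 : coshHalf z p₀ ≤ coshHalf (act g z) p₀ := by
    by_cases h : g = 1
    · rw [h, act_one]
    · have := ((mem_dirichlet_iff hp₀).1 hz).2 g⁻¹ (Γ.inv_mem hg) (inv_ne_one.2 h)
      rw [← coshHalf_act g hzb (act_mem_ball _ hp₀), act_act_inv g hp₀] at this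
      exact this.le
  have h2 : Real.sqrt (1 - r ^ 2) ≤ defect (act g z) := by
    refine Real.sqrt_le_sqrt ?_
    rw [← nrm_sq]
    nlinarith [nrm_nonneg (act g z)]
  have h3 : ‖herm (act g z) p₀‖ ≤ 2 := by
    refine (norm_herm_le _ _).trans ?_
    nlinarith [nrm_nonneg (act g z), nrm_nonneg p₀, mem_ball_iff_nrm.1 hgb]
  have h4 : 1 - nrm p₀ ≤ ‖herm z p₀‖ := by
    refine le_trans ?_ (one_sub_le_norm_herm _ _)
    nlinarith [nrm_nonneg z, nrm_nonneg p₀, mem_ball_iff_nrm.1 hzb]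
  have hdp := defect_pos hp₀
  have hdz := defect_pos hzb
  have hdg := defect_pos hgb
  rw [coshHalf, coshHalf, div_le_div_iff₀ (by positivity) (by positivity)] at h1
  have h5 : ‖herm z p₀‖ * defect (act g z) ≤ ‖herm (act g z) p₀‖ * defect z := by
    refine le_of_mul_le_mul_right ?_ hdp
    linarith
  have h6 : δ ≤ defect z := by
    have h7 : (1 - nrm p₀) * Real.sqrt (1 - r ^ 2) ≤ ‖herm z p₀‖ * defect (act g z) :=
      mul_le_mul h4 h2 hs.le (norm_nonneg _)
    have h8 : ‖herm (act g z) p₀‖ * defect z ≤ 2 * defect z := by gcongr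
    rw [hδ]; linarith
  refine Real.sqrt_le_sqrt ?_
  have := defect_sq hzb
  nlinarith

theorem setDist_le_hypDist {n : ℕ} {A B : Set (Cn n)} {z w : Cn n} (hz : z ∈ A) (hw : w ∈ B) :
    setDist A B ≤ ENNReal.ofReal (hypDist z w) :=
  (iInf₂_le z hz).trans (iInf₂_le w hw)

/-- A subset of a domain at positive distance from the boundary has its closure in the
interior. -/
theorem closure_subset_interior_of_setDist_pos {n : ℕ} {X F : Set (Cn n)} (hX : closure X ⊆ ball n)
    (hXF : X ⊆ F) (hd : 0 < setDist X (frontier F ∩ ball n)) : closure X ⊆ interior F := by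
  intro x hx
  by_contra hxi
  have hxb := hX hx
  have hxf : x ∈ frontier F ∩ ball n := ⟨⟨closure_mono hXF hx, hxi⟩, hxb⟩
  have hcosh : coshHalf x x = 1 := by
    rw [coshHalf, norm_herm_self hxb, ← defect_sq hxb, sq]
    exact div_self (mul_pos (defect_pos hxb) (defect_pos hxb)).ne'
  have hmaps : Set.MapsTo (fun z => coshHalf z x) (ball n) (Set.Ici 1) := fun z hz =>
    one_le_coshHalf hz hxb
  have hc : ContinuousWithinAt (fun z => 2 * Real.arcosh (coshHalf z x)) (ball n) x :=
    ((Real.continuousOn_arcosh.comp (continuousOn_coshHalf_left hxb) hmaps).const_smul (2 : ℝ)) x hxb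
  have hc' : Tendsto (fun z => ENNReal.ofReal (2 * Real.arcosh (coshHalf z x))) (𝓝[X] x)
      (𝓝 0) := by
    have := ENNReal.tendsto_ofReal (hc.mono (subset_closure.trans hX)).tendsto
    simpa [hcosh] using this
  have : (𝓝[X] x).NeBot := mem_closure_iff_nhdsWithin_neBot.1 hx
  refine hd.not_ge (ge_of_tendsto hc' ?_)
  filter_upwards [self_mem_nhdsWithin] with z hz
  rw [← hypDist_eq (hX (subset_closure hz)) hxb]
  exact setDist_le_hypDist hz hxf

/-- Convergence of the Poincaré series `∑ |d_γ|^{-2(n+1)}`, by comparing volumes. -/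
theorem summable_inv_norm_den {n : ℕ} {Γ : Subgroup (SU n)} {p₀ : Cn n} (hp₀ : p₀ ∈ ball n)
    (hF : (interior (dirichlet Γ p₀)).Nonempty) :
    Summable fun g : Γ => (‖den g.1 0‖ ^ (2 * (n + 1)))⁻¹ := by
  set U := interior (dirichlet Γ p₀) with hU
  have hUo : IsOpen U := isOpen_interior
  have hUF : U ⊆ dirichlet Γ p₀ := interior_subset
  have hUB : U ⊆ ball n := hUF.trans dirichlet_subset_ball
  have hUpos : 0 < volume U := hUo.measure_pos _ hF
  have hUfin : volume U < ⊤ := (measure_mono hUB).trans_lt (volume_ball_lt_top n)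
  have hUr : 0 < (volume U).toReal := ENNReal.toReal_pos hUpos.ne' hUfin.ne
  have hmeas : ∀ g : Γ, MeasurableSet (act g.1 '' U) := fun g =>
    measurable_image_of_fderivWithin hUo.measurableSet
      (fun x hx => ((hasFDerivAt_act g.1 (hUB hx)).restrictScalars ℝ).hasFDerivWithinAt)
      ((injOn_act g.1).mono hUB)
  -- The real Jacobian is `|den g x|^{-2(n+1)}`, and `|den g x| ≤ 2 |den g 0|` on the ball.
  have hvol : ∀ g : Γ, ENNReal.ofReal (((2 * ‖den g.1 0‖) ^ (2 * (n + 1)))⁻¹) * volume U ≤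
      volume (act g.1 '' U) := by
    intro g
    have h := lintegral_image_act g.1 hUo.measurableSet hUB fun _ => 1
    simp only [mul_one, setLIntegral_one] at h
    rw [h, ← setLIntegral_const]
    refine setLIntegral_mono' hUo.measurableSet fun x hx => ENNReal.ofReal_le_ofReal ?_
    have h1 := norm_pos_iff.2 (den_ne_zero g.1 (hUB hx))
    have h2 := norm_den_le g.1 (hUB hx)
    gcongr
  have hdisj : Pairwise (Function.onFun Disjoint fun g : Γ => act g.1 '' U) := by
    intro g h hgh
    refine Set.disjoint_left.2 ?_
    rintro _ ⟨x, hx, rfl⟩ ⟨y, hy, hxy⟩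
    have h1 : act (h.1⁻¹ * g.1) x = y := by
      rw [act_mul _ _ (hUB hx), ← hxy, act_inv_act _ (hUB hy)]
    refine act_notMem_dirichlet hp₀ (hUF hx) (Γ.mul_mem (Γ.inv_mem h.2) g.2) ?_ (h1 ▸ hUF hy)
    intro h2
    exact hgh (Subtype.ext (inv_mul_eq_one.1 h2).symm)
  have hC : Summable fun g : Γ => ((2 * ‖den g.1 0‖) ^ (2 * (n + 1)))⁻¹ := by
    refine summable_of_sum_le (c := (volume (ball n)).toReal / (volume U).toReal)
      (fun g => by positivity) fun s => ?_
    rw [le_div_iff₀ hUr]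
    have h1 : (∑ g ∈ s, ENNReal.ofReal (((2 * ‖den g.1 0‖) ^ (2 * (n + 1)))⁻¹)) * volume U ≤
        volume (ball n) := by
      rw [Finset.sum_mul]
      calc _ ≤ ∑ g ∈ s, volume (act g.1 '' U) := Finset.sum_le_sum fun g _ => hvol g
        _ = volume (⋃ g ∈ s, act g.1 '' U) :=
          (measure_biUnion_finset (fun g _ h _ hgh => hdisj hgh) fun g _ => hmeas g).symm
        _ ≤ _ := by
          refine measure_mono (Set.iUnion₂_subset fun g _ => ?_)
          exact Set.image_subset_iff.2 fun x hx => act_mem_ball g.1 (hUB hx)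
    have h2 := ENNReal.toReal_mono (volume_ball_lt_top n).ne h1
    rwa [ENNReal.toReal_mul, ENNReal.toReal_sum (fun _ _ => ENNReal.ofReal_ne_top),
      Finset.sum_congr rfl fun g _ => ENNReal.toReal_ofReal (by positivity)] at h2
  have h2 : (fun g : Γ => (‖den g.1 0‖ ^ (2 * (n + 1)))⁻¹) = fun g : Γ =>
      2 ^ (2 * (n + 1)) * ((2 * ‖den g.1 0‖) ^ (2 * (n + 1)))⁻¹ := by
    ext g
    rw [mul_pow, mul_inv, mul_inv_cancel_left₀ (by positivity)]
  rw [h2]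
  exact hC.mul_left _

theorem countable_of_summable_inv_norm_den {n : ℕ} {Γ : Subgroup (SU n)}
    (h : Summable fun g : Γ => (‖den g.1 0‖ ^ (2 * (n + 1)))⁻¹) : Countable Γ := by
  have h1 := h.countable_support
  have h2 : (Function.support fun g : Γ => (‖den g.1 0‖ ^ (2 * (n + 1)))⁻¹) = Set.univ := by
    ext g
    have := one_le_norm_den_zero g.1
    simp only [Function.mem_support, Set.mem_univ, iff_true]
    positivity
  rw [h2] at h1
  exact Set.countable_univ_iff.1 h1

/-! ### Boosts -/

/-- A hyperbolic translation along the `i`-th real coordinate axis. -/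
theorem exists_boost {n : ℕ} (i : Fin n) {t : ℝ} (ht : t ^ 2 < 1) :
    ∃ g : SU n, ∀ z, den g z = (1 - t * z i) / (Real.sqrt (1 - t ^ 2) : ℂ) := by
  set s : ℝ := Real.sqrt (1 - t ^ 2) with hs
  have hs0 : 0 < s := Real.sqrt_pos.2 (by linarith)
  have hss : s ^ 2 = 1 - t ^ 2 := Real.sq_sqrt (by linarith)
  have hsC : (s : ℂ) ≠ 0 := by exact_mod_cast hs0.ne'
  have hssC : (s : ℂ) ^ 2 = 1 - (t : ℂ) ^ 2 := by exact_mod_cast hss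
  -- The boost differs from the identity only on the plane of the `i`-th and last coordinates: `U`
  -- includes this plane and `1 + E` is the Lorentz matrix `s⁻¹ [[1, -t], [-t, 1]]`.
  let U : Matrix (Fin (n + 1)) (Fin 2) ℂ := Matrix.of fun r c =>
    if c = 0 then (if r = i.castSucc then 1 else 0) else (if r = Fin.last n then 1 else 0)
  let E : Matrix (Fin 2) (Fin 2) ℂ := !![(s : ℂ)⁻¹ - 1, -t * (s : ℂ)⁻¹; -t * (s : ℂ)⁻¹, (s : ℂ)⁻¹ - 1]
  let S : Matrix (Fin 2) (Fin 2) ℂ := !![1, 0; 0, -1]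
  have hne : i.castSucc ≠ Fin.last n := Fin.castSucc_ne_last i
  have hUU : Uᵀ * U = 1 := by
    ext a b
    fin_cases a <;> fin_cases b <;> simp [U, Matrix.mul_apply, hne, hne.symm]
  have hSU : sigma n * U = U * S := by
    ext r c
    rw [sigma, Matrix.diagonal_mul]
    fin_cases c <;> simp [U, S, Matrix.mul_apply, Fin.sum_univ_two]
    · by_cases h : r = i.castSucc <;> simp [h, hne]
    · by_cases h : r = Fin.last n <;> simp [h]
  have hUS : Uᵀ * sigma n = S * Uᵀ := by
    have h := congrArg Matrix.transpose hSU
    have hS : Sᵀ = S := by ext a b; fin_cases a <;> fin_cases b <;> simp [S]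
    have hsig : (sigma n)ᵀ = sigma n := by simp [sigma]
    rwa [Matrix.transpose_mul, Matrix.transpose_mul, hS, hsig] at h
  -- This is `(1 + E) S (1 + E) = S` expanded: the two-dimensional Lorentz condition.
  have hE : S * E + E * S + E * S * E = 0 := by
    ext a b
    fin_cases a <;> fin_cases b <;> simp [S, E] <;>
      field_simp <;> first | ring1 | linear_combination (-1 : ℂ) * hssC | linear_combination hssC
  let M : Matrix (Fin (n + 1)) (Fin (n + 1)) ℂ := 1 + U * (E * Uᵀ)
  have hMdet : M.det = 1 := by
    rw [Matrix.det_one_add_mul_comm, Matrix.mul_assoc, hUU, Matrix.mul_one, Matrix.det_fin_two]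
    simp [E]
    field_simp
    linear_combination (-1 : ℂ) * hssC
  have hMt : Mᵀ = M := by
    have hEt : Eᵀ = E := by ext a b; fin_cases a <;> fin_cases b <;> simp [E]
    simp [M, Matrix.transpose_mul, hEt, Matrix.mul_assoc]
  have hMc : M.map (starRingEnd ℂ) = M := by
    have hEc : E.map (starRingEnd ℂ) = E := by
      ext a b; fin_cases a <;> fin_cases b <;> simp [E]
    have hUc : U.map (starRingEnd ℂ) = U := by
      ext a b; fin_cases b <;> simp [U, apply_ite (starRingEnd ℂ)]
    have hUc' : Uᵀ.map (starRingEnd ℂ) = Uᵀ := by rw [Matrix.transpose_map, hUc]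
    simp only [M]
    rw [Matrix.map_add _ (map_add _), Matrix.map_mul, Matrix.map_mul, hEc, hUc, hUc',
      Matrix.map_one _ (map_zero _) (map_one _)]
  have hMsig : Mᵀ * sigma n * M.map (starRingEnd ℂ) = sigma n := by
    rw [hMt, hMc]
    calc M * sigma n * M
        = sigma n + U * E * (Uᵀ * sigma n) + (sigma n * U) * E * Uᵀ
          + U * E * (Uᵀ * sigma n) * U * E * Uᵀ := by
          simp only [M, Matrix.add_mul, Matrix.mul_add, Matrix.one_mul, Matrix.mul_one,
            Matrix.mul_assoc]
          abel
      _ = sigma n + U * (S * E + E * S + E * S * (Uᵀ * U) * E) * Uᵀ := by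
          rw [hUS, hSU]
          simp only [Matrix.add_mul, Matrix.mul_add, Matrix.mul_assoc]
          abel
      _ = sigma n := by rw [hUU, Matrix.mul_one, hE]; simp
  refine ⟨⟨⟨M, hMdet⟩, hMsig⟩, fun z => ?_⟩
  have hrow : ∀ r, M (Fin.last n) r = (1 : Matrix _ _ ℂ) (Fin.last n) r +
      (E 1 0 * U r 0 + E 1 1 * U r 1) := by
    intro r
    simp [M, U, Matrix.mul_apply, Fin.sum_univ_two, hne.symm]
  have hden : den (⟨⟨M, hMdet⟩, hMsig⟩ : SU n) z =
      ∑ j, M (Fin.last n) (Fin.castSucc j) * z j + M (Fin.last n) (Fin.last n) := rfl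
  rw [hden]
  simp [hrow, U, E, hne.symm, Fin.castSucc_ne_last, (Fin.castSucc_ne_last _).symm]
  field_simp
  ring

/-! ### The normalizing constant -/

/-- The constant `n!/πⁿ` in the Bergman kernel. -/
def kappa (n : ℕ) : ℝ := n.factorial / Real.pi ^ n

theorem kappa_pos (n : ℕ) : 0 < kappa n := by unfold kappa; positivity

theorem kernel_eq {n : ℕ} (z w : Cn n) :
    kernel z w = (kappa n : ℂ) * ((-herm z w) ^ (n + 1))⁻¹ := by
  simp [kernel, kappa]

theorem kernel_self {n : ℕ} (z : Cn n) :
    kernel z z = ((kappa n * ((1 - nsq z) ^ (n + 1))⁻¹ : ℝ) : ℂ) := by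
  rw [kernel_eq, neg_herm_self]; push_cast; rfl

/-- The weighted volume of the ball `∫_𝔹 (1 - |z|²)^{(n+1)l}`. -/
def weightedVol (n l : ℕ) : ℝ := ∫ z in ball n, (1 - nsq z) ^ ((n + 1) * l)

theorem integrableOn_weight (n l : ℕ) :
    IntegrableOn (fun z : Cn n => (1 - nsq z) ^ ((n + 1) * l)) (ball n) := by
  refine Measure.integrableOn_of_bounded (M := 1) (volume_ball_lt_top n).ne ?_ ?_
  · exact ((continuous_const.sub continuous_nsq).pow _).aestronglyMeasurable
  · filter_upwards [ae_restrict_mem (isOpen_ball n).measurableSet] with z hz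
    have h1 := nsq_nonneg z
    have h2 := mem_ball_iff.1 hz
    rw [Real.norm_of_nonneg (pow_nonneg (by linarith) _)]
    exact pow_le_one₀ (by linarith) (by linarith)

theorem ofReal_weightedVol (n l : ℕ) :
    ENNReal.ofReal (weightedVol n l) =
      ∫⁻ z in ball n, ENNReal.ofReal ((1 - nsq z) ^ ((n + 1) * l)) := by
  refine ofReal_integral_eq_lintegral_ofReal (integrableOn_weight n l) ?_
  filter_upwards [ae_restrict_mem (isOpen_ball n).measurableSet] with z hz
  exact pow_nonneg (by linarith [mem_ball_iff.1 hz]) _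

/-- Invariance of the weighted volume. -/
theorem lintegral_den_weight {n : ℕ} (g : SU n) (l : ℕ) :
    ∫⁻ z in ball n, ENNReal.ofReal
      (((‖den g z‖ ^ ((n + 1) * (l + 1)))⁻¹) ^ 2 * (1 - nsq z) ^ ((n + 1) * l)) =
      ENNReal.ofReal (weightedVol n l) := by
  rw [ofReal_weightedVol]
  -- The substitution `z ↦ gz` contributes `|den|^{-2(n+1)}` from the Jacobian and
  -- `|den|^{-2(n+1)l}` from the weight.
  conv_rhs => rw [← image_act_ball g]
  rw [lintegral_image_act g (isOpen_ball n).measurableSet subset_rfl]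
  refine setLIntegral_congr_fun (isOpen_ball n).measurableSet fun z hz => ?_
  have h1 := norm_pos_iff.2 (den_ne_zero g hz)
  rw [← ENNReal.ofReal_mul (by positivity), one_sub_nsq_act g hz]
  congr 1
  rw [div_pow, ← pow_mul, div_eq_mul_inv, inv_pow, ← pow_mul, mul_comm ((1 - nsq z) ^ _),
    ← mul_assoc, ← mul_inv, ← pow_add]
  congr 3
  ring

/-- At `z = 0` the two off-diagonal kernels are the constant `κ`, so only the weight `K(w,w)^{1-k}`
remains. One power is lost to the density of `dV`, hence the weight exponent `l = k - 1`. -/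
theorem kernelConst_eq (n l : ℕ) :
    kernelConst n (l + 1) = (((kappa n * weightedVol n l)⁻¹ : ℝ) : ℂ) := by
  have hκ : (kappa n : ℂ) ≠ 0 := by exact_mod_cast (kappa_pos n).ne'
  have h0 : ∀ w : Cn n, kernel 0 w = (kappa n : ℂ) ∧ kernel w 0 = (kappa n : ℂ) := fun w => by
    simp [kernel_eq, herm]
  have hint : ∫ w in ball n, kernel 0 w ^ (l + 1) * kernel w 0 ^ (l + 1) *
      (kernel w w ^ (l + 1))⁻¹ * kernel w w =
      ((kappa n ^ (l + 2) * weightedVol n l : ℝ) : ℂ) := by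
    rw [weightedVol, ← integral_const_mul, ← integral_complex_ofReal]
    refine setIntegral_congr_fun (isOpen_ball n).measurableSet fun w hw => ?_
    have h1 : ((1 - nsq w : ℝ) : ℂ) ≠ 0 := by
      have := mem_ball_iff.1 hw
      exact_mod_cast (by linarith : 1 - nsq w ≠ 0)
    simp only [(h0 w).1, (h0 w).2, kernel_self]
    push_cast at h1 ⊢
    have h2 : (1 - (nsq w : ℂ)) ^ (n + 1) ≠ 0 := pow_ne_zero _ h1
    rw [pow_mul]
    generalize (1 - (nsq w : ℂ)) ^ (n + 1) = y at h2 ⊢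
    rw [mul_pow, inv_pow]
    field_simp
    ring
  rw [kernelConst, hint, (h0 0).1]
  push_cast
  rw [mul_inv, pow_succ (kappa n : ℂ) (l + 1)]
  field_simp

/-- The weight is at least `1/2` on a polydisc whose radius is of order `N^{-1/2}`, and this
polydisc has volume of order `N^{-n}`. Only this lower bound is needed, because the norm estimate
involves `W⁻¹`. -/
theorem weightedVol_ge {n : ℕ} (hn : 0 < n) (l : ℕ) :
    (Real.pi / (2 * n * (n + 1) * (l + 1))) ^ n / 2 ≤ weightedVol n l := by
  set N : ℝ := (n + 1) * (l + 1) with hN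
  have hN1 : 1 ≤ N := by
    have : (0 : ℝ) ≤ n := by positivity
    have : (0 : ℝ) ≤ l := by positivity
    rw [hN]; nlinarith
  have hn' : (0 : ℝ) < n := by exact_mod_cast hn
  -- The radius is chosen so that `|z|² ≤ n r² = 1/(2N)` on the polydisc; Bernoulli's inequality
  -- then keeps the weight above `1/2`.
  set r : ℝ := Real.sqrt (1 / (2 * n * N)) with hr
  have hr2 : r ^ 2 = 1 / (2 * n * N) := Real.sq_sqrt (by positivity)
  have hr0 : 0 ≤ r := Real.sqrt_nonneg _
  have hnsq : ∀ z ∈ Metric.ball (0 : Cn n) r, nsq z ≤ 1 / (2 * N) := by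
    intro z hz
    rw [mem_ball_zero_iff] at hz
    have : nsq z ≤ ∑ _i : Fin n, r ^ 2 := by
      refine Finset.sum_le_sum fun i _ => ?_
      exact pow_le_pow_left₀ (norm_nonneg _) ((norm_le_pi_norm z i).trans hz.le) 2
    refine this.trans (le_of_eq ?_)
    rw [Finset.sum_const, Finset.card_univ, Fintype.card_fin, nsmul_eq_mul, hr2]
    field_simp
  have hhalf : 1 / (2 * N) ≤ 1 / 2 := by
    rw [div_le_div_iff₀ (by positivity) two_pos]; linarith
  have hsub : Metric.ball (0 : Cn n) r ⊆ ball n := fun z hz =>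
    mem_ball_iff.2 (by linarith [hnsq z hz])
  have hle : ∀ z ∈ Metric.ball (0 : Cn n) r, 1 / 2 ≤ (1 - nsq z) ^ ((n + 1) * l) := by
    intro z hz
    have h1 := hnsq z hz
    have h2 : 1 + ((n + 1) * l : ℕ) * (-nsq z) ≤ (1 + -nsq z) ^ ((n + 1) * l) :=
      one_add_mul_le_pow (by linarith) _
    have h3 : (((n + 1) * l : ℕ) : ℝ) * nsq z ≤ N * (1 / (2 * N)) := by
      refine mul_le_mul ?_ h1 (nsq_nonneg z) (by positivity)
      push_cast; rw [hN]; nlinarith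
    have h4 : N * (1 / (2 * N)) = 1 / 2 := by field_simp
    have h5 : (1 + -nsq z) = 1 - nsq z := by ring
    rw [h5] at h2
    linarith
  have hvol : volume.real (Metric.ball (0 : Cn n) r) =
      (Real.pi / (2 * n * (n + 1) * (l + 1))) ^ n := by
    have h1 : volume (Metric.ball (0 : Cn n) r) = (ENNReal.ofReal r ^ 2 * NNReal.pi) ^ n := by
      rw [volume_pi_ball _ (Real.sqrt_pos.2 (by positivity))]
      simp only [Pi.zero_apply, Complex.volume_ball, Finset.prod_const, Finset.card_univ,
        Fintype.card_fin]
      rfl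
    rw [Measure.real, h1]
    simp [ENNReal.toReal_ofReal hr0, hr2, hN]
    field_simp
  have hfin : volume (Metric.ball (0 : Cn n) r) < ⊤ := measure_ball_lt_top
  calc _ = ∫ _ in Metric.ball (0 : Cn n) r, (1 / 2 : ℝ) := by
        rw [setIntegral_const, hvol, smul_eq_mul]; ring
    _ ≤ ∫ z in Metric.ball (0 : Cn n) r, (1 - nsq z) ^ ((n + 1) * l) := by
        refine setIntegral_mono_on (integrableOn_const hfin.ne)
          ((integrableOn_weight n l).mono_set hsub) measurableSet_ball hle
    _ ≤ _ := by
        refine setIntegral_mono_set (integrableOn_weight n l) ?_ hsub.eventuallyLE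
        filter_upwards [ae_restrict_mem (isOpen_ball n).measurableSet] with z hz
        exact pow_nonneg (by linarith [mem_ball_iff.1 hz]) _

theorem weightedVol_pos {n : ℕ} (hn : 0 < n) (l : ℕ) : 0 < weightedVol n l := by
  refine lt_of_lt_of_le ?_ (weightedVol_ge hn l)
  have : (0 : ℝ) < n := by exact_mod_cast hn
  have := Real.pi_pos
  positivity

/-! ### The parametrization of the half ball -/

/-- The parameter domain of the half ball. -/
def halfBallParam (α : ℝ) : Set (ℂ × ℝ) :=
  {w : ℂ × ℝ | w.1.re ^ 2 + w.1.im ^ 2 + w.2 ^ 2 < α ^ 2 ∧ 0 < w.2}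

theorem mem_halfBallParam {α : ℝ} {w : ℂ × ℝ} :
    w ∈ halfBallParam α ↔ ‖w.1‖ ^ 2 + w.2 ^ 2 < α ^ 2 ∧ 0 < w.2 := by
  rw [← Complex.normSq_eq_norm_sq, Complex.normSq_apply, ← sq, ← sq]
  exact Iff.rfl

theorem isOpen_halfBallParam (α : ℝ) : IsOpen (halfBallParam α) := by
  have h : Continuous fun w : ℂ × ℝ => w.1.re ^ 2 + w.1.im ^ 2 + w.2 ^ 2 := by fun_prop
  exact (isOpen_lt h continuous_const).inter (isOpen_lt continuous_const continuous_snd)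

theorem halfBallParam_subset_Ioo {α : ℝ} (hα : 0 < α) :
    halfBallParam α ⊆ Set.univ ×ˢ Set.Ioo 0 α := by
  intro w hw
  rw [mem_halfBallParam] at hw
  refine ⟨Set.mem_univ _, hw.2, ?_⟩
  nlinarith [norm_nonneg w.1]

theorem halfBallParam_subset_closedBall {α : ℝ} (hα : 0 < α) :
    halfBallParam α ⊆ Metric.closedBall 0 α := by
  intro w hw
  rw [mem_halfBallParam] at hw
  rw [mem_closedBall_zero_iff, Prod.norm_def, max_le_iff, Real.norm_of_nonneg hw.2.le]
  constructor <;> nlinarith [norm_nonneg w.1]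

theorem volume_halfBallParam_lt_top {α : ℝ} (hα : 0 < α) : volume (halfBallParam α) < ⊤ :=
  (measure_mono (halfBallParam_subset_closedBall hα)).trans_lt measure_closedBall_lt_top

theorem sum_embed {n : ℕ} (hn : 2 ≤ n) (w : ℂ × ℝ) {M : Type*} [AddCommMonoid M]
    (f : Fin n → ℂ → M) (hf : ∀ i, f i 0 = 0) :
    ∑ i, f i (embed n w i) = f ⟨0, by omega⟩ w.1 + f ⟨1, by omega⟩ (w.2 : ℂ) := by
  rw [Finset.sum_eq_add_of_mem (⟨0, by omega⟩ : Fin n) ⟨1, by omega⟩ (Finset.mem_univ _)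
    (Finset.mem_univ _) (by simp)]
  · simp [embed]
  · rintro i - ⟨h0, h1⟩
    have h0' : i.1 ≠ 0 := fun h => h0 (Fin.ext h)
    have h1' : i.1 ≠ 1 := fun h => h1 (Fin.ext h)
    simp [embed, h0', h1', hf]

theorem nsq_embed {n : ℕ} (hn : 2 ≤ n) (w : ℂ × ℝ) : nsq (embed n w) = ‖w.1‖ ^ 2 + w.2 ^ 2 := by
  rw [nsq, sum_embed hn w (fun _ x => ‖x‖ ^ 2) (by simp)]
  simp

theorem neg_herm_embed {n : ℕ} (hn : 2 ≤ n) (z : Cn n) (w : ℂ × ℝ) :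
    -herm z (embed n w) = 1 - z ⟨0, by omega⟩ * conj w.1 - z ⟨1, by omega⟩ * w.2 := by
  rw [herm, sum_embed hn w (fun i x => z i * conj x) (by simp)]
  simp only [Complex.conj_ofReal]
  ring

theorem continuous_embed (n : ℕ) : Continuous (embed n) := by
  refine continuous_pi fun i => ?_
  unfold embed
  split_ifs <;> fun_prop

theorem nsq_embed_lt {n : ℕ} (hn : 2 ≤ n) {α : ℝ} {w : ℂ × ℝ} (hw : w ∈ halfBallParam α) :
    nsq (embed n w) < α ^ 2 := by
  rw [nsq_embed hn]; exact (mem_halfBallParam.1 hw).1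

theorem nrm_embed_le {n : ℕ} (hn : 2 ≤ n) {α : ℝ} (hα : 0 < α) {w : ℂ × ℝ}
    (hw : w ∈ halfBallParam α) : nrm (embed n w) ≤ α :=
  Real.sqrt_le_iff.2 ⟨hα.le, (nsq_embed_lt hn hw).le⟩

theorem embed_mem_ball {n : ℕ} (hn : 2 ≤ n) {α : ℝ} (hα : 0 < α) (hα1 : α < 1) {w : ℂ × ℝ}
    (hw : w ∈ halfBallParam α) : embed n w ∈ ball n :=
  mem_ball_iff_nrm.2 ((nrm_embed_le hn hα hw).trans_lt hα1)

/-! ### Averaging over the half ball -/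

/-- `∫_X (-⟨z,p⟩)^{-N} (1 - |p|²)^{N/2} ν_X(p)`. -/
def waveT (n : ℕ) (α : ℝ) (N : ℕ) (z : Cn n) : ℂ :=
  ∫ w in halfBallParam α, ((-herm z (embed n w)) ^ N)⁻¹ * (defect (embed n w) : ℂ) ^ N

/-- Rotation invariance in the first coordinate. -/
theorem setIntegral_halfBallParam_rotate (α : ℝ) (u : Circle) (f : ℂ × ℝ → ℂ) :
    ∫ w in halfBallParam α, f (u * w.1, w.2) = ∫ w in halfBallParam α, f w := by
  let e : ℂ × ℝ ≃ₜ ℂ × ℝ := (rotation u).toHomeomorph.prodCongr (Homeomorph.refl ℝ)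
  have he : MeasurePreserving e volume volume :=
    (rotation u).measurePreserving.prod (MeasurePreserving.id volume)
  have hpre : e ⁻¹' halfBallParam α = halfBallParam α := by
    ext w
    have : e w = (u * w.1, w.2) := rfl
    rw [Set.mem_preimage, mem_halfBallParam, mem_halfBallParam, this, norm_mul, Circle.norm_coe, one_mul]
  have h := he.setIntegral_preimage_emb e.measurableEmbedding f (halfBallParam α)
  rw [hpre] at h
  exact h

/-- The expression is `-⟨z,p⟩` with first coordinate of `p` multiplied by `ū`, and such a `p` stays
in the closed unit ball. Hence the kernel is holomorphic in `u` on the closed disc. -/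
theorem one_sub_nrm_le_of_norm_le_one {n : ℕ} (hn : 2 ≤ n) {α : ℝ} (hα : 0 < α) (hα1 : α < 1)
    (z : Cn n) {w : ℂ × ℝ} (hw : w ∈ halfBallParam α) {u : ℂ} (hu : ‖u‖ ≤ 1) :
    1 - nrm z ≤ ‖1 - z ⟨0, by omega⟩ * (u * conj w.1) - z ⟨1, by omega⟩ * w.2‖ := by
  have h := neg_herm_embed hn z (conj u * w.1, w.2)
  simp only [map_mul, Complex.conj_conj] at h
  rw [← h, norm_neg]
  refine le_trans ?_ (one_sub_le_norm_herm _ _)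
  have h1 : nrm (embed n (conj u * w.1, w.2)) ≤ 1 := by
    refine Real.sqrt_le_one.2 ?_
    have h2 := mem_halfBallParam.1 hw
    rw [nsq_embed hn]
    simp only [norm_mul, RCLike.norm_conj, mul_pow]
    have : ‖u‖ ^ 2 ≤ 1 := pow_le_one₀ (norm_nonneg u) hu
    nlinarith [sq_nonneg ‖w.1‖]
  nlinarith [nrm_nonneg z, nrm_nonneg (embed n (conj u * w.1, w.2))]

/-- Rotating the first coordinate by `u` on the unit circle does not change the integral over `X`.
Averaging over `u`, exchanging integrals and applying the mean value property at each point
evaluates the kernel at `u = 0`, so the dependence on `z₁` disappears. -/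
theorem waveT_eq {n : ℕ} (hn : 2 ≤ n) {α : ℝ} (hα : 0 < α) (hα1 : α < 1) (N : ℕ)
    {z : Cn n} (hz : z ∈ ball n) :
    waveT n α N z = ∫ w in halfBallParam α,
      ((1 - z ⟨1, by omega⟩ * w.2) ^ N)⁻¹ * (defect (embed n w) : ℂ) ^ N := by
  have hz1 : 0 < 1 - nrm z := sub_pos.2 (mem_ball_iff_nrm.1 hz)
  let q : ℂ → ℂ × ℝ → ℂ := fun u w =>
    1 - z ⟨0, by omega⟩ * (u * conj w.1) - z ⟨1, by omega⟩ * w.2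
  let G : ℂ → ℂ × ℝ → ℂ := fun u w => ((q u w) ^ N)⁻¹ * (defect (embed n w) : ℂ) ^ N
  have hq : ∀ u : ℂ, ‖u‖ ≤ 1 → ∀ w ∈ halfBallParam α, 1 - nrm z ≤ ‖q u w‖ := fun u hu w hw =>
    one_sub_nrm_le_of_norm_le_one hn hα hα1 z hw hu
  have hcirc : ∀ θ : ℝ, ∫ w in halfBallParam α, G (circleMap 0 1 θ) w = waveT n α N z := by
    intro θ
    let c : Circle := Circle.exp θ
    have hc : ((c⁻¹ : Circle) : ℂ) = conj (circleMap 0 1 θ) := by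
      rw [Circle.coe_inv_eq_conj]; simp [c, circleMap, Circle.coe_exp]
    -- The rotation is by the inverse because the coordinate of `p` enters the kernel conjugated.
    rw [waveT, ← setIntegral_halfBallParam_rotate α c⁻¹ fun w =>
      ((-herm z (embed n w)) ^ N)⁻¹ * (defect (embed n w) : ℂ) ^ N]
    refine integral_congr_ae (Eventually.of_forall fun w => ?_)
    simp only [G, q, neg_herm_embed hn, hc, map_mul, Complex.conj_conj]
    have hdef : defect (embed n (conj (circleMap 0 1 θ) * w.1, w.2)) = defect (embed n w) := by
      rw [defect, defect, nsq_embed hn, nsq_embed hn]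
      simp
    rw [hdef]
  have hswap : ∫ θ in (0 : ℝ)..2 * Real.pi, ∫ w in halfBallParam α, G (circleMap 0 1 θ) w =
      ∫ w in halfBallParam α, ∫ θ in (0 : ℝ)..2 * Real.pi, G (circleMap 0 1 θ) w := by
    refine intervalIntegral_integral_swap ?_
    have : IsFiniteMeasure (volume.restrict (halfBallParam α)) :=
      ⟨by simpa using volume_halfBallParam_lt_top hα⟩
    have : IsFiniteMeasure (volume.restrict (Set.uIoc 0 (2 * Real.pi))) :=
      ⟨by simp [Set.uIoc]⟩
    refine Integrable.of_bound (C := ((1 - nrm z) ^ N)⁻¹) ?_ ?_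
    · refine Measurable.aestronglyMeasurable ?_
      have h1 : Measurable fun x : ℝ × (ℂ × ℝ) => q (circleMap 0 1 x.1) x.2 := by
        refine Continuous.measurable ?_
        simp only [q]
        have : Continuous fun x : ℝ × (ℂ × ℝ) => circleMap 0 1 x.1 :=
          (continuous_circleMap 0 1).comp continuous_fst
        fun_prop
      have h2 : Measurable fun x : ℝ × (ℂ × ℝ) => (defect (embed n x.2) : ℂ) :=
        (Complex.continuous_ofReal.comp (continuous_defect.comp
          ((continuous_embed n).comp continuous_snd))).measurable
      exact (h1.pow_const N).inv.mul (h2.pow_const N)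
    · have hae : ∀ᵐ x : ℝ × (ℂ × ℝ) ∂((volume.restrict (Set.uIoc 0 (2 * Real.pi))).prod
          (volume.restrict (halfBallParam α))), x.2 ∈ halfBallParam α := by
        refine Measure.quasiMeasurePreserving_snd.ae ?_
        exact ae_restrict_mem (isOpen_halfBallParam α).measurableSet
      filter_upwards [hae] with x hx
      simp only [Function.uncurry, G, norm_mul, norm_inv, norm_pow, Complex.norm_real]
      rw [Real.norm_of_nonneg (defect_nonneg _)]
      have h1 := hq (circleMap 0 1 x.1) (by simp) x.2 hx
      have h2 : defect (embed n x.2) ^ N ≤ 1 := pow_le_one₀ (defect_nonneg _) (defect_le_one _)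
      calc _ ≤ (‖q (circleMap 0 1 x.1) x.2‖ ^ N)⁻¹ * 1 := by gcongr
        _ ≤ _ := by rw [mul_one]; gcongr
  have hmean : ∀ w ∈ halfBallParam α,
      ∫ θ in (0 : ℝ)..2 * Real.pi, G (circleMap 0 1 θ) w = (2 * Real.pi) • G 0 w := by
    intro w hw
    have hd : DiffContOnCl ℂ (fun u => G u w) (Metric.ball 0 |1|) := by
      refine DifferentiableOn.diffContOnCl fun u hu => ?_
      have hu' : ‖u‖ ≤ 1 := by
        have := Metric.closure_ball_subset_closedBall hu
        simpa using this
      have h1 : q u w ≠ 0 := norm_pos_iff.1 (hz1.trans_le (hq u hu' w hw))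
      have h2 : Differentiable ℂ fun u => q u w := by simp only [q]; fun_prop
      exact (((h2 u).pow N).inv (pow_ne_zero N h1)).mul_const _ |>.differentiableWithinAt
    have h := hd.circleAverage
    rw [Real.circleAverage_def] at h
    have hpi : (2 * Real.pi) ≠ 0 := by positivity
    rw [← h, smul_inv_smul₀ hpi]
  simp only [hcirc] at hswap
  rw [setIntegral_congr_fun (isOpen_halfBallParam α).measurableSet hmean, integral_smul,
    intervalIntegral.integral_const, sub_zero] at hswap
  have hpi : (2 * Real.pi) ≠ 0 := by positivity
  rw [smul_right_injective ℂ hpi hswap]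
  simp [G, q]

/-- The integrand of the reduced one-dimensional integral. -/
def profile {n : ℕ} (hn : 2 ≤ n) (N : ℕ) (z : Cn n) (t : ℝ) : ℝ :=
  (‖(1 - t * z ⟨1, by omega⟩) / (Real.sqrt (1 - t ^ 2) : ℂ)‖ ^ N)⁻¹

theorem measurable_profile {n : ℕ} (hn : 2 ≤ n) (N : ℕ) :
    Measurable fun x : Cn n × ℝ => profile hn N x.1 x.2 := by
  unfold profile
  have h1 : Measurable fun x : Cn n × ℝ => 1 - (x.2 : ℂ) * x.1 ⟨1, by omega⟩ :=
    Continuous.measurable (by fun_prop)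
  have h2 : Measurable fun x : Cn n × ℝ => (Real.sqrt (1 - x.2 ^ 2) : ℂ) :=
    Continuous.measurable (by fun_prop)
  exact ((h1.div h2).norm.pow_const N).inv

theorem lintegral_gaussian {N : ℕ} (hN : 0 < N) :
    ∫⁻ w : ℂ, ENNReal.ofReal (Real.exp (-(N / 2 : ℝ) * ‖w‖ ^ 2)) =
      ENNReal.ofReal (2 * Real.pi / N) := by
  have hb : 0 < (N / 2 : ℝ) := by positivity
  have h := GaussianFourier.integral_rexp_neg_mul_sq_norm (V := ℂ) hb
  rw [Complex.finrank_real_complex] at h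
  have h2 : (Real.pi / (N / 2 : ℝ)) ^ (((2 : ℕ) : ℝ) / 2) = 2 * Real.pi / N := by
    norm_num
    field_simp
  rw [h2] at h
  have hpos : 0 < 2 * Real.pi / N := by positivity
  rw [← h, ofReal_integral_eq_lintegral_ofReal]
  · by_contra hni
    rw [integral_undef hni] at h
    exact hpos.ne h
  · exact Eventually.of_forall fun w => (Real.exp_pos _).le

/-- Since the kernel no longer involves `w.1`, the integrand is dominated by a product of a Gaussian
in `w.1` and a function of `t`. This is the source of the gain `1/N` for the complex direction. -/
theorem enorm_waveT_le {n : ℕ} (hn : 2 ≤ n) {α : ℝ} (hα : 0 < α) (hα1 : α < 1) {N : ℕ}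
    (hN : 0 < N) {z : Cn n} (hz : z ∈ ball n) :
    ‖waveT n α N z‖ₑ ≤ ENNReal.ofReal (2 * Real.pi / N) *
      ∫⁻ t in Set.Ioo 0 α, ENNReal.ofReal (profile hn N z t) := by
  rw [waveT_eq hn hα hα1 N hz]
  refine (enorm_integral_le_lintegral_enorm _).trans ?_
  calc _ ≤ ∫⁻ w in halfBallParam α, ENNReal.ofReal (Real.exp (-(N / 2 : ℝ) * ‖w.1‖ ^ 2)) *
        ENNReal.ofReal (profile hn N z w.2) := by
        refine setLIntegral_mono' (isOpen_halfBallParam α).measurableSet fun w hw => ?_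
        rw [← ENNReal.ofReal_mul (Real.exp_pos _).le, ← ofReal_norm]
        refine ENNReal.ofReal_le_ofReal ?_
        rw [mem_halfBallParam] at hw
        have ht : w.2 ^ 2 < 1 := by nlinarith [sq_nonneg ‖w.1‖]
        have hs : 0 < Real.sqrt (1 - w.2 ^ 2) := Real.sqrt_pos.2 (by linarith)
        -- Used here: `1 - t² - |w|² ≤ (1 - t²)(1 - |w|²) ≤ (1 - t²) exp(-|w|²)`.
        have hdef : defect (embed n w) ≤
            Real.sqrt (1 - w.2 ^ 2) * Real.exp (-(1 / 2) * ‖w.1‖ ^ 2) := by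
          have h1 : Real.exp (-(1 / 2) * ‖w.1‖ ^ 2) = Real.sqrt (Real.exp (-‖w.1‖ ^ 2)) := by
            rw [Real.sqrt_eq_rpow, ← Real.exp_mul]; congr 1; ring
          rw [h1, ← Real.sqrt_mul (by linarith), defect, nsq_embed hn]
          refine Real.sqrt_le_sqrt ?_
          have h2 := Real.add_one_le_exp (-‖w.1‖ ^ 2)
          have h3 : 0 ≤ w.2 ^ 2 * ‖w.1‖ ^ 2 := by positivity
          nlinarith
        have hpow : defect (embed n w) ^ N ≤
            Real.sqrt (1 - w.2 ^ 2) ^ N * Real.exp (-(N / 2 : ℝ) * ‖w.1‖ ^ 2) := by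
          refine (pow_le_pow_left₀ (defect_nonneg _) hdef N).trans (le_of_eq ?_)
          rw [mul_pow, ← Real.exp_nat_mul]
          congr 2; ring
        rw [norm_mul, norm_inv, norm_pow, norm_pow, Complex.norm_real,
          Real.norm_of_nonneg (defect_nonneg _), profile, norm_div, Complex.norm_real,
          Real.norm_of_nonneg hs.le, div_pow, inv_div, mul_comm (w.2 : ℂ)]
        calc _ ≤ (‖1 - z ⟨1, by omega⟩ * (w.2 : ℂ)‖ ^ N)⁻¹ *
              (Real.sqrt (1 - w.2 ^ 2) ^ N * Real.exp (-(N / 2 : ℝ) * ‖w.1‖ ^ 2)) := by gcongr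
          _ = _ := by ring
    -- Enlarging the half ball to a full product separates the variables and makes the Gaussian
    -- integral explicit.
    _ ≤ ∫⁻ w in Set.univ ×ˢ Set.Ioo 0 α,
        ENNReal.ofReal (Real.exp (-(N / 2 : ℝ) * ‖w.1‖ ^ 2)) *
        ENNReal.ofReal (profile hn N z w.2) :=
        lintegral_mono_set (halfBallParam_subset_Ioo hα)
    _ = _ := by
        rw [Measure.volume_eq_prod, ← Measure.prod_restrict,
          lintegral_prod_mul (f := fun w : ℂ => ENNReal.ofReal (Real.exp (-(N / 2 : ℝ) * ‖w‖ ^ 2)))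
            (g := fun t => ENNReal.ofReal (profile hn N z t)), Measure.restrict_univ, lintegral_gaussian hN]
        · exact (Continuous.measurable (by fun_prop)).ennreal_ofReal.aemeasurable
        · exact ((measurable_profile hn N).comp
            (measurable_const.prodMk measurable_id)).ennreal_ofReal.aemeasurable

/-- The Cauchy–Schwarz inequality on a finite interval. -/
theorem sq_lintegral_Ioo_le {α : ℝ} {f : ℝ → ℝ≥0∞} (hf : Measurable f) :
    (∫⁻ t in Set.Ioo 0 α, f t) ^ 2 ≤ ENNReal.ofReal α * ∫⁻ t in Set.Ioo 0 α, f t ^ 2 := by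
  have h := ENNReal.lintegral_mul_le_Lp_mul_Lq (volume.restrict (Set.Ioo 0 α))
    Real.HolderConjugate.two_two (f := fun _ => 1) (g := f) aemeasurable_const hf.aemeasurable
  simp only [Pi.mul_apply, one_mul, ENNReal.rpow_two, one_pow, lintegral_one,
    Measure.restrict_apply_univ, Real.volume_Ioo, sub_zero] at h
  refine (pow_le_pow_left' h 2).trans (le_of_eq ?_)
  have hsq : ∀ x : ℝ≥0∞, (x ^ (1 / 2 : ℝ)) ^ 2 = x := fun x => by
    rw [← ENNReal.rpow_two, ← ENNReal.rpow_mul]; norm_num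
  rw [mul_pow, hsq, hsq]

/-- After Cauchy–Schwarz in `t` and Tonelli, the inner integral over the ball is the same for every
`t`, because the profile at `t` is a power of the denominator of a boost. The two factors `α` come
from Cauchy–Schwarz and from the length of the interval. -/
theorem lintegral_waveT_sq_le {n : ℕ} (hn : 2 ≤ n) {α : ℝ} (hα : 0 < α) (hα1 : α < 1) (l : ℕ) :
    ∫⁻ z in ball n, ENNReal.ofReal
      (‖waveT n α ((n + 1) * (l + 1)) z‖ ^ 2 * (1 - nsq z) ^ ((n + 1) * l)) ≤
      ENNReal.ofReal ((2 * Real.pi / ((n + 1) * (l + 1) : ℕ)) ^ 2 * α ^ 2 * weightedVol n l) := by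
  set N : ℕ := (n + 1) * (l + 1) with hN
  have hN0 : 0 < N := by positivity
  have hprof : ∀ z : Cn n, Measurable fun t => ENNReal.ofReal (profile hn N z t) := fun z =>
    ((measurable_profile hn N).comp (measurable_const.prodMk measurable_id)).ennreal_ofReal
  have hboost : ∀ t ∈ Set.Ioo 0 α, ∫⁻ z in ball n,
      ENNReal.ofReal (profile hn N z t ^ 2 * (1 - nsq z) ^ ((n + 1) * l)) =
      ENNReal.ofReal (weightedVol n l) := by
    intro t ht
    -- The boost along the second real axis with parameter `t` has denominator `(1 - t z₂)/√(1 -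
    -- t²)`.
    obtain ⟨g, hg⟩ := exists_boost (⟨1, by omega⟩ : Fin n) (t := t) (by nlinarith [ht.1, ht.2])
    rw [← lintegral_den_weight g l]
    simp only [hg, profile, hN]
  calc _ ≤ ∫⁻ z in ball n, ENNReal.ofReal (2 * Real.pi / N) ^ 2 * ENNReal.ofReal α *
        ∫⁻ t in Set.Ioo 0 α,
          ENNReal.ofReal (profile hn N z t ^ 2 * (1 - nsq z) ^ ((n + 1) * l)) := by
        refine setLIntegral_mono' (isOpen_ball n).measurableSet fun z hz => ?_
        have h0 : 0 ≤ 1 - nsq z := by linarith [mem_ball_iff.1 hz]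
        have h1 := enorm_waveT_le hn hα hα1 hN0 hz
        rw [ENNReal.ofReal_mul (by positivity), ENNReal.ofReal_pow (norm_nonneg _),
          ofReal_norm]
        calc _ ≤ (ENNReal.ofReal (2 * Real.pi / N) *
              ∫⁻ t in Set.Ioo 0 α, ENNReal.ofReal (profile hn N z t)) ^ 2 *
              ENNReal.ofReal ((1 - nsq z) ^ ((n + 1) * l)) := by gcongr
          _ ≤ ENNReal.ofReal (2 * Real.pi / N) ^ 2 * (ENNReal.ofReal α *
              ∫⁻ t in Set.Ioo 0 α, ENNReal.ofReal (profile hn N z t) ^ 2) *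
              ENNReal.ofReal ((1 - nsq z) ^ ((n + 1) * l)) := by
              rw [mul_pow]
              gcongr
              exact sq_lintegral_Ioo_le (hprof z)
          _ = _ := by
              rw [mul_assoc, mul_assoc, mul_assoc, ← lintegral_mul_const _ ((hprof z).pow_const 2)]
              congr 3
              ext t
              have hp : 0 ≤ profile hn N z t := by unfold profile; positivity
              rw [ENNReal.ofReal_mul (by positivity), ENNReal.ofReal_pow hp]
    _ = ENNReal.ofReal (2 * Real.pi / N) ^ 2 * ENNReal.ofReal α *
        ∫⁻ z in ball n, ∫⁻ t in Set.Ioo 0 α,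
          ENNReal.ofReal (profile hn N z t ^ 2 * (1 - nsq z) ^ ((n + 1) * l)) :=
        lintegral_const_mul' _ _ (by finiteness)
    _ = ENNReal.ofReal (2 * Real.pi / N) ^ 2 * ENNReal.ofReal α *
        ∫⁻ t in Set.Ioo 0 α, ENNReal.ofReal (weightedVol n l) := by
        rw [lintegral_lintegral_swap, setLIntegral_congr_fun measurableSet_Ioo hboost]
        refine Measurable.aemeasurable (Measurable.ennreal_ofReal ?_)
        refine ((measurable_profile hn N).pow_const 2).mul ?_
        exact ((measurable_const.sub (continuous_nsq.measurable.comp measurable_fst)).pow_const _)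
    _ = _ := by
        rw [setLIntegral_const, Real.volume_Ioo, sub_zero,
          ENNReal.ofReal_mul (by positivity), ENNReal.ofReal_mul (by positivity),
          ENNReal.ofReal_pow (by positivity), ENNReal.ofReal_pow hα.le]
        ring

/-! ### Holomorphy of series and of the averaged kernel. -/

/-- A locally normally convergent series of holomorphic functions on an open subset of a complex
normed space is holomorphic. -/
theorem differentiableOn_tsum_of_locally_bounded {ι E F : Type*} [NormedAddCommGroup E]
    [NormedSpace ℂ E] [NormedAddCommGroup F] [NormedSpace ℂ F] [CompleteSpace F]
    {f : ι → E → F} {s : Set E} (hf : ∀ i, DifferentiableOn ℂ (f i) s)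
    (h : ∀ x ∈ s, ∃ ε > 0, Metric.ball x ε ⊆ s ∧
      ∃ u : ι → ℝ, Summable u ∧ ∀ i, ∀ y ∈ Metric.ball x ε, ‖f i y‖ ≤ u i) :
    DifferentiableOn ℂ (fun x => ∑' i, f i x) s := by
  intro x hx
  obtain ⟨ε, hε, hεs, u, hu, hfu⟩ := h x hx
  have hr : 0 < ε / 2 := half_pos hε
  have hsub : ∀ y ∈ Metric.ball x (ε / 2), Metric.ball y (ε / 2) ⊆ Metric.ball x ε := by
    intro y hy
    refine Metric.ball_subset_ball' ?_
    rw [Metric.mem_ball] at hy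
    linarith
  have hball : Metric.ball x (ε / 2) ⊆ Metric.ball x ε := Metric.ball_subset_ball (by linarith)
  -- A Cauchy estimate on balls of half the radius: `f i` moves by at most `2 u i` there, so the
  -- derivatives are summably bounded and the series may be differentiated termwise.
  have hd : ∀ i, ∀ y ∈ Metric.ball x (ε / 2), ‖fderiv ℂ (f i) y‖ ≤ 2 * u i / (ε / 2) := by
    intro i y hy
    refine Complex.norm_fderiv_le_div_of_mapsTo_ball ((hf i).mono ((hsub y hy).trans hεs)) ?_ hr
    intro v hv
    rw [mem_closedBall_iff_norm]
    refine (norm_sub_le _ _).trans ?_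
    linarith [hfu i v (hsub y hy hv), hfu i y (hball hy)]
  have hx' : x ∈ Metric.ball x (ε / 2) := Metric.mem_ball_self hr
  let _ : NormedSpace ℝ E := NormedSpace.restrictScalars ℝ ℂ E
  have := hasFDerivAt_tsum_of_isPreconnected (f := f) (f' := fun i => fderiv ℂ (f i))
    ((hu.mul_left 2).div_const (ε / 2)) Metric.isOpen_ball
    (convex_ball x (ε / 2)).isPreconnected
    (fun i y hy => ((hf i).differentiableAt
      (mem_of_superset (Metric.isOpen_ball.mem_nhds (hball hy)) hεs)).hasFDerivAt)
    hd hx' (Summable.of_norm_bounded hu fun i => hfu i x (hball hx')) hx'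
  exact this.differentiableAt.differentiableWithinAt

/-- The functional `z ↦ ∑ zᵢ p̄ᵢ`. -/
def hermFun {n : ℕ} (p : Cn n) : Cn n →L[ℂ] ℂ :=
  ∑ i, conj (p i) • ContinuousLinearMap.proj (R := ℂ) (φ := fun _ : Fin n => ℂ) i

theorem continuous_hermFun {n : ℕ} : Continuous (hermFun : Cn n → _) := by
  unfold hermFun
  exact continuous_finsetSum _ fun i _ => by fun_prop

theorem hermFun_apply {n : ℕ} (p z : Cn n) : hermFun p z = ∑ i, z i * conj (p i) := by
  simp [hermFun, mul_comm]

theorem norm_hermFun_le {n : ℕ} {p : Cn n} (hp : p ∈ ball n) : ‖hermFun p‖ ≤ n := by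
  refine ContinuousLinearMap.opNorm_le_bound _ (by positivity) fun z => ?_
  rw [hermFun_apply]
  refine (norm_sum_le _ _).trans ?_
  calc ∑ i, ‖z i * conj (p i)‖ ≤ ∑ _i : Fin n, ‖z‖ := by
        refine Finset.sum_le_sum fun i _ => ?_
        rw [norm_mul, RCLike.norm_conj]
        have h1 : ‖p i‖ ≤ 1 :=
          ((norm_le_pi_norm p i).trans (norm_le_nrm p)).trans (mem_ball_iff_nrm.1 hp).le
        calc _ ≤ ‖z‖ * 1 := by gcongr; exact norm_le_pi_norm z i
          _ = _ := mul_one _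
    _ = _ := by simp

theorem neg_herm_eq {n : ℕ} (z p : Cn n) : -herm z p = 1 - hermFun p z := by
  rw [hermFun_apply, herm]; ring

theorem continuous_neg_herm {n : ℕ} : Continuous fun x : Cn n × Cn n => -herm x.1 x.2 := by
  unfold herm
  fun_prop

theorem one_sub_nrm_le_norm_neg_herm {n : ℕ} (z : Cn n) {p : Cn n} (hp : p ∈ ball n) :
    1 - nrm z ≤ ‖-herm z p‖ := by
  rw [norm_neg]
  refine le_trans ?_ (one_sub_le_norm_herm z p)
  nlinarith [nrm_nonneg z, mem_ball_iff_nrm.1 hp]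

/-- Differentiation under the integral. On `|z| < r < 1` the base `-⟨z,p⟩` has modulus between `1 -
r` and `2`, which gives a constant bound for the derivative of the integrand. -/
theorem differentiableOn_waveT {n : ℕ} (hn : 2 ≤ n) {α : ℝ} (hα : 0 < α) (hα1 : α < 1) (N : ℕ) :
    DifferentiableOn ℂ (waveT n α N) (ball n) := by
  intro z₀ hz₀
  obtain ⟨r, hr0, hr1⟩ := exists_between (mem_ball_iff_nrm.1 hz₀)
  have hUo : IsOpen {z : Cn n | nrm z < r} := isOpen_lt continuous_nrm continuous_const
  have hS := (isOpen_halfBallParam α).measurableSet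
  have hfin : IsFiniteMeasure (volume.restrict (halfBallParam α)) :=
    ⟨by simpa using volume_halfBallParam_lt_top hα⟩
  have hX : ∀ w ∈ halfBallParam α, ∀ z : Cn n, nrm z < r → 1 - r ≤ ‖-herm z (embed n w)‖ :=
    fun w hw z hz => le_trans (by linarith)
      (one_sub_nrm_le_norm_neg_herm z (embed_mem_ball hn hα hα1 hw))
  have hc : ∀ z : Cn n, Continuous fun w => -herm z (embed n w) := fun z =>
    continuous_neg_herm.comp (continuous_const.prodMk (continuous_embed n))
  have hdc : Continuous fun w => (defect (embed n w) : ℂ) ^ N :=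
    (Complex.continuous_ofReal.comp (continuous_defect.comp (continuous_embed n))).pow N
  have hFm : ∀ z : Cn n, AEStronglyMeasurable (fun w => ((-herm z (embed n w)) ^ N)⁻¹ *
      (defect (embed n w) : ℂ) ^ N) (volume.restrict (halfBallParam α)) := fun z =>
    ((((hc z).measurable.pow_const N).inv).mul hdc.measurable).aestronglyMeasurable
  have hdle : ∀ w, ‖(defect (embed n w) : ℂ) ^ N‖ ≤ 1 := fun w => by
    rw [norm_pow, Complex.norm_real, Real.norm_of_nonneg (defect_nonneg _)]
    exact pow_le_one₀ (defect_nonneg _) (defect_le_one _)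
  let F' : Cn n → ℂ × ℝ → (Cn n →L[ℂ] ℂ) := fun z w =>
    (((defect (embed n w) : ℂ) ^ N) * (-(N * (-herm z (embed n w)) ^ (N - 1)) /
      ((-herm z (embed n w)) ^ N) ^ 2)) • -hermFun (embed n w)
  have key := hasFDerivAt_integral_of_dominated_of_fderiv_le (𝕜 := ℂ)
    (μ := volume.restrict (halfBallParam α)) (F' := F')
    (F := fun z w => ((-herm z (embed n w)) ^ N)⁻¹ * (defect (embed n w) : ℂ) ^ N)
    (x₀ := z₀) (s := {z : Cn n | nrm z < r})
    (bound := fun _ => N * 2 ^ (N - 1) / ((1 - r) ^ N) ^ 2 * n)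
    (hUo.mem_nhds hr0) (Eventually.of_forall hFm) ?_ ?_ ?_ (integrable_const _) ?_
  · exact key.differentiableAt.differentiableWithinAt
  · refine Integrable.of_bound (C := ((1 - r) ^ N)⁻¹) (hFm z₀) ?_
    filter_upwards [ae_restrict_mem hS] with w hw
    have h1 := hX w hw z₀ hr0
    have h2 : 0 < 1 - r := by linarith
    rw [norm_mul, norm_inv, norm_pow]
    calc _ ≤ (‖-herm z₀ (embed n w)‖ ^ N)⁻¹ * 1 := by gcongr; exact hdle w
      _ ≤ _ := by rw [mul_one]; gcongr
  · have h1 : Measurable fun w => ((defect (embed n w) : ℂ) ^ N) *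
        (-(N * (-herm z₀ (embed n w)) ^ (N - 1)) / ((-herm z₀ (embed n w)) ^ N) ^ 2) :=
      hdc.measurable.mul ((measurable_const.mul ((hc z₀).measurable.pow_const _)).neg.div
        (((hc z₀).measurable.pow_const _).pow_const _))
    exact h1.aestronglyMeasurable.smul
      (continuous_hermFun.comp (continuous_embed n)).neg.aestronglyMeasurable
  · filter_upwards [ae_restrict_mem hS] with w hw z hz
    have h1 := hX w hw z hz
    have h2 : 0 < 1 - r := by linarith
    have hpb := embed_mem_ball hn hα hα1 hw
    have h3 : ‖-herm z (embed n w)‖ ≤ 2 := by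
      rw [norm_neg]
      refine (norm_herm_le _ _).trans ?_
      have h4 := mem_ball_iff_nrm.1 hpb
      have h5 : nrm z < 1 := lt_trans hz hr1
      nlinarith [nrm_nonneg z, nrm_nonneg (embed n w)]
    simp only [F']
    rw [norm_smul, norm_neg, norm_mul, norm_div, norm_neg, norm_mul, norm_pow, norm_pow, norm_pow,
      norm_pow, Complex.norm_natCast]
    have h6 := hdle w
    rw [norm_pow] at h6
    calc _ ≤ 1 * (N * 2 ^ (N - 1) / ((1 - r) ^ N) ^ 2) * n := by
          gcongr
          exact norm_hermFun_le hpb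
      _ = _ := by rw [one_mul]
  · filter_upwards [ae_restrict_mem hS] with w hw z hz
    have h1 := hX w hw z hz
    have h2 : 0 < 1 - r := by linarith
    have h3 : -herm z (embed n w) ≠ 0 := norm_pos_iff.1 (h2.trans_le h1)
    have h4 : HasFDerivAt (fun z => -herm z (embed n w)) (-hermFun (embed n w)) z := by
      simp only [neg_herm_eq]
      exact (hermFun (embed n w)).hasFDerivAt.const_sub 1
    have h5 := ((hasDerivAt_pow N (-herm z (embed n w))).inv (pow_ne_zero N h3)).mul_const
      ((defect (embed n w) : ℂ) ^ N)
    refine (h5.comp_hasFDerivAt z h4).congr_fderiv ?_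
    simp only [F']
    congr 1
    ring

theorem norm_waveT_le {n : ℕ} (hn : 2 ≤ n) {α : ℝ} (hα : 0 < α) (hα1 : α < 1) (N : ℕ)
    {z : Cn n} (hz : z ∈ ball n) :
    ‖waveT n α N z‖ ≤ ((1 - α) ^ N)⁻¹ * volume.real (halfBallParam α) := by
  refine norm_setIntegral_le_of_norm_le_const (volume_halfBallParam_lt_top hα) fun w hw => ?_
  have h1 : 1 - α ≤ ‖-herm z (embed n w)‖ := by
    rw [norm_neg]
    refine le_trans ?_ (one_sub_le_norm_herm z _)
    nlinarith [nrm_embed_le hn hα hw, mem_ball_iff_nrm.1 hz, nrm_nonneg z, nrm_nonneg (embed n w)]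
  have h2 : 0 < 1 - α := by linarith
  rw [norm_mul, norm_inv, norm_pow, norm_pow, Complex.norm_real,
    Real.norm_of_nonneg (defect_nonneg _)]
  calc _ ≤ (‖-herm z (embed n w)‖ ^ N)⁻¹ * 1 := by
        gcongr; exact pow_le_one₀ (defect_nonneg _) (defect_le_one _)
    _ ≤ _ := by rw [mul_one]; gcongr

/-! ### The embedding of the parameter domain -/

/-- `embed n` as a real-linear map. -/
def embedL (n : ℕ) : ℂ × ℝ →ₗ[ℝ] Cn n where
  toFun := embed n
  map_add' v w := by ext i; simp only [embed, Pi.add_apply]; split_ifs <;> simp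
  map_smul' c w := by ext i; simp only [embed, Pi.smul_apply]; split_ifs <;> simp

theorem embed_injective {n : ℕ} (hn : 2 ≤ n) : Function.Injective (embed n) := by
  intro v w h
  have h0 := congrFun h ⟨0, by omega⟩
  have h1 := congrFun h ⟨1, by omega⟩
  simp only [embed, if_true, one_ne_zero, if_false, Complex.ofReal_inj] at h0 h1
  exact Prod.ext h0 h1

theorem measurableEmbedding_embed {n : ℕ} (hn : 2 ≤ n) : MeasurableEmbedding (embed n) :=
  (LinearMap.isClosedEmbedding_of_injective (f := embedL n)
    (LinearMap.ker_eq_bot.2 (embed_injective hn))).measurableEmbedding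

theorem mem_halfBall_iff {n : ℕ} (hn : 2 ≤ n) {α : ℝ} (hα1 : α < 1) (hα : 0 < α) {z : Cn n} :
    z ∈ halfBall n hn α ↔ ∃ w ∈ halfBallParam α, embed n w = z := by
  constructor
  · rintro ⟨-, h1, h2, h3, h4⟩
    refine ⟨(z ⟨0, by omega⟩, (z ⟨1, by omega⟩).re), ⟨h1, h2⟩, ?_⟩
    ext i
    simp only [embed]
    split_ifs with hi0 hi1
    · congr 1; exact Fin.ext hi0.symm
    · have : i = ⟨1, by omega⟩ := Fin.ext hi1
      rw [this]
      exact Complex.ext (by simp) (by simp [h3])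
    · exact (h4 i (by omega)).symm
  · rintro ⟨w, hw, rfl⟩
    refine ⟨embed_mem_ball hn hα hα1 hw, ?_, ?_, ?_, fun i hi => ?_⟩
    · simpa [embed] using hw.1
    · simpa [embed] using hw.2
    · simp [embed]
    · have h0 : i.1 ≠ 0 := by omega
      have h1 : i.1 ≠ 1 := by omega
      simp [embed, h0, h1]

/-! ### The Poincaré series -/

section Theta

variable {n m : ℕ} {Γ : Subgroup (SU n)} (ρ : Γ →* unitaryGroup (Fin m) ℂ) (j : Fin m)

/-- The vector `ρ(γ⁻¹) e_j`. -/
def rhoCol (g : Γ) : Fin m → ℂ := fun i => (ρ g⁻¹).1 i j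

theorem norm_rhoCol_apply_le (g : Γ) (i : Fin m) : ‖rhoCol ρ j g i‖ ≤ 1 :=
  entry_norm_bound_of_unitary (ρ g⁻¹).2 i j

theorem norm_rhoCol_le (g : Γ) : ‖rhoCol ρ j g‖ ≤ 1 :=
  (pi_norm_le_iff_of_nonneg zero_le_one).2 (norm_rhoCol_apply_le ρ j g)

/-- The rule `ρ(h) ρ((gh)⁻¹) = ρ(g⁻¹)`, which accounts for the factor `ρ(h)` when the series is
reindexed. -/
theorem mulVec_rhoCol (g h : Γ) : (ρ h).1 *ᵥ rhoCol ρ j (g * h) = rhoCol ρ j g := by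
  ext i
  have h1 : ρ g⁻¹ = ρ h * ρ (g * h)⁻¹ := by rw [← map_mul]; congr 1; group
  simp only [rhoCol, h1]
  rfl

theorem rhoCol_one : rhoCol ρ j 1 = Pi.single j 1 := by
  ext i
  simp [rhoCol, Matrix.one_apply, Pi.single_apply]

theorem kernel_pow (k : ℕ) (z p : Cn n) :
    kernel z p ^ k = (kappa n : ℂ) ^ k * ((-herm z p) ^ ((n + 1) * k))⁻¹ := by
  rw [kernel_eq, mul_pow, inv_pow, pow_mul]

theorem thetaTerm_eq (k : ℕ) {z : Cn n} (hz : z ∈ ball n) (p : Cn n) (g : Γ) :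
    thetaTerm Γ ρ j k z p g = ((kappa n : ℂ) ^ k * (((den g.1 z) ^ ((n + 1) * k))⁻¹ *
      ((-herm (act g.1 z) p) ^ ((n + 1) * k))⁻¹)) • rhoCol ρ j g := by
  ext i
  rw [thetaTerm, jac_eq g.1 hz, kernel_pow, Matrix.mulVec_single]
  simp only [Pi.smul_apply, smul_eq_mul, MulOpposite.smul_eq_mul_unop, MulOpposite.unop_op,
    Matrix.col_apply, rhoCol, inv_pow, ← pow_mul]
  ring

/-- For `k ≥ 2` the exponent is at least `2(n+1)`, and since `|den g 0| ≥ 1` the surplus powers can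
be dropped. Every series below is thereby majorized by the single one obtained from volumes. -/
theorem norm_den_pow_inv_le {k : ℕ} (hk : 2 ≤ k) {z : Cn n} {r : ℝ} (hr : nrm z ≤ r) (hr1 : r < 1)
    (g : SU n) : ‖((den g z) ^ ((n + 1) * k))⁻¹‖ ≤
      ((1 - r) ^ ((n + 1) * k))⁻¹ * (‖den g 0‖ ^ (2 * (n + 1)))⁻¹ := by
  have h1 := one_le_norm_den_zero g
  have h2 : 0 < 1 - r := by linarith
  have h3 : ‖den g 0‖ * (1 - r) ≤ ‖den g z‖ := by
    refine le_trans ?_ (le_norm_den g z)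
    gcongr
  rw [norm_inv, norm_pow, ← mul_inv]
  refine inv_anti₀ (by positivity) ?_
  calc (1 - r) ^ ((n + 1) * k) * ‖den g 0‖ ^ (2 * (n + 1))
      ≤ (1 - r) ^ ((n + 1) * k) * ‖den g 0‖ ^ ((n + 1) * k) := by
        refine mul_le_mul_of_nonneg_left (pow_le_pow_right₀ h1 ?_) (by positivity)
        rw [mul_comm]
        gcongr
    _ = (‖den g 0‖ * (1 - r)) ^ ((n + 1) * k) := by rw [mul_pow, mul_comm]
    _ ≤ _ := by gcongr

theorem norm_neg_herm_pow_inv_le (N : ℕ) {z p : Cn n} (hz : z ∈ ball n) {r : ℝ} (hr : nrm p ≤ r)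
    (hr1 : r < 1) : ‖((-herm z p) ^ N)⁻¹‖ ≤ ((1 - r) ^ N)⁻¹ := by
  have h1 : 1 - r ≤ ‖-herm z p‖ := by
    rw [norm_neg]
    refine le_trans ?_ (one_sub_le_norm_herm z _)
    nlinarith [mem_ball_iff_nrm.1 hz, nrm_nonneg z, nrm_nonneg p]
  have h2 : 0 < 1 - r := by linarith
  rw [norm_inv, norm_pow]
  gcongr

theorem summable_thetaTerm (hΓ : Summable fun g : Γ => (‖den g.1 0‖ ^ (2 * (n + 1)))⁻¹) {k : ℕ}
    (hk : 2 ≤ k) {z p : Cn n} (hz : z ∈ ball n) (hp : p ∈ ball n) :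
    Summable (thetaTerm Γ ρ j k z p) := by
  refine Summable.of_norm_bounded (((hΓ.mul_left ((1 - nrm z) ^ ((n + 1) * k))⁻¹).mul_right
    ((1 - nrm p) ^ ((n + 1) * k))⁻¹).mul_left (kappa n ^ k)) fun g => ?_
  rw [thetaTerm_eq ρ j k hz, norm_smul, norm_mul, norm_mul, norm_pow, Complex.norm_real,
    Real.norm_of_nonneg (kappa_pos n).le]
  have h1 := norm_den_pow_inv_le hk le_rfl (mem_ball_iff_nrm.1 hz) g.1
  have h2 := norm_neg_herm_pow_inv_le ((n + 1) * k) (act_mem_ball g.1 hz) le_rfl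
    (mem_ball_iff_nrm.1 hp)
  have h3 := kappa_pos n
  have h4 : 0 < 1 - nrm z := sub_pos.2 (mem_ball_iff_nrm.1 hz)
  calc _ ≤ kappa n ^ k * (((1 - nrm z) ^ ((n + 1) * k))⁻¹ * (‖den g.1 0‖ ^ (2 * (n + 1)))⁻¹ *
        ((1 - nrm p) ^ ((n + 1) * k))⁻¹) * 1 := by
        have h5 : 0 < 1 - nrm p := sub_pos.2 (mem_ball_iff_nrm.1 hp)
        gcongr
        exact norm_rhoCol_le ρ j g
    _ = _ := mul_one _

theorem kernel_rpow (k : ℕ) {p : Cn n} (hp : p ∈ ball n) :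
    (kernel p p).re ^ (-(k : ℝ) / 2) = kappa n ^ (-(k : ℝ) / 2) * defect p ^ ((n + 1) * k) := by
  have hd := defect_pos hp
  rw [kernel_self, Complex.ofReal_re, Real.mul_rpow (kappa_pos n).le (by
    rw [← defect_sq hp]; positivity), ← defect_sq hp, ← pow_mul, Real.inv_rpow (by positivity),
    ← Real.rpow_neg (by positivity), ← Real.rpow_natCast, ← Real.rpow_mul hd.le,
    ← Real.rpow_natCast]
  congr 2
  push_cast
  ring

variable (Γ) in
/-- The scalar function by which `γ` enters the series `Θ_X`. -/
def phi (α : ℝ) (k : ℕ) (g : Γ) (z : Cn n) : ℂ :=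
  ((den g.1 z) ^ ((n + 1) * k))⁻¹ * waveT n α ((n + 1) * k) (act g.1 z)

/-- The scalar factor in front of the series `Θ_X`. -/
def thetaFactor (n k : ℕ) : ℂ :=
  (kappa n ^ (-(k : ℝ) / 2) : ℝ) * kernelConst n k * (kappa n : ℂ) ^ k

/-- The integrand contributed by `γ`. -/
def phiIntegrand (k : ℕ) (z : Cn n) (g : Γ) (w : ℂ × ℝ) : ℂ :=
  ((den g.1 z) ^ ((n + 1) * k))⁻¹ * (((-herm (act g.1 z) (embed n w)) ^ ((n + 1) * k))⁻¹ *
    (defect (embed n w) : ℂ) ^ ((n + 1) * k))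

theorem integral_phiIntegrand (α : ℝ) (k : ℕ) (z : Cn n) (g : Γ) :
    ∫ w in halfBallParam α, phiIntegrand k z g w = phi Γ α k g z :=
  integral_const_mul _ _

theorem norm_phiIntegrand_le (hn : 2 ≤ n) {α : ℝ} (hα : 0 < α) (hα1 : α < 1) {k : ℕ} (hk : 2 ≤ k)
    {z : Cn n} (hz : z ∈ ball n) (g : Γ) {w : ℂ × ℝ} (hw : w ∈ halfBallParam α) :
    ‖phiIntegrand k z g w‖ ≤ ((1 - nrm z) ^ ((n + 1) * k))⁻¹ * ((1 - α) ^ ((n + 1) * k))⁻¹ *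
      (‖den g.1 0‖ ^ (2 * (n + 1)))⁻¹ := by
  have h1 := norm_den_pow_inv_le hk le_rfl (mem_ball_iff_nrm.1 hz) g.1
  have h2 := norm_neg_herm_pow_inv_le ((n + 1) * k) (act_mem_ball g.1 hz)
    (nrm_embed_le hn hα hw) hα1
  have h3 : ‖(defect (embed n w) : ℂ) ^ ((n + 1) * k)‖ ≤ 1 := by
    rw [norm_pow, Complex.norm_real, Real.norm_of_nonneg (defect_nonneg _)]
    exact pow_le_one₀ (defect_nonneg _) (defect_le_one _)
  have h4 : 0 < 1 - nrm z := sub_pos.2 (mem_ball_iff_nrm.1 hz)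
  have h5 : 0 < 1 - α := sub_pos.2 hα1
  rw [phiIntegrand, norm_mul, norm_mul]
  calc _ ≤ ((1 - nrm z) ^ ((n + 1) * k))⁻¹ * (‖den g.1 0‖ ^ (2 * (n + 1)))⁻¹ *
        (((1 - α) ^ ((n + 1) * k))⁻¹ * 1) := by gcongr
    _ = _ := by ring

theorem continuousOn_phiIntegrand (hn : 2 ≤ n) {α : ℝ} (hα : 0 < α) (hα1 : α < 1) (k : ℕ)
    {z : Cn n} (hz : z ∈ ball n) (g : Γ) :
    ContinuousOn (phiIntegrand k z g) (halfBallParam α) := by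
  refine continuousOn_const.mul (ContinuousOn.mul (ContinuousOn.inv₀ ?_ ?_) ?_)
  · exact ((continuous_neg_herm.comp
      (continuous_const.prodMk (continuous_embed n))).pow _).continuousOn
  · exact fun w hw => pow_ne_zero _ (neg_ne_zero.2 (herm_ne_zero (act_mem_ball g.1 hz)
      (embed_mem_ball hn hα hα1 hw)))
  · exact ((Complex.continuous_ofReal.comp
      (continuous_defect.comp (continuous_embed n))).pow _).continuousOn

theorem thetaIntegrand_embed (hn : 2 ≤ n) {α : ℝ} (hα : 0 < α) (hα1 : α < 1) (k : ℕ)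
    {z : Cn n} (hz : z ∈ ball n) {w : ℂ × ℝ} (hw : w ∈ halfBallParam α) :
    thetaIntegrand Γ ρ j k z (embed n w) =
      thetaFactor n k • ∑' g : Γ, phiIntegrand k z g w • rhoCol ρ j g := by
  have hp := embed_mem_ball hn hα hα1 hw
  rw [thetaIntegrand, kernel_rpow k hp, thetaPoint, ← tsum_const_smul'', ← tsum_const_smul'',
    ← tsum_const_smul'']
  refine tsum_congr fun g => ?_
  rw [thetaTerm_eq ρ j k hz]
  ext i
  simp only [Pi.smul_apply, smul_eq_mul, Complex.real_smul, thetaFactor, phiIntegrand]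
  push_cast
  ring

theorem halfBallMeasure_eq (n : ℕ) (α : ℝ) :
    halfBallMeasure n α = (volume.restrict (halfBallParam α)).map (embed n) := rfl

theorem integrable_thetaIntegrand (hn : 2 ≤ n) {α : ℝ} (hα : 0 < α) (hα1 : α < 1)
    (hΓ : Summable fun g : Γ => (‖den g.1 0‖ ^ (2 * (n + 1)))⁻¹) {k : ℕ} (hk : 2 ≤ k)
    {z : Cn n} (hz : z ∈ ball n) :
    Integrable (thetaIntegrand Γ ρ j k z) (halfBallMeasure n α) := by
  have hS := (isOpen_halfBallParam α).measurableSet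
  have hfin : IsFiniteMeasure (volume.restrict (halfBallParam α)) :=
    ⟨by simpa using volume_halfBallParam_lt_top hα⟩
  rw [halfBallMeasure_eq, (measurableEmbedding_embed hn).integrable_map_iff]
  have hu := hΓ.mul_left (((1 - nrm z) ^ ((n + 1) * k))⁻¹ * ((1 - α) ^ ((n + 1) * k))⁻¹)
  have hb : ∀ g : Γ, ∀ w ∈ halfBallParam α, ‖phiIntegrand k z g w • rhoCol ρ j g‖ ≤
      ((1 - nrm z) ^ ((n + 1) * k))⁻¹ * ((1 - α) ^ ((n + 1) * k))⁻¹ *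
      (‖den g.1 0‖ ^ (2 * (n + 1)))⁻¹ := by
    intro g w hw
    rw [norm_smul]
    have h1 := norm_phiIntegrand_le hn hα hα1 hk hz g hw
    have h2 := norm_rhoCol_le ρ j g
    nlinarith [norm_nonneg (phiIntegrand k z g w), norm_nonneg (rhoCol ρ j g)]
  have hi : Integrable (fun w => thetaFactor n k • ∑' g : Γ, phiIntegrand k z g w • rhoCol ρ j g)
      (volume.restrict (halfBallParam α)) := by
    refine Integrable.smul (thetaFactor n k) ?_
    refine Integrable.of_bound (C := ∑' g : Γ, ((1 - nrm z) ^ ((n + 1) * k))⁻¹ *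
      ((1 - α) ^ ((n + 1) * k))⁻¹ * (‖den g.1 0‖ ^ (2 * (n + 1)))⁻¹) ?_ ?_
    · exact (continuousOn_tsum (fun g => (continuousOn_phiIntegrand hn hα hα1 k hz g).smul
        continuousOn_const) hu hb).aestronglyMeasurable hS
    · filter_upwards [ae_restrict_mem hS] with w hw
      exact tsum_of_norm_bounded hu.hasSum fun g => hb g w hw
  refine hi.congr ?_
  filter_upwards [ae_restrict_mem hS] with w hw
  exact (thetaIntegrand_embed ρ j hn hα hα1 k hz hw).symm

theorem norm_phi_le (hn : 2 ≤ n) {α : ℝ} (hα : 0 < α) (hα1 : α < 1) {k : ℕ} (hk : 2 ≤ k)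
    {z : Cn n} {r : ℝ} (hr : nrm z ≤ r) (hr1 : r < 1) (g : Γ) :
    ‖phi Γ α k g z‖ ≤ ((1 - r) ^ ((n + 1) * k))⁻¹ * (((1 - α) ^ ((n + 1) * k))⁻¹ *
      volume.real (halfBallParam α)) * (‖den g.1 0‖ ^ (2 * (n + 1)))⁻¹ := by
  have hz : z ∈ ball n := mem_ball_iff_nrm.2 (hr.trans_lt hr1)
  have h1 := norm_den_pow_inv_le hk hr hr1 g.1
  have h2 := norm_waveT_le hn hα hα1 ((n + 1) * k) (act_mem_ball g.1 hz)
  have h3 : 0 < 1 - r := sub_pos.2 hr1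
  rw [phi, norm_mul]
  calc _ ≤ ((1 - r) ^ ((n + 1) * k))⁻¹ * (‖den g.1 0‖ ^ (2 * (n + 1)))⁻¹ *
        (((1 - α) ^ ((n + 1) * k))⁻¹ * volume.real (halfBallParam α)) := by gcongr
    _ = _ := by ring

theorem norm_phi_smul_le (hn : 2 ≤ n) {α : ℝ} (hα : 0 < α) (hα1 : α < 1) {k : ℕ} (hk : 2 ≤ k)
    {z : Cn n} {r : ℝ} (hr : nrm z ≤ r) (hr1 : r < 1) (g : Γ) :
    ‖phi Γ α k g z • rhoCol ρ j g‖ ≤ ((1 - r) ^ ((n + 1) * k))⁻¹ * (((1 - α) ^ ((n + 1) * k))⁻¹ *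
      volume.real (halfBallParam α)) * (‖den g.1 0‖ ^ (2 * (n + 1)))⁻¹ := by
  rw [norm_smul]
  exact (mul_le_of_le_one_right (norm_nonneg _) (norm_rhoCol_le ρ j g)).trans
    (norm_phi_le hn hα hα1 hk hr hr1 g)

theorem summable_phi_smul (hn : 2 ≤ n) {α : ℝ} (hα : 0 < α) (hα1 : α < 1)
    (hΓ : Summable fun g : Γ => (‖den g.1 0‖ ^ (2 * (n + 1)))⁻¹) {k : ℕ} (hk : 2 ≤ k)
    {z : Cn n} (hz : z ∈ ball n) : Summable fun g : Γ => phi Γ α k g z • rhoCol ρ j g :=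
  Summable.of_norm_bounded (hΓ.mul_left _) fun g =>
    norm_phi_smul_le ρ j hn hα hα1 hk le_rfl (mem_ball_iff_nrm.1 hz) g

/-- Fubini: for fixed `z` the terms are bounded on `X` by a summable sequence, so the integral
passes inside the sum and turns each kernel into `waveT`. -/
theorem thetaSub_eq (hn : 2 ≤ n) {α : ℝ} (hα : 0 < α) (hα1 : α < 1)
    (hΓ : Summable fun g : Γ => (‖den g.1 0‖ ^ (2 * (n + 1)))⁻¹) {k : ℕ} (hk : 2 ≤ k)
    {z : Cn n} (hz : z ∈ ball n) :
    thetaSub Γ ρ j k (halfBallMeasure n α) z =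
      thetaFactor n k • ∑' g : Γ, phi Γ α k g z • rhoCol ρ j g := by
  have hS := (isOpen_halfBallParam α).measurableSet
  have hfin : IsFiniteMeasure (volume.restrict (halfBallParam α)) :=
    ⟨by simpa using volume_halfBallParam_lt_top hα⟩
  have hc : Countable Γ := countable_of_summable_inv_norm_den hΓ
  rw [thetaSub, halfBallMeasure_eq, (measurableEmbedding_embed hn).integral_map,
    setIntegral_congr_fun hS fun w hw => thetaIntegrand_embed ρ j hn hα hα1 k hz hw,
    integral_smul]
  congr 1
  have hb : ∀ g : Γ, ∀ w ∈ halfBallParam α, ‖phiIntegrand k z g w • rhoCol ρ j g‖ ≤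
      ((1 - nrm z) ^ ((n + 1) * k))⁻¹ * ((1 - α) ^ ((n + 1) * k))⁻¹ *
      (‖den g.1 0‖ ^ (2 * (n + 1)))⁻¹ := by
    intro g w hw
    rw [norm_smul]
    exact (mul_le_of_le_one_right (norm_nonneg _) (norm_rhoCol_le ρ j g)).trans
      (norm_phiIntegrand_le hn hα hα1 hk hz g hw)
  have hi : ∀ g : Γ, Integrable (fun w => phiIntegrand k z g w • rhoCol ρ j g)
      (volume.restrict (halfBallParam α)) := fun g =>
    Integrable.of_bound (((continuousOn_phiIntegrand hn hα hα1 k hz g).smul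
      continuousOn_const).aestronglyMeasurable hS) _
      ((ae_restrict_mem hS).mono fun w hw => hb g w hw)
  have hs : Summable fun g : Γ =>
      ∫ w in halfBallParam α, ‖phiIntegrand k z g w • rhoCol ρ j g‖ := by
    refine Summable.of_nonneg_of_le (fun g => integral_nonneg fun w => norm_nonneg _) (fun g => ?_)
      (((hΓ.mul_left (((1 - nrm z) ^ ((n + 1) * k))⁻¹ * ((1 - α) ^ ((n + 1) * k))⁻¹))).mul_right
        (volume.real (halfBallParam α)))
    have h1 := norm_setIntegral_le_of_norm_le_const (volume_halfBallParam_lt_top hα)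
      (f := fun w => ‖phiIntegrand k z g w • rhoCol ρ j g‖) fun w hw => by
        rw [norm_norm]; exact hb g w hw
    exact (le_abs_self _).trans h1
  rw [← (hasSum_integral_of_summable_integral_norm hi hs).tsum_eq]
  refine tsum_congr fun g => ?_
  rw [integral_smul_const, integral_phiIntegrand]

theorem differentiableOn_phi (hn : 2 ≤ n) {α : ℝ} (hα : 0 < α) (hα1 : α < 1) (k : ℕ) (g : Γ) :
    DifferentiableOn ℂ (phi Γ α k g) (ball n) := by
  refine DifferentiableOn.mul (DifferentiableOn.inv ?_ ?_) ?_
  · exact ((differentiable_den g.1).pow _).differentiableOn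
  · exact fun z hz => pow_ne_zero _ (den_ne_zero g.1 hz)
  · exact (differentiableOn_waveT hn hα hα1 _).comp (differentiableOn_act g.1)
      fun z hz => act_mem_ball g.1 hz

theorem phi_act (α : ℝ) (k : ℕ) (g h : Γ) {z : Cn n} (hz : z ∈ ball n) :
    jac h.1 z ^ k * phi Γ α k g (act h.1 z) = phi Γ α k (g * h) z := by
  rw [phi, phi, Subgroup.coe_mul, den_mul _ _ hz, act_mul _ _ hz, jac_eq h.1 hz, inv_pow,
    ← pow_mul, mul_pow, mul_inv]
  ring

/-- Holomorphy follows from locally uniform majorants. Automorphy is the substitution `g ↦ gh` in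
the series, using the cocycle rule for the Jacobian and the homomorphism property of `ρ`. -/
theorem isAutomorphicForm_thetaSub (hn : 2 ≤ n) {α : ℝ} (hα : 0 < α) (hα1 : α < 1)
    (hΓ : Summable fun g : Γ => (‖den g.1 0‖ ^ (2 * (n + 1)))⁻¹) {k : ℕ} (hk : 2 ≤ k) :
    IsAutomorphicForm Γ ρ k (thetaSub Γ ρ j k (halfBallMeasure n α)) := by
  constructor
  · have h : DifferentiableOn ℂ (fun z => thetaFactor n k •
        ∑' g : Γ, phi Γ α k g z • rhoCol ρ j g) (ball n) := by
      refine DifferentiableOn.const_smul ?_ (thetaFactor n k)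
      refine differentiableOn_tsum_of_locally_bounded
        (fun g => (differentiableOn_phi hn hα hα1 k g).smul_const _) fun z hz => ?_
      obtain ⟨r, hr0, hr1⟩ := exists_between (mem_ball_iff_nrm.1 hz)
      obtain ⟨ε, hε, hεs⟩ := Metric.isOpen_iff.1 (isOpen_lt continuous_nrm continuous_const) z
        (hr0 : z ∈ {z : Cn n | nrm z < r})
      refine ⟨ε, hε, fun y hy => mem_ball_iff_nrm.2 ((hεs hy).trans hr1), _, hΓ.mul_left _,
        fun g y hy => norm_phi_smul_le ρ j hn hα hα1 hk (hεs hy).le hr1 g⟩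
    exact h.congr fun z hz => thetaSub_eq ρ j hn hα hα1 hΓ hk hz
  · intro h z hz
    rw [thetaSub_eq ρ j hn hα hα1 hΓ hk (act_mem_ball h.1 hz), thetaSub_eq ρ j hn hα hα1 hΓ hk hz,
      Matrix.mulVec_smul, smul_comm]
    congr 1
    have h1 := (Matrix.mulVecLin (ρ h).1).toContinuousLinearMap.map_tsum
      (summable_phi_smul ρ j hn hα hα1 hΓ hk hz)
    simp only [LinearMap.coe_toContinuousLinearMap', Matrix.mulVecLin_apply] at h1
    rw [h1, ← (Equiv.mulRight h).tsum_eq fun g : Γ => (ρ h).1 *ᵥ phi Γ α k g z • rhoCol ρ j g,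
      ← tsum_const_smul'']
    refine tsum_congr fun g => ?_
    rw [Equiv.coe_mulRight, Matrix.mulVec_smul, mulVec_rhoCol, smul_smul, phi_act α k g h hz]

end Theta

/-! ### The norm of the theta series -/

theorem isCompact_nrm_le (n : ℕ) (r : ℝ) : IsCompact {z : Cn n | nrm z ≤ r} := by
  refine Metric.isCompact_of_isClosed_isBounded (isClosed_le continuous_nrm continuous_const) ?_
  refine (Metric.isBounded_closedBall (x := (0 : Cn n)) (r := r)).subset fun z hz => ?_
  rw [mem_closedBall_zero_iff]
  exact (norm_le_nrm z).trans hz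

theorem closure_halfBall_subset {n : ℕ} (hn : 2 ≤ n) {α : ℝ} (hα : 0 < α) (hα1 : α < 1) :
    closure (halfBall n hn α) ⊆ {z | nrm z ≤ α} := by
  refine closure_minimal (fun z hz => ?_) (isClosed_le continuous_nrm continuous_const)
  obtain ⟨w, hw, rfl⟩ := (mem_halfBall_iff hn hα1 hα).1 hz
  exact nrm_embed_le hn hα hw

theorem halfBall_nonempty {n : ℕ} (hn : 2 ≤ n) {α : ℝ} (hα : 0 < α) (hα1 : α < 1) :
    (halfBall n hn α).Nonempty := by
  refine ⟨embed n (0, α / 2), (mem_halfBall_iff hn hα1 hα).2 ⟨_, ?_, rfl⟩⟩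
  rw [mem_halfBallParam]
  constructor
  · simp; nlinarith
  · simp [hα]

/-- Off a neighbourhood of the half ball, the normalized kernel is uniformly less than one. -/
theorem exists_kernel_ratio_le {n : ℕ} (hn : 2 ≤ n) {α : ℝ} (hα : 0 < α) (hα1 : α < 1)
    {F : Set (Cn n)} (hF : closure (halfBall n hn α) ⊆ interior F) :
    ∃ θ : ℝ, 0 < θ ∧ θ < 1 ∧ ∀ y ∈ ball n, y ∉ F → ∀ w ∈ halfBallParam α,
      defect y * defect (embed n w) / ‖herm y (embed n w)‖ ≤ θ := by
  have hcpt : IsCompact (closure (halfBall n hn α)) :=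
    (isCompact_nrm_le n α).of_isClosed_subset isClosed_closure (closure_halfBall_subset hn hα hα1)
  -- By compactness, points outside `F` are at Euclidean distance at least `ε` from `X`. Then
  -- `|⟨y,p⟩|` exceeds the product of the defects, which is at most `1`, by at least `ε²/2`; hence
  -- the value of `θ` below.
  obtain ⟨ε, hε, hsub⟩ := hcpt.exists_thickening_subset_open isOpen_interior hF
  refine ⟨1 / (1 + ε ^ 2 / 2), by positivity, ?_, fun y hy hyF w hw => ?_⟩
  · rw [div_lt_one (by positivity)]
    have : 0 < ε ^ 2 := by positivity
    linarith
  have hp := embed_mem_ball hn hα hα1 hw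
  have hdist : ε ≤ nrm (y - embed n w) := by
    refine le_trans ?_ (norm_le_nrm _)
    rw [← dist_eq_norm]
    by_contra! hlt
    refine hyF (interior_subset (hsub ?_))
    exact Metric.mem_thickening_iff.2 ⟨_, subset_closure
      ((mem_halfBall_iff hn hα1 hα).2 ⟨w, hw, rfl⟩), hlt⟩
  have h1 := defect_mul_add_le_norm_herm hy hp
  have h2 : ε ^ 2 ≤ nsq (y - embed n w) := by
    rw [← nrm_sq]; gcongr
  have h3 : defect y * defect (embed n w) ≤ 1 :=
    mul_le_one₀ (defect_le_one _) (defect_nonneg _) (defect_le_one _)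
  have h4 := mul_pos (defect_pos hy) (defect_pos hp)
  rw [div_le_div_iff₀ (norm_herm_pos hy hp) (by positivity)]
  nlinarith [sq_nonneg ε]

section Theta

variable {n m : ℕ} {Γ : Subgroup (SU n)} (ρ : Γ →* unitaryGroup (Fin m) ℂ) (j : Fin m)

/-- Weighted by `(1 - |z|²)^{N/2}`, a term becomes a power of `1 / cosh(τ(γz, p)/2)`; both
exponential decay and summability over `γ` can then be read from the same quantity. -/
theorem norm_phiIntegrand_mul {k : ℕ} {z : Cn n} (hz : z ∈ ball n) (g : Γ) (w : ℂ × ℝ) :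
    ‖phiIntegrand k z g w‖ * defect z ^ ((n + 1) * k) =
      (defect (act g.1 z) * defect (embed n w) / ‖herm (act g.1 z) (embed n w)‖) ^
        ((n + 1) * k) := by
  rw [phiIntegrand, norm_mul, norm_mul, norm_inv, norm_inv, norm_pow, norm_pow, norm_neg, norm_pow,
    Complex.norm_real, Real.norm_of_nonneg (defect_nonneg _), defect_act g.1 hz, div_pow, mul_pow,
    div_pow]
  ring

/-- The terms with `γ ≠ 1` are exponentially small on the fundamental domain. -/
theorem exists_norm_tsum_phi_le (hn : 2 ≤ n) {α : ℝ} (hα : 0 < α) (hα1 : α < 1)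
    (hΓ : Summable fun g : Γ => (‖den g.1 0‖ ^ (2 * (n + 1)))⁻¹) {p₀ : Cn n} (hp₀ : p₀ ∈ ball n)
    (hX : closure (halfBall n hn α) ⊆ interior (dirichlet Γ p₀)) {r : ℝ} (hr0 : 0 ≤ r)
    (hr1 : r < 1) (hr : ∀ z ∈ dirichlet Γ p₀, nrm z ≤ r) [DecidableEq Γ] :
    ∃ B θ : ℝ, 0 ≤ B ∧ 0 < θ ∧ θ < 1 ∧ ∀ t : ℕ, ∀ z ∈ dirichlet Γ p₀,
      ‖∑' g : Γ, if g = 1 then 0 else phi Γ α (t + 2) g z • rhoCol ρ j g‖ ^ 2 *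
        (1 - nsq z) ^ ((n + 1) * (t + 1)) ≤ B * θ ^ t := by
  obtain ⟨θ, hθ0, hθ1, hθ⟩ := exists_kernel_ratio_le hn hα hα1 hX
  set V := volume.real (halfBallParam α) with hV
  have hV0 : 0 ≤ V := measureReal_nonneg
  have hr1' : 0 < 1 - r := sub_pos.2 hr1
  have hα1' : 0 < 1 - α := sub_pos.2 hα1
  set B₀ : ℝ := ((1 - r) ^ ((n + 1) * 2))⁻¹ * ((1 - α) ^ ((n + 1) * 2))⁻¹ with hB₀
  have hB₀0 : 0 ≤ B₀ := by positivity
  set A : ℝ := ∑' g : Γ, (‖den g.1 0‖ ^ (2 * (n + 1)))⁻¹ with hA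
  have hA0 : 0 ≤ A := tsum_nonneg fun g => by positivity
  have hterm : ∀ t : ℕ, ∀ z ∈ dirichlet Γ p₀, ∀ g : Γ, g ≠ 1 →
      ‖phi Γ α (t + 2) g z‖ * defect z ^ ((n + 1) * (t + 2)) ≤
        B₀ * θ ^ ((n + 1) * t) * V * (‖den g.1 0‖ ^ (2 * (n + 1)))⁻¹ := by
    intro t z hz g hg
    have hzb := hz.1
    have hyF := act_notMem_dirichlet hp₀ hz g.2 fun h => hg (Subtype.ext h)
    have hd : 0 < defect z ^ ((n + 1) * (t + 2)) := pow_pos (defect_pos hzb) _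
    have hpt : ∀ w ∈ halfBallParam α, ‖phiIntegrand (t + 2) z g w‖ ≤
        B₀ * θ ^ ((n + 1) * t) * (‖den g.1 0‖ ^ (2 * (n + 1)))⁻¹ /
          defect z ^ ((n + 1) * (t + 2)) := by
      intro w hw
      rw [le_div_iff₀ hd, norm_phiIntegrand_mul hzb]
      have h1 := hθ _ (act_mem_ball g.1 hzb) hyF w hw
      have h2 := norm_phiIntegrand_mul (k := 2) hzb g w
      have h3 := norm_phiIntegrand_le hn hα hα1 le_rfl hzb g hw
      have h4 : 0 ≤ defect (act g.1 z) * defect (embed n w) /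
          ‖herm (act g.1 z) (embed n w)‖ :=
        div_nonneg (mul_nonneg (defect_nonneg _) (defect_nonneg _)) (norm_nonneg _)
      have h5 : (1 - r) ≤ 1 - nrm z := by linarith [hr z hz]
      -- The exponent for `k = 2` supplies summability over the group; the remaining `(n+1)t` powers
      -- are estimated by `θ`.
      have h6 : (defect (act g.1 z) * defect (embed n w) / ‖herm (act g.1 z) (embed n w)‖) ^
          ((n + 1) * 2) ≤ B₀ * (‖den g.1 0‖ ^ (2 * (n + 1)))⁻¹ := by
        rw [← h2]
        calc _ ≤ ‖phiIntegrand 2 z g w‖ * 1 := by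
              gcongr
              exact pow_le_one₀ (defect_nonneg _) (defect_le_one _)
          _ ≤ _ := by
              rw [mul_one]
              refine h3.trans ?_
              rw [hB₀]
              gcongr
      rw [show (n + 1) * (t + 2) = (n + 1) * 2 + (n + 1) * t by ring, pow_add]
      calc _ ≤ B₀ * (‖den g.1 0‖ ^ (2 * (n + 1)))⁻¹ * θ ^ ((n + 1) * t) := by gcongr
        _ = _ := by ring
    have h7 := norm_setIntegral_le_of_norm_le_const (volume_halfBallParam_lt_top hα) hpt
    rw [integral_phiIntegrand] at h7
    calc _ ≤ (B₀ * θ ^ ((n + 1) * t) * (‖den g.1 0‖ ^ (2 * (n + 1)))⁻¹ /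
          defect z ^ ((n + 1) * (t + 2)) * V) * defect z ^ ((n + 1) * (t + 2)) := by gcongr
      _ = _ := by field_simp
  refine ⟨(B₀ * V * A) ^ 2 * ((1 - r ^ 2) ^ (n + 1))⁻¹, θ, ?_, hθ0, hθ1, fun t z hz => ?_⟩
  · have : 0 < 1 - r ^ 2 := by nlinarith
    positivity
  have hzb := hz.1
  have hd := defect_pos hzb
  have hdN : 0 < defect z ^ ((n + 1) * (t + 2)) := pow_pos hd _
  set v := ∑' g : Γ, if g = 1 then 0 else phi Γ α (t + 2) g z • rhoCol ρ j g with hv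
  have hvle : ‖v‖ * defect z ^ ((n + 1) * (t + 2)) ≤ B₀ * θ ^ ((n + 1) * t) * V * A := by
    rw [← le_div_iff₀ hdN]
    have hs : HasSum (fun g : Γ => B₀ * θ ^ ((n + 1) * t) * V /
        defect z ^ ((n + 1) * (t + 2)) * (‖den g.1 0‖ ^ (2 * (n + 1)))⁻¹)
        (B₀ * θ ^ ((n + 1) * t) * V / defect z ^ ((n + 1) * (t + 2)) * A) := hΓ.hasSum.mul_left _
    refine (tsum_of_norm_bounded hs fun g => ?_).trans (le_of_eq (by ring))
    by_cases hg : g = 1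
    · rw [if_pos hg, norm_zero]; positivity
    · rw [if_neg hg, norm_smul]
      refine (mul_le_of_le_one_right (norm_nonneg _) (norm_rhoCol_le ρ j g)).trans ?_
      rw [div_mul_eq_mul_div, le_div_iff₀ hdN]
      exact hterm t z hz g hg
  have hsq : (1 - r ^ 2) ≤ 1 - nsq z := by
    rw [← nrm_sq]
    have := hr z hz
    have := nrm_nonneg z
    nlinarith
  have hr2 : 0 < 1 - r ^ 2 := by nlinarith
  have hpow : (1 - nsq z) ^ ((n + 1) * (t + 1)) =
      (defect z ^ ((n + 1) * (t + 2))) ^ 2 * ((1 - nsq z) ^ (n + 1))⁻¹ := by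
    have : (1 - nsq z) ≠ 0 := (hr2.trans_le hsq).ne'
    have h8 : (defect z ^ ((n + 1) * (t + 2))) ^ 2 = (1 - nsq z) ^ ((n + 1) * (t + 2)) := by
      rw [← defect_sq hzb, ← pow_mul, ← pow_mul, mul_comm]
    rw [h8, show (n + 1) * (t + 2) = (n + 1) * (t + 1) + (n + 1) by ring, pow_add,
      mul_inv_cancel_right₀ (pow_ne_zero _ this)]
  -- Most of the decay is discarded: any geometric rate beats the polynomial growth of the
  -- normalization.
  have hθt : (θ ^ ((n + 1) * t)) ^ 2 ≤ θ ^ t := by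
    rw [← pow_mul]
    refine pow_le_pow_of_le_one hθ0.le hθ1.le ?_
    nlinarith
  have hnz : 0 < 1 - nsq z := hr2.trans_le hsq
  rw [hpow, ← mul_assoc, ← mul_pow]
  calc _ ≤ (B₀ * θ ^ ((n + 1) * t) * V * A) ^ 2 * ((1 - r ^ 2) ^ (n + 1))⁻¹ := by gcongr
    _ = (B₀ * V * A) ^ 2 * ((1 - r ^ 2) ^ (n + 1))⁻¹ * (θ ^ ((n + 1) * t)) ^ 2 := by ring
    _ ≤ _ := by gcongr

theorem phi_one (α : ℝ) (k : ℕ) (z : Cn n) :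
    phi Γ α k 1 z = waveT n α ((n + 1) * k) z := by
  simp [phi, den_one, act_one]

theorem sum_norm_sq_single_add_le (a : ℂ) (v : Fin m → ℂ) :
    ∑ i, ‖(a • (Pi.single j 1 : Fin m → ℂ) + v) i‖ ^ 2 ≤ 2 * ‖a‖ ^ 2 + 2 * m * ‖v‖ ^ 2 := by
  have h1 : ∀ i, ‖(a • (Pi.single j 1 : Fin m → ℂ) + v) i‖ ^ 2 ≤
      (if i = j then 2 * ‖a‖ ^ 2 else 0) + 2 * ‖v‖ ^ 2 := by
    intro i
    have h2 := norm_le_pi_norm v i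
    have h3 : ‖v i‖ ^ 2 ≤ ‖v‖ ^ 2 := by gcongr
    by_cases hi : i = j
    · subst hi
      simp only [Pi.add_apply, Pi.smul_apply, Pi.single_eq_same, smul_eq_mul, mul_one, if_true]
      have h4 := norm_add_le a (v i)
      nlinarith [sq_nonneg (‖a‖ - ‖v i‖), norm_nonneg (a + v i), norm_nonneg a, norm_nonneg (v i)]
    · simp only [Pi.add_apply, Pi.smul_apply, Pi.single_eq_of_ne hi, smul_zero, zero_add,
        if_neg hi]
      nlinarith [sq_nonneg ‖v‖]
  refine (Finset.sum_le_sum fun i _ => h1 i).trans (le_of_eq ?_)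
  rw [Finset.sum_add_distrib, Finset.sum_ite_eq' Finset.univ j]
  simp
  ring

/-- The powers of `κ` cancel down to one: `κ^{-k}` from `K(p,p)^{-k/2}`, `κ^{2k}` from the kernels,
`(κW)^{-2}` from the normalizing constant and `κ^{-(k-1)}` from the weight. -/
theorem innerDensity_thetaSub (hn : 2 ≤ n) {α : ℝ} (hα : 0 < α) (hα1 : α < 1)
    (hΓ : Summable fun g : Γ => (‖den g.1 0‖ ^ (2 * (n + 1)))⁻¹) (l : ℕ) (hl : 1 ≤ l)
    {z : Cn n} (hz : z ∈ ball n) :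
    innerDensity (l + 1) (thetaSub Γ ρ j (l + 1) (halfBallMeasure n α))
      (thetaSub Γ ρ j (l + 1) (halfBallMeasure n α)) z =
    (((kappa n * weightedVol n l ^ 2)⁻¹ *
      ((∑ i, ‖(∑' g : Γ, phi Γ α (l + 1) g z • rhoCol ρ j g) i‖ ^ 2) *
        (1 - nsq z) ^ ((n + 1) * l)) : ℝ) : ℂ) := by
  have hκ := kappa_pos n
  have hW := weightedVol_pos (by omega : 0 < n) l
  have hnz : 0 < 1 - nsq z := by linarith [mem_ball_iff.1 hz]
  set S := ∑' g : Γ, phi Γ α (l + 1) g z • rhoCol ρ j g with hS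
  have hfac : ‖thetaFactor n (l + 1)‖ ^ 2 = kappa n ^ (l + 1) * (kappa n * weightedVol n l)⁻¹ ^ 2 := by
    have h1 : (kappa n ^ (-((l + 1 : ℕ) : ℝ) / 2)) ^ 2 = (kappa n ^ (l + 1))⁻¹ := by
      rw [← Real.rpow_natCast, ← Real.rpow_mul hκ.le, ← Real.rpow_natCast, ← Real.rpow_neg hκ.le]
      congr 1
      push_cast
      ring
    rw [thetaFactor, kernelConst_eq, norm_mul, norm_mul, norm_pow, Complex.norm_real,
      Complex.norm_real, Complex.norm_real, Real.norm_of_nonneg hκ.le,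
      Real.norm_of_nonneg (Real.rpow_nonneg hκ.le _), Real.norm_of_nonneg (by positivity),
      mul_pow, mul_pow, h1]
    field_simp
  have hsum : ∑ i, thetaSub Γ ρ j (l + 1) (halfBallMeasure n α) z i *
      conj (thetaSub Γ ρ j (l + 1) (halfBallMeasure n α) z i) =
      ((‖thetaFactor n (l + 1)‖ ^ 2 * ∑ i, ‖S i‖ ^ 2 : ℝ) : ℂ) := by
    rw [thetaSub_eq ρ j hn hα hα1 hΓ (by omega) hz, Finset.mul_sum, Complex.ofReal_sum]
    refine Finset.sum_congr rfl fun i _ => ?_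
    rw [Complex.mul_conj, Complex.normSq_eq_norm_sq, Pi.smul_apply, norm_smul, mul_pow]
  rw [innerDensity, hsum, kernel_self, hfac, ← Complex.ofReal_pow, ← Complex.ofReal_inv,
    ← Complex.ofReal_mul, ← Complex.ofReal_mul]
  congr 1
  have h2 : (1 - nsq z) ^ (n + 1) ≠ 0 := (pow_pos hnz _).ne'
  rw [pow_mul]
  generalize (1 - nsq z) ^ (n + 1) = y at h2 ⊢
  simp only [mul_pow, inv_pow]
  field_simp
  ring

/-- The density is continuous on the ball, and `F` lies in a compact ball inside it. -/
theorem integrableOn_innerDensity_thetaSub (hn : 2 ≤ n) {α : ℝ} (hα : 0 < α) (hα1 : α < 1)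
    (hΓ : Summable fun g : Γ => (‖den g.1 0‖ ^ (2 * (n + 1)))⁻¹) {k : ℕ} (hk : 2 ≤ k)
    {F : Set (Cn n)} {r : ℝ} (hr1 : r < 1) (hr : ∀ z ∈ F, nrm z ≤ r) :
    IntegrableOn (innerDensity k (thetaSub Γ ρ j k (halfBallMeasure n α))
      (thetaSub Γ ρ j k (halfBallMeasure n α))) F := by
  have hc := (isAutomorphicForm_thetaSub ρ j hn hα hα1 hΓ hk).1.continuousOn
  have hker : ∀ z ∈ ball n, kernel z z ≠ 0 := by
    intro z hz
    have hnz : 0 < 1 - nsq z := by linarith [mem_ball_iff.1 hz]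
    have := kappa_pos n
    rw [kernel_self]
    exact_mod_cast (by positivity : kappa n * ((1 - nsq z) ^ (n + 1))⁻¹ ≠ 0)
  have hkc : ContinuousOn (fun z : Cn n => kernel z z) (ball n) := by
    simp only [kernel_eq]
    refine continuousOn_const.mul (ContinuousOn.inv₀ ?_ fun z hz => ?_)
    · exact ((continuous_neg_herm.comp (continuous_id.prodMk continuous_id)).pow _).continuousOn
    · exact pow_ne_zero _ (neg_ne_zero.2 (herm_ne_zero hz hz))
  have hd : ContinuousOn (innerDensity k (thetaSub Γ ρ j k (halfBallMeasure n α))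
      (thetaSub Γ ρ j k (halfBallMeasure n α))) (ball n) := by
    unfold innerDensity
    refine ContinuousOn.mul (ContinuousOn.mul (continuousOn_finsetSum _ fun i _ => ?_) ?_) hkc
    · have hci := (continuous_apply i).comp_continuousOn hc
      exact hci.mul (Complex.continuous_conj.comp_continuousOn hci)
    · exact (hkc.pow k).inv₀ fun z hz => pow_ne_zero _ (hker z hz)
  have hsub : {z : Cn n | nrm z ≤ r} ⊆ ball n := fun z hz => mem_ball_iff_nrm.2 (hz.trans_lt hr1)
  exact ((hd.mono hsub).integrableOn_compact (isCompact_nrm_le n r)).mono_set hr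

end Theta

section Theta

variable {n m : ℕ} {Γ : Subgroup (SU n)} (ρ : Γ →* unitaryGroup (Fin m) ℂ) (j : Fin m)

/-- The term `γ = 1` is estimated over the whole ball, where its integral is controlled by
invariance; the others are pointwise small on the domain. The group enters only through `B` and `θ`,
which multiply an exponentially small quantity. -/
theorem exists_norm_innerProd_le (hn : 2 ≤ n) {α : ℝ} (hα : 0 < α) (hα1 : α < 1)
    (hΓ : Summable fun g : Γ => (‖den g.1 0‖ ^ (2 * (n + 1)))⁻¹) {p₀ : Cn n} (hp₀ : p₀ ∈ ball n)
    (hX : closure (halfBall n hn α) ⊆ interior (dirichlet Γ p₀)) {r : ℝ} (hr0 : 0 ≤ r)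
    (hr1 : r < 1) (hr : ∀ z ∈ dirichlet Γ p₀, nrm z ≤ r) :
    ∃ B θ : ℝ, 0 ≤ B ∧ 0 < θ ∧ θ < 1 ∧ ∀ t : ℕ,
      ‖innerProd Γ p₀ (t + 2) (thetaSub Γ ρ j (t + 2) (halfBallMeasure n α))
        (thetaSub Γ ρ j (t + 2) (halfBallMeasure n α))‖ ≤
      (kappa n * weightedVol n (t + 1) ^ 2)⁻¹ * (2 * ((2 * Real.pi / ((n + 1) * (t + 2) : ℕ)) ^ 2 *
        α ^ 2 * weightedVol n (t + 1)) + B * θ ^ t) := by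
  classical
  obtain ⟨B, θ, hB, hθ0, hθ1, hrest⟩ :=
    exists_norm_tsum_phi_le ρ j hn hα hα1 hΓ hp₀ hX hr0 hr1 hr
  refine ⟨2 * m * B * volume.real (ball n), θ, by positivity, hθ0, hθ1, fun t => ?_⟩
  have hc : Countable Γ := countable_of_summable_inv_norm_den hΓ
  have hFm : MeasurableSet (dirichlet Γ p₀) := measurableSet_dirichlet hp₀
  have hκ := kappa_pos n
  have hW := weightedVol_pos (by omega : 0 < n) (t + 1)
  set C := (kappa n * weightedVol n (t + 1) ^ 2)⁻¹ with hC
  have hC0 : 0 < C := by positivity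
  set M := fun z : Cn n => ‖waveT n α ((n + 1) * (t + 2)) z‖ ^ 2 *
    (1 - nsq z) ^ ((n + 1) * (t + 1)) with hM
  have hpt : ∀ z ∈ dirichlet Γ p₀, ‖innerDensity (t + 2)
      (thetaSub Γ ρ j (t + 2) (halfBallMeasure n α))
      (thetaSub Γ ρ j (t + 2) (halfBallMeasure n α)) z‖ₑ ≤
      ENNReal.ofReal C * (2 * ENNReal.ofReal (M z) + ENNReal.ofReal (2 * m * B * θ ^ t)) := by
    intro z hz
    have hzb := hz.1
    have hnz : 0 < 1 - nsq z := by linarith [mem_ball_iff.1 hzb]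
    have hw : 0 ≤ (1 - nsq z) ^ ((n + 1) * (t + 1)) := by positivity
    have hM0 : 0 ≤ M z := by positivity
    have hd := innerDensity_thetaSub ρ j hn hα hα1 hΓ (t + 1) (by omega) hzb
    rw [show t + 1 + 1 = t + 2 from rfl] at hd
    -- Splitting off the identity element; the cross term is absorbed by `|a + b|² ≤ 2|a|² + 2|b|²`.
    rw [hd, (summable_phi_smul ρ j hn hα hα1 hΓ (by omega) hzb).tsum_eq_add_tsum_ite 1, phi_one,
      rhoCol_one, ← ofReal_norm, Complex.norm_real, Real.norm_of_nonneg (by positivity),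
      ← ENNReal.ofReal_ofNat, ← ENNReal.ofReal_mul (by norm_num),
      ← ENNReal.ofReal_add (by positivity) (by positivity), ← ENNReal.ofReal_mul hC0.le]
    refine ENNReal.ofReal_le_ofReal (mul_le_mul_of_nonneg_left ?_ hC0.le)
    have h1 := sum_norm_sq_single_add_le j (waveT n α ((n + 1) * (t + 2)) z)
      (∑' g : Γ, if g = 1 then 0 else phi Γ α (t + 2) g z • rhoCol ρ j g)
    refine (mul_le_mul_of_nonneg_right h1 hw).trans ?_
    have h2 := mul_le_mul_of_nonneg_left (hrest t z hz) (by positivity : (0 : ℝ) ≤ 2 * m)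
    rw [hM]
    linarith
  have hmain := lintegral_waveT_sq_le hn hα hα1 (t + 1)
  rw [show t + 1 + 1 = t + 2 from rfl] at hmain
  have hE : 0 ≤ 2 * m * B * θ ^ t := by positivity
  have hball : ENNReal.ofReal (volume.real (ball n)) = volume (ball n) :=
    ENNReal.ofReal_toReal (volume_ball_lt_top n).ne
  refine (ENNReal.ofReal_le_ofReal_iff (by positivity)).1 ?_
  rw [ofReal_norm]
  calc _ ≤ ∫⁻ z in dirichlet Γ p₀, ENNReal.ofReal C *
        (2 * ENNReal.ofReal (M z) + ENNReal.ofReal (2 * m * B * θ ^ t)) :=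
        (enorm_integral_le_lintegral_enorm _).trans (setLIntegral_mono' hFm hpt)
    _ ≤ ∫⁻ z in ball n, ENNReal.ofReal C *
        (2 * ENNReal.ofReal (M z) + ENNReal.ofReal (2 * m * B * θ ^ t)) :=
        lintegral_mono_set dirichlet_subset_ball
    _ = ENNReal.ofReal C * (2 * (∫⁻ z in ball n, ENNReal.ofReal (M z)) +
        ENNReal.ofReal (2 * m * B * θ ^ t) * volume (ball n)) := by
        rw [lintegral_const_mul' _ _ ENNReal.ofReal_ne_top, lintegral_add_right _ measurable_const,
          lintegral_const_mul' _ _ (by simp), setLIntegral_const]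
    _ ≤ ENNReal.ofReal C * (2 * ENNReal.ofReal ((2 * Real.pi / ((n + 1) * (t + 2) : ℕ)) ^ 2 *
        α ^ 2 * weightedVol n (t + 1)) +
        ENNReal.ofReal (2 * m * B * θ ^ t) * ENNReal.ofReal (volume.real (ball n))) := by
        rw [hball]
        gcongr
    _ = _ := by
        rw [← ENNReal.ofReal_mul hE, ← ENNReal.ofReal_ofNat, ← ENNReal.ofReal_mul (by norm_num),
          ← ENNReal.ofReal_add (by positivity) (by positivity), ← ENNReal.ofReal_mul hC0.le]
        congr 3
        ring

/-! ### Growth rate in `k`. -/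

/-- The constant in the lower bound for the weighted volume. -/
def volConst (n : ℕ) : ℝ := (Real.pi / (2 * n * (n + 1))) ^ n / 2

theorem volConst_pos {n : ℕ} (hn : 0 < n) : 0 < volConst n := by
  have : (0 : ℝ) < n := by exact_mod_cast hn
  have := Real.pi_pos
  unfold volConst
  positivity

theorem inv_weightedVol_le (hn : 0 < n) (l : ℕ) :
    (weightedVol n l)⁻¹ ≤ ((l + 1 : ℕ) : ℝ) ^ n / volConst n := by
  have h := weightedVol_ge hn l
  have h1 : (Real.pi / (2 * n * (n + 1) * (l + 1))) ^ n / 2 =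
      volConst n / ((l + 1 : ℕ) : ℝ) ^ n := by
    rw [volConst, ← div_div Real.pi, div_pow _ ((l : ℝ) + 1)]
    push_cast
    ring
  rw [h1] at h
  have h2 := volConst_pos hn
  rw [← inv_div]
  exact inv_anti₀ (by positivity) h

/-- The constant in the norm estimate. -/
def normConst (n : ℕ) : ℝ := 8 * Real.pi ^ 2 / (kappa n * volConst n) + 1

theorem normConst_pos {n : ℕ} (hn : 0 < n) : 0 < normConst n := by
  have := kappa_pos n
  have := volConst_pos hn
  unfold normConst
  positivity

theorem eventually_norm_innerProd_le (hn : 2 ≤ n) {α : ℝ} (hα : 0 < α) (hα1 : α < 1)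
    (hΓ : Summable fun g : Γ => (‖den g.1 0‖ ^ (2 * (n + 1)))⁻¹) {p₀ : Cn n} (hp₀ : p₀ ∈ ball n)
    (hX : closure (halfBall n hn α) ⊆ interior (dirichlet Γ p₀)) {r : ℝ} (hr0 : 0 ≤ r)
    (hr1 : r < 1) (hr : ∀ z ∈ dirichlet Γ p₀, nrm z ≤ r) :
    ∀ᶠ k : ℕ in atTop, ‖innerProd Γ p₀ k (thetaSub Γ ρ j k (halfBallMeasure n α))
      (thetaSub Γ ρ j k (halfBallMeasure n α))‖ ≤ normConst n * (k : ℝ) ^ ((n : ℝ) - 2) := by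
  obtain ⟨B, θ, hB, hθ0, hθ1, hbound⟩ :=
    exists_norm_innerProd_le ρ j hn hα hα1 hΓ hp₀ hX hr0 hr1 hr
  have hn0 : 0 < n := by omega
  have hκ := kappa_pos n
  have hv := volConst_pos hn0
  -- The remainder after inserting `W⁻¹ ≤ k^n / volConst n` twice; the factor `θ²` in the
  -- denominator comes from `t = k - 2`.
  have hlim : Tendsto (fun k : ℕ => B / (kappa n * volConst n ^ 2 * θ ^ 2) *
      ((k : ℝ) ^ (2 * n) * θ ^ k)) atTop (𝓝 0) := by
    have := (tendsto_pow_const_mul_const_pow_of_abs_lt_one (2 * n)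
      (by rwa [abs_of_pos hθ0] : |θ| < 1)).const_mul (B / (kappa n * volConst n ^ 2 * θ ^ 2))
    simpa using this
  filter_upwards [eventually_ge_atTop 2, hlim.eventually_le_const one_pos] with k hk hsmall
  obtain ⟨t, rfl⟩ := Nat.exists_eq_add_of_le' hk
  refine (hbound t).trans ?_
  have hW := weightedVol_pos hn0 (t + 1)
  have hinv := inv_weightedVol_le hn0 (t + 1)
  rw [show t + 1 + 1 = t + 2 from rfl] at hinv
  set W := weightedVol n (t + 1) with hWdef
  set k : ℝ := ((t + 2 : ℕ) : ℝ) with hkdef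
  have hk1 : 1 ≤ k := by rw [hkdef]; exact_mod_cast (by omega : 1 ≤ t + 2)
  have hrpow : k ^ ((n : ℝ) - 2) = k ^ n / k ^ 2 := by
    rw [Real.rpow_sub (by linarith), Real.rpow_natCast, Real.rpow_two]
  -- As `n ≥ 2`, a remainder bounded by `1` is absorbed by `k^{n-2}`; this is the summand `1` in
  -- `normConst`.
  have hone : 1 ≤ k ^ ((n : ℝ) - 2) := by
    refine Real.one_le_rpow hk1 ?_
    have : (2 : ℝ) ≤ n := by exact_mod_cast hn
    linarith
  have hNk : k ≤ (((n + 1) * (t + 2) : ℕ) : ℝ) := by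
    rw [hkdef]
    exact_mod_cast Nat.le_mul_of_pos_left _ (by omega)
  -- One factor `W⁻¹` survives and contributes `k^n`, while the square of the Gaussian factor
  -- contributes `k^{-2}`. Using `N ≥ k` and `α ≤ 1` makes the constant depend on `n` alone.
  have hfirst : (kappa n * W ^ 2)⁻¹ * (2 * ((2 * Real.pi / ((n + 1) * (t + 2) : ℕ)) ^ 2 *
      α ^ 2 * W)) ≤ 8 * Real.pi ^ 2 / (kappa n * volConst n) * k ^ ((n : ℝ) - 2) := by
    have h1 : (2 * Real.pi / ((n + 1) * (t + 2) : ℕ)) ^ 2 ≤ (2 * Real.pi / k) ^ 2 := by gcongr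
    have h2 : α ^ 2 ≤ 1 := pow_le_one₀ hα.le hα1.le
    calc _ = (kappa n)⁻¹ * 2 * (2 * Real.pi / ((n + 1) * (t + 2) : ℕ)) ^ 2 * α ^ 2 * W⁻¹ := by
          field_simp
      _ ≤ (kappa n)⁻¹ * 2 * (2 * Real.pi / k) ^ 2 * 1 * (k ^ n / volConst n) := by gcongr
      _ = _ := by
          rw [hrpow]
          field_simp
          ring
  have hsecond : (kappa n * W ^ 2)⁻¹ * (B * θ ^ t) ≤ 1 := by
    refine le_trans ?_ hsmall
    calc _ = (kappa n)⁻¹ * W⁻¹ ^ 2 * (B * θ ^ t) := by field_simp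
      _ ≤ (kappa n)⁻¹ * (k ^ n / volConst n) ^ 2 * (B * θ ^ t) := by gcongr
      _ = _ := by
          rw [pow_add θ t 2, div_pow, ← pow_mul, mul_comm n 2]
          field_simp
  rw [mul_add (kappa n * W ^ 2)⁻¹, normConst, add_mul _ (1 : ℝ), one_mul]
  exact add_le_add hfirst (hsecond.trans hone)

end Theta

/-- Otherwise `k^b` would be `O(k^a)` and hence little-o of itself, although it never vanishes for
`k ≥ 1`. -/
theorem not_isEquivalent_of_le_rpow {f : ℕ → ℝ} {C a b c : ℝ} (hab : a < b) (hc : c ≠ 0)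
    (hf : ∀ᶠ k : ℕ in atTop, |f k| ≤ C * (k : ℝ) ^ a) :
    ¬ Asymptotics.IsEquivalent atTop f fun k : ℕ => c * (k : ℝ) ^ b := by
  intro h
  have h1 : f =O[atTop] fun k : ℕ => (k : ℝ) ^ a := by
    refine Asymptotics.IsBigO.of_bound C ?_
    filter_upwards [hf] with k hk
    rwa [Real.norm_eq_abs, Real.norm_of_nonneg (by positivity)]
  have h2 : (fun k : ℕ => (k : ℝ) ^ a) =o[atTop] fun k : ℕ => (k : ℝ) ^ b := by
    refine Asymptotics.isLittleO_of_tendsto' ?_ ?_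
    · filter_upwards [eventually_ge_atTop 1] with k hk h0
      have hk0 : (0 : ℝ) < k := by exact_mod_cast hk
      exact absurd h0 (Real.rpow_pos_of_pos hk0 b).ne'
    · have h5 := (tendsto_rpow_neg_atTop (sub_pos.2 hab)).comp
        (tendsto_natCast_atTop_atTop (R := ℝ))
      refine h5.congr' ?_
      filter_upwards [eventually_ge_atTop 1] with k hk
      have hk0 : (0 : ℝ) < k := by exact_mod_cast hk
      rw [Function.comp_apply, ← Real.rpow_sub hk0, neg_sub]
  have h3 : (fun k : ℕ => (k : ℝ) ^ b) =O[atTop] fun k : ℕ => c * (k : ℝ) ^ b :=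
    Asymptotics.isBigO_self_const_mul hc _ _
  have h4 : (fun k : ℕ => c * (k : ℝ) ^ b) =o[atTop] fun k : ℕ => c * (k : ℝ) ^ b :=
    (h.symm.isBigO.trans h1).trans_isLittleO (h2.trans_isBigO h3)
  refine Asymptotics.isLittleO_irrefl (Eventually.frequently ?_) h4
  filter_upwards [eventually_ge_atTop 1] with k hk
  have hk0 : (0 : ℝ) < k := by exact_mod_cast hk
  exact mul_ne_zero hc (ne_of_gt (Real.rpow_pos_of_pos hk0 b))

/-! ### The half ball as a CR submanifold -/

/-- An open set whose intersection with the range of `embed` is the half ball. -/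
def halfBallOpen (n : ℕ) (hn : 2 ≤ n) (α : ℝ) : Set (Cn n) :=
  ball n ∩ {z | (z ⟨0, by omega⟩).re ^ 2 + (z ⟨0, by omega⟩).im ^ 2 + (z ⟨1, by omega⟩).re ^ 2 <
    α ^ 2} ∩ {z | 0 < (z ⟨1, by omega⟩).re}

theorem isOpen_halfBallOpen (n : ℕ) (hn : 2 ≤ n) (α : ℝ) : IsOpen (halfBallOpen n hn α) := by
  refine ((isOpen_ball n).inter (isOpen_lt ?_ continuous_const)).inter
    (isOpen_lt continuous_const ?_) <;> fun_prop

theorem halfBall_eq_inter {n : ℕ} (hn : 2 ≤ n) {α : ℝ} (hα : 0 < α) (hα1 : α < 1) :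
    halfBall n hn α = halfBallOpen n hn α ∩ (LinearMap.range (embedL n) : Set (Cn n)) := by
  ext z
  constructor
  · intro hz
    obtain ⟨w, -, hw⟩ := (mem_halfBall_iff hn hα1 hα).1 hz
    exact ⟨⟨⟨hz.1, hz.2.1⟩, hz.2.2.1⟩, w, hw⟩
  · rintro ⟨⟨⟨-, h1⟩, h2⟩, w, rfl⟩
    refine (mem_halfBall_iff hn hα1 hα).2 ⟨w, ⟨?_, ?_⟩, rfl⟩
    · simpa [embedL, embed] using h1
    · simpa [embedL, embed] using h2

theorem finrank_range_embedL {n : ℕ} (hn : 2 ≤ n) :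
    Module.finrank ℝ (LinearMap.range (embedL n)) = 3 := by
  rw [LinearMap.finrank_range_of_inj (embed_injective hn)]
  simp [Complex.finrank_real_complex]

theorem isSubmanifold_halfBall {n : ℕ} (hn : 2 ≤ n) {α : ℝ} (hα : 0 < α) (hα1 : α < 1) :
    IsSubmanifold 3 (halfBall n hn α) := by
  intro p hp
  rw [halfBall_eq_inter hn hα hα1] at hp ⊢
  refine ⟨OpenPartialHomeomorph.ofSet _ (isOpen_halfBallOpen n hn α), hp.1, contDiffOn_id,
    contDiffOn_id, LinearMap.range (embedL n), finrank_range_embedL hn, ?_⟩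
  simp

/-- An open piece of a linear subspace: difference quotients stay in the subspace, which is closed,
and conversely small multiples of its vectors keep the point in `X`. -/
theorem tangentSp_halfBall {n : ℕ} (hn : 2 ≤ n) {α : ℝ} (hα : 0 < α) (hα1 : α < 1) {p : Cn n}
    (hp : p ∈ halfBall n hn α) : tangentSp (halfBall n hn α) p = LinearMap.range (embedL n) := by
  rw [halfBall_eq_inter hn hα hα1] at hp ⊢
  refine le_antisymm (Submodule.span_le.2 fun v hv => ?_) fun v hv => Submodule.subset_span ?_
  · obtain ⟨ι, l, hl, c, d, -, hd, hcd⟩ := exists_fun_of_mem_tangentConeAt hv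
    have hcl : IsClosed (LinearMap.range (embedL n) : Set (Cn n)) :=
      Submodule.closed_of_finiteDimensional _
    refine hcl.mem_of_tendsto hcd ?_
    filter_upwards [hd] with i hi
    refine Submodule.smul_mem _ _ ?_
    simpa using Submodule.sub_mem _ hi.2 hp.2
  · refine mem_tangentConeAt_of_add_smul_mem (l := 𝓝[≠] (0 : ℝ)) (c := id) tendsto_id ?_
    have hc : Tendsto (fun c : ℝ => p + c • v) (𝓝[≠] 0) (𝓝 p) := by
      have : Continuous fun c : ℝ => p + c • v := by fun_prop
      simpa using (this.tendsto 0).mono_left nhdsWithin_le_nhds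
    filter_upwards [hc ((isOpen_halfBallOpen n hn α).mem_nhds hp.1)] with c h
    exact ⟨h, Submodule.add_mem _ hp.2 (Submodule.smul_mem _ c hv)⟩

/-- The complex hyperbolic Hermitian metric, up to a positive factor. -/
def hypHerm {n : ℕ} (p v w : Cn n) : ℂ :=
  ((1 - ∑ i, p i * conj (p i)) * (∑ i, v i * conj (w i)) +
    (∑ i, v i * conj (p i)) * (∑ i, p i * conj (w i))) / (1 - ∑ i, p i * conj (p i)) ^ 2

theorem hypMetric_eq {n : ℕ} (p v w : Cn n) : hypMetric p v w = (hypHerm p v w).re := rfl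

theorem hypHerm_smul_left {n : ℕ} (p v w : Cn n) (a : ℂ) :
    hypHerm p (a • v) w = a * hypHerm p v w := by
  simp only [hypHerm, Pi.smul_apply, smul_eq_mul, mul_assoc, ← Finset.mul_sum]
  ring

theorem hypHerm_smul_right {n : ℕ} (p v w : Cn n) (a : ℂ) :
    hypHerm p v (a • w) = conj a * hypHerm p v w := by
  simp only [hypHerm, Pi.smul_apply, smul_eq_mul, map_mul, mul_left_comm _ (conj a),
    ← Finset.mul_sum]
  ring

theorem hypHerm_add_right {n : ℕ} (p v w w' : Cn n) :
    hypHerm p v (w + w') = hypHerm p v w + hypHerm p v w' := by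
  simp only [hypHerm, Pi.add_apply, map_add, mul_add, Finset.sum_add_distrib]
  ring

theorem hypHerm_self {n : ℕ} (p v : Cn n) :
    hypHerm p v v = (((1 - nsq p) * nsq v + ‖∑ i, v i * conj (p i)‖ ^ 2) /
      (1 - nsq p) ^ 2 : ℝ) := by
  have h : ∑ i, p i * conj (v i) = conj (∑ i, v i * conj (p i)) := by
    simp [mul_comm]
  rw [hypHerm, h, Complex.mul_conj, Complex.normSq_eq_norm_sq, sum_mul_conj_self,
    sum_mul_conj_self]
  push_cast
  ring

theorem embed_fst {n : ℕ} (a : ℂ) : embed n (a, 0) = a • embed n (1, 0) := by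
  ext i
  simp [embed]

/-- The holomorphic frame of the complex directions of the half ball. -/
def crFrame (n : ℕ) : Fin 2 → Cn n := ![embed n (1, 0), embed n (Complex.I, 0)]

theorem mem_span_crFrame {n : ℕ} {v : Cn n} :
    v ∈ Submodule.span ℝ (Set.range (crFrame n)) ↔ ∃ a : ℂ, v = a • embed n (1, 0) := by
  rw [crFrame, Matrix.range_cons, Matrix.range_cons, Matrix.range_empty, Set.union_empty,
    Set.singleton_union, Submodule.mem_span_pair]
  have key : ∀ x y : ℝ, x • embed n (1, 0) + y • embed n (Complex.I, 0) =
      (x + y * Complex.I : ℂ) • embed n (1, 0) := fun x y => by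
    rw [embed_fst Complex.I, add_smul, mul_smul, Complex.coe_smul, Complex.coe_smul]
  constructor
  · rintro ⟨x, y, rfl⟩
    exact ⟨_, key x y⟩
  · rintro ⟨a, rfl⟩
    exact ⟨a.re, a.im, by rw [key, Complex.re_add_im]⟩

theorem linearIndependent_crFrame {n : ℕ} (hn : 2 ≤ n) : LinearIndependent ℝ (crFrame n) := by
  refine LinearIndependent.pair_iff.2 fun x y h => ?_
  have h0 := congrFun h ⟨0, by omega⟩
  have h1 : (x : ℂ) + y * Complex.I = 0 := by simpa [embed] using h0
  have hre := congrArg Complex.re h1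
  have him := congrArg Complex.im h1
  simp at hre him
  exact ⟨hre, him⟩

/-- The distribution is the constant complex line of the first coordinate. No normal vector is
computed: a tangent `v` orthogonal to this line is Hermitian orthogonal to it, and, unless `v` is
zero, it spans the tangent space together with the line. Finally `iv` is always real-orthogonal to
`v`. -/
theorem isCRSubmanifold_halfBall {n : ℕ} (hn : 2 ≤ n) {α : ℝ} (hα : 0 < α) (hα1 : α < 1) :
    IsCRSubmanifold 3 (halfBall n hn α) := by
  refine ⟨fun z hz => hz.1, isSubmanifold_halfBall hn hα hα1,
    fun _ => Submodule.span ℝ (Set.range (crFrame n)), ⟨fun p hp => ?_, 2, fun p hp => ?_⟩,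
    fun p hp => ⟨fun v hv => ?_, fun v hv hvD u hu => ?_⟩⟩
  · rw [tangentSp_halfBall hn hα hα1 hp]
    intro v hv
    obtain ⟨a, rfl⟩ := mem_span_crFrame.1 hv
    exact ⟨(a, 0), embed_fst a⟩
  · exact ⟨Set.univ, isOpen_univ, Set.mem_univ p, fun i _ => crFrame n i,
      fun i => contDiffOn_const, fun x _ => ⟨linearIndependent_crFrame hn, rfl⟩⟩
  · obtain ⟨a, rfl⟩ := mem_span_crFrame.1 hv
    exact mem_span_crFrame.2 ⟨Complex.I * a, by rw [mul_smul]⟩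
  · rw [tangentSp_halfBall hn hα hα1 hp] at hv hu
    obtain ⟨⟨a, t⟩, rfl⟩ := hv
    obtain ⟨⟨b, s⟩, rfl⟩ := hu
    simp only [hypMetric_eq] at hvD ⊢
    set v := embedL n (a, t) with hv
    set e := embed n (1, 0) with he
    have hpb : 0 < 1 - nsq p := by linarith [mem_ball_iff.1 hp.1]
    -- Real orthogonality to both `e` and `ie` kills the real and imaginary parts of the Hermitian
    -- product.
    have hve : hypHerm p v e = 0 := by
      have h1 := hvD e (mem_span_crFrame.2 ⟨1, (one_smul _ _).symm⟩)
      have h2 := hvD (Complex.I • e) (mem_span_crFrame.2 ⟨Complex.I, rfl⟩)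
      rw [hypHerm_smul_right] at h2
      refine Complex.ext h1 ?_
      simpa using h2
    have hsplit : ∀ (x : ℂ) (y : ℝ), embedL n (x, y) = x • e + embed n (0, y) := fun x y => by
      rw [he, ← embed_fst]
      change embedL n (x, y) = embedL n (x, 0) + embedL n (0, y)
      rw [← map_add]; simp
    by_cases ht : t = 0
    · have h0 : embed n ((0 : ℂ), (0 : ℝ)) = 0 := (embedL n).map_zero
      have hva : v = a • e := by rw [hv, hsplit, ht, h0, add_zero]
      have hee : hypHerm p e e ≠ 0 := by
        rw [hypHerm_self]
        have hne : nsq e = 1 := by rw [he, nsq_embed hn]; simp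
        rw [hne]
        exact_mod_cast (by positivity)
      rw [hva, hypHerm_smul_left] at hve
      have ha : a = 0 := (mul_eq_zero.1 hve).resolve_right hee
      rw [hva, ha, zero_smul, smul_zero, ← zero_smul ℂ (0 : Cn n), hypHerm_smul_left]
      simp
    -- With nonzero last coordinate, `v` is transverse to the complex line, so each tangent vector
    -- is a complex multiple of `e` plus a real multiple of `v`. The reality of the second
    -- coefficient is what makes the product with `iv` purely imaginary.
    · have hu : embedL n (b, s) = (b - (s / t : ℝ) * a) • e + ((s / t : ℝ) : ℂ) • v := by
        have h1 : embed n ((0 : ℂ), s) = ((s / t : ℝ) : ℂ) • embed n (0, t) := by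
          rw [Complex.coe_smul]
          change embedL n (0, s) = (s / t) • embedL n (0, t)
          rw [← map_smul]
          simp [ht]
        rw [hv, hsplit, hsplit, h1, sub_smul, smul_add, mul_smul]
        abel
      rw [hu, hypHerm_add_right, hypHerm_smul_right, hypHerm_smul_right, hypHerm_smul_left,
        hypHerm_smul_left, hve, hypHerm_self, Complex.conj_ofReal]
      generalize ((1 - nsq p) * nsq v + ‖∑ i, v i * conj (p i)‖ ^ 2) / (1 - nsq p) ^ 2 = q
      simp

theorem not_isTotallyReal_halfBall {n : ℕ} (hn : 2 ≤ n) {α : ℝ} (hα : 0 < α) (hα1 : α < 1) :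
    ¬ IsTotallyReal (halfBall n hn α) := by
  intro h
  obtain ⟨p, hp⟩ := halfBall_nonempty hn hα hα1
  have h1 := h p hp (embed n (1, 0))
  rw [tangentSp_halfBall hn hα hα1 hp, ← embed_fst] at h1
  have h2 := congrFun (h1 ⟨_, rfl⟩ ⟨_, rfl⟩) ⟨0, by omega⟩
  simp [embed] at h2

theorem not_isComplexSub_halfBall {n : ℕ} (hn : 2 ≤ n) {α : ℝ} (hα : 0 < α) (hα1 : α < 1) :
    ¬ IsComplexSub (halfBall n hn α) := by
  intro h
  obtain ⟨p, hp⟩ := halfBall_nonempty hn hα hα1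
  have h1 := h p hp (embed n (0, 1))
  rw [tangentSp_halfBall hn hα hα1 hp] at h1
  obtain ⟨w, hw⟩ := h1 ⟨_, rfl⟩
  have h2 := congrArg Complex.im (congrFun hw ⟨1, by omega⟩)
  simp [embedL, embed] at h2

end BallForms
end

open BallForms Filter MeasureTheory in
theorem mainTheorem6 (n : ℕ) (hn : 2 ≤ n) (α : ℝ) (hα₀ : 0 < α) (hα₁ : α < 1) :
    (IsCRSubmanifold 3 (halfBall n hn α) ∧ ¬ IsTotallyReal (halfBall n hn α) ∧
      ¬ IsComplexSub (halfBall n hn α)) ∧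
    ∃ C : ℝ, 0 < C ∧ ∀ Γ : Subgroup (SU n),
      DiscreteTopology Γ → ActsFreely Γ → CompactSpace (BallQuotient Γ) →
      ∀ p₀ ∈ ball n, halfBall n hn α ⊆ dirichlet Γ p₀ →
      0 < setDist (halfBall n hn α) (frontier (dirichlet Γ p₀) ∩ ball n) →
      ∀ (m : ℕ) (ρ : Γ →* Matrix.unitaryGroup (Fin m) ℂ) (j : Fin m),
        (∀ᶠ k : ℕ in atTop,
          (∀ z ∈ ball n, ∀ p ∈ halfBall n hn α, Summable (thetaTerm Γ ρ j k z p)) ∧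
          (∀ z ∈ ball n, Integrable (thetaIntegrand Γ ρ j k z) (halfBallMeasure n α)) ∧
          IsAutomorphicForm Γ ρ k (thetaSub Γ ρ j k (halfBallMeasure n α)) ∧
          IntegrableOn (innerDensity k (thetaSub Γ ρ j k (halfBallMeasure n α))
            (thetaSub Γ ρ j k (halfBallMeasure n α))) (dirichlet Γ p₀) ∧
          ‖innerProd Γ p₀ k (thetaSub Γ ρ j k (halfBallMeasure n α))
            (thetaSub Γ ρ j k (halfBallMeasure n α))‖ ≤ C * (k : ℝ) ^ ((n : ℝ) - 2)) ∧
        ∀ c : ℝ, c ≠ 0 → ¬ Asymptotics.IsEquivalent atTop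
          (fun k : ℕ => (innerProd Γ p₀ k (thetaSub Γ ρ j k (halfBallMeasure n α))
            (thetaSub Γ ρ j k (halfBallMeasure n α))).re)
          (fun k : ℕ => c * (k : ℝ) ^ ((n : ℝ) - 3 / 2)) := by
  refine ⟨⟨isCRSubmanifold_halfBall hn hα₀ hα₁, not_isTotallyReal_halfBall hn hα₀ hα₁,
    not_isComplexSub_halfBall hn hα₀ hα₁⟩, normConst n, normConst_pos (by omega), ?_⟩
  intro Γ _ _ hcpt p₀ hp₀ hsub hdist m ρ j
  have hcl : closure (halfBall n hn α) ⊆ ball n := fun z hz =>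
    mem_ball_iff_nrm.2 ((closure_halfBall_subset hn hα₀ hα₁ hz).trans_lt hα₁)
  have hX := closure_subset_interior_of_setDist_pos hcl hsub hdist
  have hΓ := summable_inv_norm_den hp₀
    (((halfBall_nonempty hn hα₀ hα₁).mono subset_closure).mono hX)
  obtain ⟨r, hr0, hr1, hr⟩ := exists_nrm_le_of_mem_dirichlet Γ hp₀
  have hbound := eventually_norm_innerProd_le ρ j hn hα₀ hα₁ hΓ hp₀ hX hr0 hr1 hr
  -- The non-asymptotic statement is a consequence of the bound, since `n - 2 < n - 3/2`.
  refine ⟨?_, fun c hc => not_isEquivalent_of_le_rpow (by linarith) hc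
    (hbound.mono fun k hk => (Complex.abs_re_le_norm _).trans hk)⟩
  filter_upwards [eventually_ge_atTop 2, hbound] with k hk hb
  exact ⟨fun z hz p hp => summable_thetaTerm ρ j hΓ hk hz hp.1,
    fun z hz => integrable_thetaIntegrand ρ j hn hα₀ hα₁ hΓ hk hz,
    isAutomorphicForm_thetaSub ρ j hn hα₀ hα₁ hΓ hk,
    integrableOn_innerDensity_thetaSub ρ j hn hα₀ hα₁ hΓ hk hr1 hr, hb⟩
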